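/- **Setting.** An (unweighted) coordination game $\mathcal G(G,C,\beta)$ is given by a directed graph $G=(V,E)$ without self loops, a finite set $M$ of colours, a nonempty set $C(i)\subseteq M$ of available colours for each node $i$, and integer bonuses $\beta(i,c)$. The players are the nodes; node $i$ chooses $s(i)\in C(i)$ and receives the payoff $p_i(s)=|\{k : (k\to i)\in E,\ s(k)=s(i)\}|+\beta(i,s(i))$. NE means pure Nash equilibrium. A query is a function $q:Q\to M$ on a nonempty set $Q\subseteq V$ with $q(i)\in C(i)$; it is consistent with $s$ if $q(i)=s(i)$ for all $i\in Q$. The problem $\forall$NE asks whether every NE is consistent with $q$. Put $n=|V|$, $m=|M|$, $e=|E|$ and $|G|=nm+e$. Running time is the number of elementary operations (memory accesses, additions, subtractions, comparisons, assignments, tests) of a program on integer variables and arrays, each at unit cost. **Algorithm.** Sort $V$ topologically into $i_1,\dots,i_n$. For $j=1,\dots,n$, with $v=i_j$: 1. Put $X(v):=\emptyset$ and let $Y$ be the family $(X(k))_{k\to v}$, indexed by the predecessors of $v$. For each $c\in C(v)$ do the following, with the convention that in (b) and (c) unavailable colours $c'\notin C(v)$ have bonus $\beta(v,c')=-\infty$.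 - (a) Let $S$ be the subfamily of those $Z\in Y$ with $c\in Z$; put $C':=M\setminus\{c\}$ and $Y':=Y\setminus S$. - (b) If some $c'\in C'$ has $|S|+\beta(v,c)-\beta(v,c')<0$, continue with the next $c$. - (c) While some $c'\in C'$ has $|S|+\beta(v,c)-\beta(v,c')\ge |Y'|$, remove $c'$ from $C'$ and remove from $Y'$ all members that contain $c'$. - (d) Consider the bipartite graph with left nodes the members of $Y'$, right nodes $(c',x)$ with $c'\in C'$ and $1\le x\le |S|+\beta(v,c)-\beta(v,c')$, and an edge between $Z$ and $(c',x)$ if and only if $c'\in Z$. If its maximum matching has size $|Y'|$, add $c$ to $X(v)$. 2. If $v\in Q$ and $X(v)\ne\{q(v)\}$, return NO. After the last node, return YES. **Theorem.** Let $G$ be a directed acyclic graph in which every node has out-degree at most one. Then, whatever correct subroutines are used for the topological sort and for the comparison of the maximum matching size with $|Y'|$, the algorithm halts and solves $\forall$NE: it returns YES if and only if every NE is consistent with $q$, and it returns NO if and only if some queried node $i\in Q$ has a colour different from $q(i)$ in some NE. Moreover, for every node $i$ processed before the algorithm stops, $X(i)$ is exactly the set of colours that $i$ has in the Nash equilibria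 of the game. With suitable subroutines the algorithm runs in time $O(|G|^{2.5})$, where the constant is absolute (it depends neither on the graph, the number of colours, the bonuses nor the query). -/

import Mathlib

namespace CoordDag

/-! ### Unweighted coordination games on directed graphs -/

/-- An unweighted coordination game: a directed graph `(V, E)` without self loops on
`V = Fin n`, a nonempty set of available colours `C i ⊆ M = Fin m` for every node and integer
bonuses. -/
structure Game (n m : ℕ) where
  /-- the edges; `(i, j) ∈ E` is the edge `i → j` -/
  E : Finset (Fin n × Fin n)
  loopless : ∀ i, (i, i) ∉ E
  C : Fin n → Finset (Fin m)
  nonempty : ∀ i, (C i).Nonempty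
  bonus : Fin n → Fin m → ℤ

variable {n m : ℕ}

/-- The payoff of node `i`: the number of predecessors with the same colour, plus the bonus. -/
def Game.payoff (G : Game n m) (s : Fin n → Fin m) (i : Fin n) : ℤ :=
  ((Finset.univ.filter fun j => (j, i) ∈ G.E ∧ s j = s i).card : ℤ) + G.bonus i (s i)

/-- A joint strategy chooses an available colour for every node. -/
def Game.IsJointStrategy (G : Game n m) (s : Fin n → Fin m) : Prop :=
  ∀ i, s i ∈ G.C i

/-- `s` is a pure Nash equilibrium: a joint strategy with no profitable deviation. -/
def Game.IsNash (G : Game n m) (s : Fin n → Fin m) : Prop :=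
  G.IsJointStrategy s ∧
    ∀ i, ∀ x ∈ G.C i, G.payoff (Function.update s i x) i ≤ G.payoff s i

/-- A directed graph is acyclic if no node can be reached from itself by a nonempty path. -/
def IsAcyclic (E : Finset (Fin n × Fin n)) : Prop :=
  ∀ i, ¬ Relation.TransGen (fun a b => (a, b) ∈ E) i i

/-- Every node has at most one outgoing edge. -/
def OutDegreeLeOne (E : Finset (Fin n × Fin n)) : Prop :=
  ∀ i, (E.filter fun p => p.1 = i).card ≤ 1

/-- The size `|G| = n m + e` of the input. -/
def Game.size (G : Game n m) : ℕ := n * m + G.E.card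

/-- A query `q : Q → M` on a nonempty set `Q` of nodes, with `q i ∈ C i`. -/
structure Query (G : Game n m) where
  Q : Finset (Fin n)
  nonempty : Q.Nonempty
  q : Q → Fin m
  mem : ∀ i : Q, q i ∈ G.C i

/-- The query is consistent with `s`. -/
def Query.Consistent {G : Game n m} (q : Query G) (s : Fin n → Fin m) : Prop :=
  ∀ i : q.Q, q.q i = s i

/-! ### Maximum matchings in bipartite graphs -/

/-- `N` is a matching of the bipartite graph with edge set `F`: a set of edges, no two of which
share an end. -/
def IsMatching {α β : Type} (F N : Finset (α × β)) : Prop :=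
  N ⊆ F ∧ ∀ a ∈ N, ∀ b ∈ N, (a.1 = b.1 ∨ a.2 = b.2) → a = b

open Classical in
/-- The size of a maximum matching of the bipartite graph with edge set `F`. -/
noncomputable def maxMatching {α β : Type} (F : Finset (α × β)) : ℕ :=
  (F.powerset.filter fun N => IsMatching F N).sup Finset.card

/-! ### An imperative language with a step count

Programs work on integer variables and two-dimensional integer arrays. The only arithmetic
operations are addition and subtraction. Every constant, memory access, arithmetic operation,
comparison and connective, every write and every test costs one unit. -/

/-- The variables; `tmp k` are scratch variables for subroutines. -/
inductive Var
  | n | m | e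
  | j | v | k | c | d
  | sizeS | sizeY | skip | changed | found | ans
  | tmp (k : ℕ)
  deriving DecidableEq

/-- The arrays; `tmp k` are scratch arrays for subroutines. -/
inductive Arr
  | src | dst | avail | bonus | query
  | ord | X | Y | Yp | Cp
  | tmp (k : ℕ)
  deriving DecidableEq

/-- The content of the memory. -/
structure Store where
  var : Var → ℤ
  arr : Arr → ℤ → ℤ → ℤ

def Store.setVar (s : Store) (x : Var) (z : ℤ) : Store :=
  { s with var := Function.update s.var x z }

def Store.setArr (s : Store) (a : Arr) (i j z : ℤ) : Store :=
  { s with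
    arr := Function.update s.arr a
      (Function.update (s.arr a) i (Function.update (s.arr a i) j z)) }

/-- Integer expressions. -/
inductive Expr
  | lit (z : ℤ)
  | var (x : Var)
  | get (a : Arr) (i j : Expr)
  | add (a b : Expr)
  | sub (a b : Expr)

def Expr.eval (s : Store) : Expr → ℤ
  | lit z => z
  | var x => s.var x
  | get a i j => s.arr a (i.eval s) (j.eval s)
  | add a b => a.eval s + b.eval s
  | sub a b => a.eval s - b.eval s

def Expr.cost : Expr → ℕ
  | lit _ => 1
  | var _ => 1
  | get _ i j => i.cost + j.cost + 1
  | add a b => a.cost + b.cost + 1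
  | sub a b => a.cost + b.cost + 1

/-- Tests. -/
inductive Test
  | lt (a b : Expr)
  | eq (a b : Expr)
  | and (p q : Test)
  | or (p q : Test)
  | not (p : Test)

def Test.Holds (s : Store) : Test → Prop
  | lt a b => a.eval s < b.eval s
  | eq a b => a.eval s = b.eval s
  | and p q => p.Holds s ∧ q.Holds s
  | or p q => p.Holds s ∨ q.Holds s
  | not p => ¬ p.Holds s

def Test.cost : Test → ℕ
  | lt a b => a.cost + b.cost + 1
  | eq a b => a.cost + b.cost + 1
  | and p q => p.cost + q.cost + 1
  | or p q => p.cost + q.cost + 1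
  | not p => p.cost + 1

/-- Programs. -/
inductive Prog
  | nop
  | assign (x : Var) (a : Expr)
  | store (a : Arr) (i j b : Expr)
  | seq (P R : Prog)
  | ite (p : Test) (P R : Prog)
  | while (p : Test) (P : Prog)

/-- `Exec P s t s₁`: started with memory `s`, the program `P` halts after `t` steps with
memory `s₁`. -/
inductive Exec : Prog → Store → ℕ → Store → Prop
  | nop (s : Store) : Exec .nop s 1 s
  | assign (x : Var) (a : Expr) (s : Store) :
      Exec (.assign x a) s (a.cost + 1) (s.setVar x (a.eval s))
  | store (a : Arr) (i j b : Expr) (s : Store) :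
      Exec (.store a i j b) s (i.cost + j.cost + b.cost + 1)
        (s.setArr a (i.eval s) (j.eval s) (b.eval s))
  | seq {P R : Prog} {s s₁ s₂ : Store} {t₁ t₂ : ℕ} :
      Exec P s t₁ s₁ → Exec R s₁ t₂ s₂ → Exec (.seq P R) s (t₁ + t₂) s₂
  | ite_true {p : Test} {P R : Prog} {s s₁ : Store} {t : ℕ} :
      p.Holds s → Exec P s t s₁ → Exec (.ite p P R) s (p.cost + 1 + t) s₁
  | ite_false {p : Test} {P R : Prog} {s s₁ : Store} {t : ℕ} :
      ¬ p.Holds s → Exec R s t s₁ → Exec (.ite p P R) s (p.cost + 1 + t) s₁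
  | while_false {p : Test} {P : Prog} {s : Store} :
      ¬ p.Holds s → Exec (.while p P) s (p.cost + 1) s
  | while_true {p : Test} {P : Prog} {s s₁ s₂ : Store} {t₁ t₂ : ℕ} :
      p.Holds s → Exec P s t₁ s₁ → Exec (.while p P) s₁ t₂ s₂ →
        Exec (.while p P) s (p.cost + 1 + t₁ + t₂) s₂

infixr:30 " ;; " => Prog.seq
infix:35 " ≔ " => Prog.assign

/-- `a[i]` for a one-dimensional array, kept in column `0`. -/
def Expr.get1 (a : Arr) (i : Expr) : Expr := .get a i (.lit 0)

/-- `a[i] := b` for a one-dimensional array. -/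
def Prog.store1 (a : Arr) (i b : Expr) : Prog := .store a i (.lit 0) b

/-- `if p then P`. -/
def Prog.when (p : Test) (P : Prog) : Prog := .ite p P .nop

/-- `for x := 0, …, b - 1 do P`. -/
def Prog.for (x b : Var) (P : Prog) : Prog :=
  x ≔ .lit 0 ;;
  .while (.lt (.var x) (.var b)) (P ;; x ≔ .add (.var x) (.lit 1))

/-! ### The input -/

/-- The memory holds the number `n` of nodes and, in some order and without repetition, a list
of the edges: the `k`-th edge goes from `src[k]` to `dst[k]`. -/
def Store.HasGraph (s : Store) (E : Finset (Fin n × Fin n)) : Prop :=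
  s.var .n = n ∧ s.var .e = E.card ∧
    ∃ l : List (Fin n × Fin n), l.Nodup ∧ l.toFinset = E ∧
      ∀ (k : ℕ) (h : k < l.length),
        s.arr .src k 0 = (l[k].1 : ℕ) ∧ s.arr .dst k 0 = (l[k].2 : ℕ)

/-- The memory holds the game and the query; `query[i] = -1` means that `i` is not queried.
Nothing is assumed about the rest of the memory. -/
structure Store.HasInput (s : Store) (G : Game n m) (q : Query G) : Prop where
  graph : s.HasGraph G.E
  colours : s.var .m = m
  avail : ∀ (i : Fin n) (c : Fin m),
    s.arr .avail (i : ℕ) (c : ℕ) = if c ∈ G.C i then 1 else 0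
  bonus : ∀ (i : Fin n) (c : Fin m), s.arr .bonus (i : ℕ) (c : ℕ) = G.bonus i c
  query : ∀ i : q.Q, s.arr .query (i.1 : ℕ) 0 = (q.q i : ℕ)
  noQuery : ∀ i : Fin n, i ∉ q.Q → s.arr .query (i : ℕ) 0 = -1

/-! ### The two subroutines -/

/-- `s₁` agrees with `s` except in the scratch memory and in the variables and arrays that
satisfy `out` and `outArr`. -/
def Store.Preserved (s s₁ : Store) (out : Var → Prop) (outArr : Arr → Prop) : Prop :=
  (∀ x, (∀ k, x ≠ .tmp k) → ¬ out x → s₁.var x = s.var x) ∧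
    (∀ a, (∀ k, a ≠ .tmp k) → ¬ outArr a → s₁.arr a = s.arr a)

/-- `P` sorts acyclic graphs topologically into the sequence `ord[0], …, ord[n - 1]`. -/
def IsTopologicalSort (P : Prog) : Prop :=
  ∀ (n : ℕ) (E : Finset (Fin n × Fin n)) (s : Store), IsAcyclic E → s.HasGraph E →
    ∃ (t : ℕ) (s₁ : Store), Exec P s t s₁ ∧
      (∃ σ : Fin n ≃ Fin n, (∀ k : Fin n, s₁.arr .ord (k : ℕ) 0 = (σ k : ℕ)) ∧
        ∀ p ∈ E, σ.symm p.1 < σ.symm p.2) ∧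
      s.Preserved s₁ (fun _ => False) (fun a => a = .ord)

/-- The number `|S| + β(v, c) - β(v, d)` of copies of the colour `d`. -/
def Store.copies (s : Store) (d : ℕ) : ℤ :=
  s.var .sizeS + s.arr .bonus (s.var .v) (s.var .c) - s.arr .bonus (s.var .v) d

/-- The current set of remaining predecessors (each one stands for its set of colours). -/
def Store.left (s : Store) : Finset ℕ :=
  (Finset.range (s.var .n).toNat).filter fun k : ℕ => s.arr .Yp k 0 = 1

/-- The copies `(d, x)`, `1 ≤ x ≤ |S| + β(v, c) - β(v, d)`, of the remaining colours `d`. -/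
def Store.right (s : Store) : Finset (Σ _ : ℕ, ℕ) :=
  ((Finset.range (s.var .m).toNat).filter fun d : ℕ => s.arr .Cp d 0 = 1).sigma
    fun d : ℕ => Finset.Icc 1 (s.copies d).toNat

/-- The edges of the bipartite graph: `k` is joined to `(d, x)` if and only if `d ∈ X(k)`. -/
def Store.bipartite (s : Store) : Finset (ℕ × Σ _ : ℕ, ℕ) :=
  (s.left ×ˢ s.right).filter fun p => s.arr .X p.1 p.2.1 = 1

/-- `P` finds out whether a maximum matching of the bipartite graph has as many edges as there
are left nodes. -/
def IsMatchingTest (P : Prog) : Prop :=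
  ∀ s : Store, ∃ (t : ℕ) (s₁ : Store), Exec P s t s₁ ∧
    (s₁.var .found = 1 ↔ maxMatching s.bipartite = s.left.card) ∧
    s.Preserved s₁ (fun x => x = .found) (fun _ => False)

/-! ### The algorithm -/

/-- `|S| + β(v, c) - β(v, d)`. -/
def copiesExpr : Expr :=
  .sub (.add (.var .sizeS) (.get .bonus (.var .v) (.var .c))) (.get .bonus (.var .v) (.var .d))

/-- The test `d ∈ C(v)`. -/
def availTest : Test := .eq (.get .avail (.var .v) (.var .d)) (.lit 1)

/-- `S := {Z ∈ Y | c ∈ Z}`, of which only the size is kept, and `Y' := Y \ S`. The members of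
`Y` are indexed by the predecessors of `v`. -/
def splitY : Prog :=
  .sizeS ≔ .lit 0 ;;
  .sizeY ≔ .lit 0 ;;
  .for .k .n
    (.store1 .Yp (.var .k) (.lit 0) ;;
     .when (.eq (.get1 .Y (.var .k)) (.lit 1))
      (.ite (.eq (.get .X (.var .k) (.var .c)) (.lit 1))
        (.sizeS ≔ .add (.var .sizeS) (.lit 1))
        (.store1 .Yp (.var .k) (.lit 1) ;;
         .sizeY ≔ .add (.var .sizeY) (.lit 1))))

/-- `C' := M \ {c}`. -/
def initColours : Prog :=
  .for .d .m
    (.ite (.eq (.var .d) (.var .c))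
      (.store1 .Cp (.var .d) (.lit 0))
      (.store1 .Cp (.var .d) (.lit 1)))

/-- Does some `d ∈ C'` satisfy `|S| + β(v, c) - β(v, d) < 0`? Unavailable colours have bonus
`-∞`, so only available ones count. -/
def checkSkip : Prog :=
  .skip ≔ .lit 0 ;;
  .for .d .m
    (.when (.and (.eq (.get1 .Cp (.var .d)) (.lit 1))
        (.and availTest (.lt copiesExpr (.lit 0))))
      (.skip ≔ .lit 1))

/-- As long as some `d ∈ C'` satisfies `|S| + β(v, c) - β(v, d) ≥ |Y'|` (which unavailable
colours, with bonus `-∞`, always do), remove `d` from `C'` and all sets that contain `d` from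
`Y'`. The colours are scanned cyclically until one scan removes nothing. -/
def pruneColours : Prog :=
  .changed ≔ .lit 1 ;;
  .while (.eq (.var .changed) (.lit 1))
    (.changed ≔ .lit 0 ;;
     .for .d .m
      (.when (.and (.eq (.get1 .Cp (.var .d)) (.lit 1))
          (.or (.not availTest) (.not (.lt copiesExpr (.var .sizeY)))))
        (.changed ≔ .lit 1 ;;
         .store1 .Cp (.var .d) (.lit 0) ;;
         .for .k .n
          (.when (.and (.eq (.get1 .Yp (.var .k)) (.lit 1))
              (.eq (.get .X (.var .k) (.var .d)) (.lit 1)))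
            (.store1 .Yp (.var .k) (.lit 0) ;;
             .sizeY ≔ .sub (.var .sizeY) (.lit 1))))))

/-- One pass of the inner loop: decide whether to add the colour `c` to `X(v)`. -/
def tryColour (matching : Prog) : Prog :=
  splitY ;;
  initColours ;;
  checkSkip ;;
  .when (.eq (.var .skip) (.lit 0))
    (pruneColours ;;
     matching ;;
     .when (.eq (.var .found) (.lit 1))
      (.store .X (.var .v) (.var .c) (.lit 1)))

/-- Compute `X(v)` from the sets `X(k)` of the predecessors `k` of `v`. -/
def computeX (matching : Prog) : Prog :=
  .for .c .m (.store .X (.var .v) (.var .c) (.lit 0)) ;;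
  .for .k .n (.store1 .Y (.var .k) (.lit 0)) ;;
  .for .k .e
    (.when (.eq (.get1 .dst (.var .k)) (.var .v))
      (.store1 .Y (.get1 .src (.var .k)) (.lit 1))) ;;
  .for .c .m
    (.when (.eq (.get .avail (.var .v) (.var .c)) (.lit 1)) (tryColour matching))

/-- If `v ∈ Q` and `X(v) ≠ {q(v)}`, the answer is NO (`0`). -/
def checkQuery : Prog :=
  .when (.not (.lt (.get1 .query (.var .v)) (.lit 0)))
    (.for .c .m
      (.ite (.eq (.var .c) (.get1 .query (.var .v)))
        (.when (.not (.eq (.get .X (.var .v) (.var .c)) (.lit 1))) (.ans ≔ .lit 0))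
        (.when (.eq (.get .X (.var .v) (.var .c)) (.lit 1)) (.ans ≔ .lit 0))))

/-- The algorithm for the question whether all Nash equilibria are consistent with the query,
on top of a subroutine for topological sorting and one for maximum bipartite matchings. The
answer is the final value of `ans`: `1` is YES and `0` is NO. A NO stops the main loop. -/
def algorithm (topsort matching : Prog) : Prog :=
  topsort ;;
  .ans ≔ .lit 1 ;;
  .j ≔ .lit 0 ;;
  .while (.and (.lt (.var .j) (.var .n)) (.eq (.var .ans) (.lit 1)))
    (.v ≔ .get1 .ord (.var .j) ;;
     computeX matching ;;
     checkQuery ;;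
     .j ≔ .add (.var .j) (.lit 1))

/-- The final memory `s` is right for the given game and query: the answer is YES exactly when
all Nash equilibria are consistent with the query, it is NO exactly when some queried node has
another colour in some Nash equilibrium, and for all nodes `i = ord[k]` that were processed,
`X(i)` is the set of the colours of `i` in the Nash equilibria. -/
def Store.Correct (s : Store) (G : Game n m) (q : Query G) : Prop :=
  (s.var .ans = 1 ↔ ∀ σ, G.IsNash σ → q.Consistent σ) ∧
  (s.var .ans = 0 ↔ ∃ i : q.Q, ∃ σ, G.IsNash σ ∧ σ i ≠ q.q i) ∧
  ∀ (i : Fin n) (k : ℕ), (k : ℤ) < s.var .j → s.arr .ord k 0 = (i : ℕ) →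
    ∀ c : Fin m, s.arr .X (i : ℕ) (c : ℕ) = 1 ↔ ∃ σ, G.IsNash σ ∧ σ i = c

end CoordDag

namespace CoordDag

/-! ### Total correctness with running times -/

/-! Whether a node is stable depends only on its own colour and on those of its predecessors. Along
a topological order, any colouring that is stable on an initial segment therefore extends to an
equilibrium: each further node takes a best response (`Game.exists_isNash_extend`). In particular
equilibria exist. If every node has at most one successor, the parts of the graph that lead to
different predecessors of `v` are disjoint, so the predecessors can be given equilibrium colours
independently of each other. Hence `v` has the colour `c` in some equilibrium if and only if `c` is
a best response to some choice of colours from the sets of the predecessors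
(`Game.exists_isNash_iff_supports`).

To decide the latter, let every predecessor that can choose `c` do so: this makes the payoff of `c`
as large as possible and burdens no other colour. The others must be distributed so that an
available colour `d` gets at most `|S| + β(v, c) - β(v, d)` of them, and an unavailable one any
number (`exists_best_iff_assignable`). A colour that can take all remaining predecessors may be
removed together with those that can choose it (`assignable_erase_iff`). After pruning only
available colours are left, whose capacities are nonnegative by test (b), and a distribution is the
same as a matching that covers all left nodes (`maxMatching_eq_card_iff`).

For the time bound, predecessors are matched one by one by augmenting paths. A search round costs
`O(n m)`. Each round except the last marks a colour, and every marked colour except at most one is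
full and hence used by some left node, so there are `O(min(n, m))` rounds (`SearchInv.card_le`).
Augmentations are charged to edges: each of the `e ≤ n` edges pays for at most one for each of the
`m` colours. This gives `O((n m)² min(n, m))`, and `min(n, m) ≤ √(n m)`. Sorting, pruning and the
other scans cost only `O((n m)²)`.

Both halves of the theorem come from one proof, `algorithm_spec`: its time bounds are conditional on
a proposition `b`, which is false for arbitrary subroutines and true for the concrete ones. -/

/-- Started with memory `s`, the program `P` halts, and `Q t s₁` holds for its running time `t`
and the final memory `s₁`. -/
def WP (P : Prog) (s : Store) (Q : ℕ → Store → Prop) : Prop :=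
  ∃ t s₁, Exec P s t s₁ ∧ Q t s₁

/-- Does the program contain an assignment to the variable `y`? -/
def Prog.writesVar : Prog → Var → Bool
  | nop, _ => false
  | assign x _, y => decide (y = x)
  | store _ _ _ _, _ => false
  | seq P R, y => P.writesVar y || R.writesVar y
  | ite _ P R, y => P.writesVar y || R.writesVar y
  | Prog.while _ P, y => P.writesVar y

/-- Does the program contain an assignment to an entry of the array `b`? -/
def Prog.writesArr : Prog → Arr → Bool
  | nop, _ => false
  | assign _ _, _ => false
  | store a _ _ _, b => decide (b = a)
  | seq P R, b => P.writesArr b || R.writesArr b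
  | ite _ P R, b => P.writesArr b || R.writesArr b
  | Prog.while _ P, b => P.writesArr b

/-- `s₁` agrees with `s` on all variables and arrays that `P` does not write. -/
def Frame (P : Prog) (s s₁ : Store) : Prop :=
  (∀ y, P.writesVar y = false → s₁.var y = s.var y) ∧
    ∀ a, P.writesArr a = false → s₁.arr a = s.arr a

@[simp] theorem setVar_arr (s : Store) (x : Var) (z : ℤ) : (s.setVar x z).arr = s.arr := rfl

@[simp] theorem setArr_var (s : Store) (a : Arr) (i j z : ℤ) :
    (s.setArr a i j z).var = s.var := rfl

theorem setVar_var (s : Store) (x y : Var) (z : ℤ) :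
    (s.setVar x z).var y = if y = x then z else s.var y := by
  simp [Store.setVar, Function.update_apply]

theorem setArr_arr (s : Store) (a b : Arr) (i j z i' j' : ℤ) :
    (s.setArr a i j z).arr b i' j' =
      if b = a ∧ i' = i ∧ j' = j then z else s.arr b i' j' := by
  by_cases hb : b = a
  · subst hb
    by_cases hi : i' = i
    · subst hi
      simp [Store.setArr, Function.update_apply]
    · simp [Store.setArr, hi]
  · simp [Store.setArr, hb]

theorem setArr_arr_of_ne (s : Store) {a b : Arr} (h : b ≠ a) (i j z : ℤ) :
    (s.setArr a i j z).arr b = s.arr b := by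
  simp [Store.setArr, h]

/-- For a concrete program `writesVar` and `writesArr` compute, so that unchanged memory is
recognised by `rfl`. For unknown subroutines `Store.Preserved` takes this role. -/
theorem Frame.of_exec {P : Prog} {s s₁ : Store} {t : ℕ} (h : Exec P s t s₁) : Frame P s s₁ := by
  induction h with
  | nop s => exact ⟨fun _ _ => rfl, fun _ _ => rfl⟩
  | assign x a s =>
    refine ⟨fun y hy => ?_, fun _ _ => rfl⟩
    simp only [Prog.writesVar, decide_eq_false_iff_not] at hy
    simp [setVar_var, hy]
  | store a i j b s =>
    refine ⟨fun _ _ => rfl, fun c hc => ?_⟩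
    simp only [Prog.writesArr, decide_eq_false_iff_not] at hc
    exact setArr_arr_of_ne _ hc _ _ _
  | seq _ _ ih₁ ih₂ =>
    refine ⟨fun y hy => ?_, fun a ha => ?_⟩
    · simp only [Prog.writesVar, Bool.or_eq_false_iff] at hy
      rw [ih₂.1 y hy.2, ih₁.1 y hy.1]
    · simp only [Prog.writesArr, Bool.or_eq_false_iff] at ha
      rw [ih₂.2 a ha.2, ih₁.2 a ha.1]
  | ite_true _ _ ih =>
    refine ⟨fun y hy => ?_, fun a ha => ?_⟩
    · simp only [Prog.writesVar, Bool.or_eq_false_iff] at hy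
      exact ih.1 y hy.1
    · simp only [Prog.writesArr, Bool.or_eq_false_iff] at ha
      exact ih.2 a ha.1
  | ite_false _ _ ih =>
    refine ⟨fun y hy => ?_, fun a ha => ?_⟩
    · simp only [Prog.writesVar, Bool.or_eq_false_iff] at hy
      exact ih.1 y hy.2
    · simp only [Prog.writesArr, Bool.or_eq_false_iff] at ha
      exact ih.2 a ha.2
  | while_false _ => exact ⟨fun _ _ => rfl, fun _ _ => rfl⟩
  | while_true _ _ _ ih₁ ih₂ =>
    refine ⟨fun y hy => ?_, fun a ha => ?_⟩
    · rw [ih₂.1 y hy, ih₁.1 y hy]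
    · rw [ih₂.2 a ha, ih₁.2 a ha]

theorem Frame.refl (P : Prog) (s : Store) : Frame P s s := ⟨fun _ _ => rfl, fun _ _ => rfl⟩

theorem Frame.trans {P : Prog} {s s₁ s₂ : Store} (h : Frame P s s₁) (h' : Frame P s₁ s₂) :
    Frame P s s₂ :=
  ⟨fun y hy => (h'.1 y hy).trans (h.1 y hy), fun a ha => (h'.2 a ha).trans (h.2 a ha)⟩

/-- The rule of consequence. The frame condition is handed to the continuation, so specifications
need not mention untouched memory. -/
theorem WP.mono {P : Prog} {s : Store} {Q Q' : ℕ → Store → Prop} (h : WP P s Q)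
    (hQ : ∀ t s₁, Frame P s s₁ → Q t s₁ → Q' t s₁) : WP P s Q' := by
  obtain ⟨t, s₁, he, hq⟩ := h
  exact ⟨t, s₁, he, hQ t s₁ (Frame.of_exec he) hq⟩

/-- Hides the postcondition of a goal from `simp`. -/
theorem WP.intro {P : Prog} {s : Store} {R : ℕ → Store → Prop}
    (h : ∀ Q : ℕ → Store → Prop, (∀ t s₁, R t s₁ → Q t s₁) → WP P s Q) : WP P s R :=
  h R fun _ _ => id

@[simp] theorem WP_nop {s : Store} {Q : ℕ → Store → Prop} : WP .nop s Q ↔ Q 1 s := by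
  constructor
  · rintro ⟨t, s₁, he, hq⟩
    cases he
    exact hq
  · intro h
    exact ⟨_, _, .nop s, h⟩

@[simp] theorem WP_assign {x : Var} {a : Expr} {s : Store} {Q : ℕ → Store → Prop} :
    WP (.assign x a) s Q ↔ Q (a.cost + 1) (s.setVar x (a.eval s)) := by
  constructor
  · rintro ⟨t, s₁, he, hq⟩
    cases he
    exact hq
  · intro h
    exact ⟨_, _, .assign x a s, h⟩

@[simp] theorem WP_store {a : Arr} {i j b : Expr} {s : Store} {Q : ℕ → Store → Prop} :
    WP (.store a i j b) s Q ↔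
      Q (i.cost + j.cost + b.cost + 1) (s.setArr a (i.eval s) (j.eval s) (b.eval s)) := by
  constructor
  · rintro ⟨t, s₁, he, hq⟩
    cases he
    exact hq
  · intro h
    exact ⟨_, _, .store a i j b s, h⟩

@[simp] theorem WP_store1 {a : Arr} {i b : Expr} {s : Store} {Q : ℕ → Store → Prop} :
    WP (.store1 a i b) s Q ↔
      Q (i.cost + 1 + b.cost + 1) (s.setArr a (i.eval s) 0 (b.eval s)) := by
  simp [Prog.store1, Expr.cost, Expr.eval]

@[simp] theorem WP_seq {P R : Prog} {s : Store} {Q : ℕ → Store → Prop} :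
    WP (.seq P R) s Q ↔ WP P s fun t₁ s₁ => WP R s₁ fun t₂ s₂ => Q (t₁ + t₂) s₂ := by
  constructor
  · rintro ⟨t, s₁, he, hq⟩
    cases he with
    | seq h₁ h₂ => exact ⟨_, _, h₁, _, _, h₂, hq⟩
  · rintro ⟨_, _, h₁, _, _, h₂, hq⟩
    exact ⟨_, _, .seq h₁ h₂, hq⟩

@[simp] theorem WP_ite {p : Test} {P R : Prog} {s : Store} {Q : ℕ → Store → Prop} :
    WP (.ite p P R) s Q ↔
      (p.Holds s → WP P s fun t => Q (p.cost + 1 + t)) ∧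
        (¬ p.Holds s → WP R s fun t => Q (p.cost + 1 + t)) := by
  constructor
  · rintro ⟨t, s₁, he, hq⟩
    cases he with
    | ite_true h₁ h₂ => exact ⟨fun _ => ⟨_, _, h₂, hq⟩, fun h => absurd h₁ h⟩
    | ite_false h₁ h₂ => exact ⟨fun h => absurd h h₁, fun _ => ⟨_, _, h₂, hq⟩⟩
  · rintro ⟨h₁, h₂⟩
    by_cases hp : p.Holds s
    · obtain ⟨t, s₁, he, hq⟩ := h₁ hp
      exact ⟨_, _, .ite_true hp he, hq⟩
    · obtain ⟨t, s₁, he, hq⟩ := h₂ hp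
      exact ⟨_, _, .ite_false hp he, hq⟩

@[simp] theorem WP_when {p : Test} {P : Prog} {s : Store} {Q : ℕ → Store → Prop} :
    WP (.when p P) s Q ↔
      (p.Holds s → WP P s fun t => Q (p.cost + 1 + t)) ∧
        (¬ p.Holds s → Q (p.cost + 2) s) := by
  simp [Prog.when, add_assoc]

attribute [simp] Test.Holds Expr.eval Expr.get1 Test.cost Expr.cost setVar_var

/-- The rule for `while` with an invariant that may refer to the elapsed time and to a variant
that decreases. -/
theorem WP_while {p : Test} {P : Prog} {s : Store} {Q : ℕ → Store → Prop}
    (I : ℕ → ℕ → Store → Prop) {k₀ : ℕ} (h0 : I 0 k₀ s)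
    (hstep : ∀ t k s', Frame P s s' → I t k s' → p.Holds s' →
      WP P s' fun t' s₁ => ∃ k' < k, I (t + (p.cost + 1) + t') k' s₁)
    (hend : ∀ t k s', Frame P s s' → I t k s' → ¬ p.Holds s' → Q (t + (p.cost + 1)) s') :
    WP (.while p P) s Q := by
  -- Here `t` is the time already spent in earlier rounds, and the remaining run is analysed by
  -- strong induction on the variant `k`.
  suffices H : ∀ k t s', Frame P s s' → I t k s' →
      WP (.while p P) s' fun t' s₁ => Q (t + t') s₁ by
    simpa using H _ 0 s (Frame.refl _ _) h0
  intro k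
  induction k using Nat.strong_induction_on with
  | _ k ih =>
    intro t s' hF hI
    by_cases hp : p.Holds s'
    · obtain ⟨t', s₁, he, k', hk', hI₁⟩ := hstep t k s' hF hI hp
      obtain ⟨t₂, s₂, he₂, hQ⟩ := ih k' hk' _ s₁ (hF.trans (Frame.of_exec he)) hI₁
      refine ⟨_, _, .while_true hp he he₂, ?_⟩
      have : t + (p.cost + 1 + t' + t₂) = t + (p.cost + 1) + t' + t₂ := by omega
      simp only [this]
      exact hQ
    · exact ⟨_, _, .while_false hp, hend t k s' hF hI hp⟩

/-- The rule for `for` with an invariant that may refer to the elapsed time. -/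
theorem WP_for_of_preserved {x b : Var} {P : Prog} {s : Store} {Q : ℕ → Store → Prop}
    (I : ℕ → ℕ → Store → Prop) (hbx : b ≠ x) {N : ℕ} (hN : (s.var b).toNat = N)
    (h0 : I 0 0 (s.setVar x 0))
    (hstep : ∀ (i t : ℕ) (s' : Store), i < N → s'.var b = s.var b → s'.var x = i → I i t s' →
      WP P s' fun t' s₁ => (s₁.var x = s'.var x ∧ s₁.var b = s'.var b) ∧
        I (i + 1) (t + t' + 8) (s₁.setVar x (i + 1 : ℕ)))
    (hend : ∀ t s', I N t s' → s'.var b = s.var b → Q (t + 6) s') :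
    WP (.for x b P) s Q := by
  unfold Prog.for
  rw [WP_seq, WP_assign]
  refine WP_while (fun t k s' => ∃ i, i + k = N ∧ s'.var b = s.var b ∧
    s'.var x = i ∧ I i t s') (k₀ := N) ?_ ?_ ?_
  · exact ⟨0, by omega, by simp [hbx], by simp, h0⟩
  · rintro t k s' - ⟨i, hi, hbs, hxi, hI⟩ hp
    have hiN : i < N := by
      simp only [Test.Holds, Expr.eval, hxi, hbs] at hp
      omega
    rw [WP_seq]
    refine (hstep i t s' hiN hbs hxi hI).mono fun t₁ s₁ _ ⟨⟨hx₁, hb₁⟩, hI₁⟩ => ?_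
    simp only [WP_assign, Expr.eval, Expr.cost, Test.cost, hx₁, hxi]
    refine ⟨k - 1, by omega, i + 1, by omega, by simp [hbx, hb₁, hbs], by simp, ?_⟩
    -- The `8` per round: four units for the test and four for the increment.
    have : t + (1 + 1 + 1 + 1) + (t₁ + (1 + 1 + 1 + 1)) = t + t₁ + 8 := by omega
    rw [this]
    exact_mod_cast hI₁
  · rintro t k s' - ⟨i, hi, hbs, hxi, hI⟩ hp
    have hiN : i = N := by
      simp only [Test.Holds, Expr.eval, hxi, hbs] at hp
      omega
    subst hiN
    have := hend t s' hI hbs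
    simp only [Expr.cost, Test.cost]
    -- The `6` outside the rounds: two units for `x := 0` and four for the last test, which fails.
    have e : 1 + 1 + (t + (1 + 1 + 1 + 1)) = t + 6 := by omega
    rw [e]
    exact this

/-- The rule for `for` if the body does not write the loop variable and the bound. -/
theorem WP_for {x b : Var} {P : Prog} {s : Store} {Q : ℕ → Store → Prop}
    (I : ℕ → ℕ → Store → Prop) (hx : P.writesVar x = false) (hb : P.writesVar b = false)
    (hbx : b ≠ x) {N : ℕ} (hN : (s.var b).toNat = N) (h0 : I 0 0 (s.setVar x 0))
    (hstep : ∀ i t s', i < N → Frame (.for x b P) s s' → s'.var x = i → I i t s' →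
      WP P s' fun t' s₁ => I (i + 1) (t + t' + 8) (s₁.setVar x (i + 1 : ℕ)))
    (hend : ∀ t s', Frame (.for x b P) s s' → I N t s' → Q (t + 6) s') :
    WP (.for x b P) s Q := by
  have hset : ∀ (s₁ : Store) (z : ℤ), Frame (.for x b P) s s₁ →
      Frame (.for x b P) s (s₁.setVar x z) := by
    refine fun s₁ z hF => ⟨fun y hy => ?_, hF.2⟩
    rw [← hF.1 y hy]
    simp only [Prog.for, Prog.writesVar, Bool.or_eq_false_iff, decide_eq_false_iff_not] at hy
    simp [hy.1]
  refine WP_for_of_preserved (fun i t s' => Frame (.for x b P) s s' ∧ I i t s') hbx hN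
    ⟨hset s 0 (Frame.refl _ _), h0⟩ ?_ fun t s' h _ => hend t s' h.1 h.2
  rintro i t s' hi - hxi ⟨hF, hI⟩
  refine (hstep i t s' hi hF hxi hI).mono fun t₁ s₁ hF₁ hI₁ =>
    ⟨⟨hF₁.1 x hx, hF₁.1 b hb⟩, hset _ _ (hF.trans ⟨fun y hy => hF₁.1 y ?_,
      fun a ha => hF₁.2 a ?_⟩), hI₁⟩
  · simp only [Prog.for, Prog.writesVar, Bool.or_eq_false_iff] at hy
    exact hy.2.1
  · simpa only [Prog.for, Prog.writesArr, Bool.false_or, Bool.or_false] using ha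

/-! ### Nash equilibria on in-forests -/

section Nash

variable {n m : ℕ}

/-- The colour `s v` is available at `v` and a best response to the colours of the
predecessors. -/
def Game.BestResponse (G : Game n m) (s : Fin n → Fin m) (v : Fin n) : Prop :=
  s v ∈ G.C v ∧ ∀ x ∈ G.C v,
    ((Finset.univ.filter fun k => (k, v) ∈ G.E ∧ s k = x).card : ℤ) + G.bonus v x ≤
      ((Finset.univ.filter fun k => (k, v) ∈ G.E ∧ s k = s v).card : ℤ) + G.bonus v (s v)

/-- Without self loops, a deviation of `v` leaves the colours of its predecessors alone, so
stability can be stated without `Function.update`. -/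
theorem Game.isNash_iff (G : Game n m) (s : Fin n → Fin m) :
    G.IsNash s ↔ ∀ v, G.BestResponse s v := by
  have key : ∀ v x, G.payoff (Function.update s v x) v =
      ((Finset.univ.filter fun k => (k, v) ∈ G.E ∧ s k = x).card : ℤ) + G.bonus v x := by
    intro v x
    simp only [Game.payoff, Function.update_self]
    congr 3
    ext k
    simp only [Finset.mem_filter, Finset.mem_univ, true_and]
    refine and_congr_right fun hk => ?_
    have : k ≠ v := by
      rintro rfl
      exact G.loopless _ hk
    simp [this]
  constructor
  · rintro ⟨h₁, h₂⟩ v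
    refine ⟨h₁ v, fun x hx => ?_⟩
    rw [← key]
    exact h₂ v x hx
  · intro h
    refine ⟨fun v => (h v).1, fun v x hx => ?_⟩
    rw [key]
    exact (h v).2 x hx

theorem Game.BestResponse.congr {G : Game n m} {s s' : Fin n → Fin m} {v : Fin n}
    (h : G.BestResponse s v) (hv : s' v = s v) (hk : ∀ k, (k, v) ∈ G.E → s' k = s k) :
    G.BestResponse s' v := by
  have key : ∀ x, (Finset.univ.filter fun k => (k, v) ∈ G.E ∧ s' k = x) =
      Finset.univ.filter fun k => (k, v) ∈ G.E ∧ s k = x := by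
    intro x
    ext k
    simp only [Finset.mem_filter, Finset.mem_univ, true_and]
    exact and_congr_right fun h => by rw [hk k h]
  refine ⟨hv ▸ h.1, fun x hx => ?_⟩
  rw [key, key, hv]
  exact h.2 x hx

/-- A joint strategy that is stable on the first `j` nodes of a topological order extends to a
Nash equilibrium. -/
theorem Game.exists_isNash_extend (G : Game n m) (σ : Fin n ≃ Fin n)
    (hσ : ∀ p ∈ G.E, σ.symm p.1 < σ.symm p.2) (j : ℕ) (hj : j ≤ n) (s : Fin n → Fin m)
    (hs : ∀ i, (σ.symm i : ℕ) < j → G.BestResponse s i) :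
    ∃ s', G.IsNash s' ∧ ∀ i, (σ.symm i : ℕ) < j → s' i = s i := by
  induction hd : n - j generalizing j s with
  | zero =>
    refine ⟨s, (G.isNash_iff s).2 fun v => hs v ?_, fun _ _ => rfl⟩
    have := (σ.symm v).2
    omega
  | succ d ih =>
    have hjn : j < n := by omega
    set v := σ ⟨j, hjn⟩ with hv
    have hvj : (σ.symm v : ℕ) = j := by simp [hv]
    -- The next node of the order takes a best response. It is no predecessor of an earlier node, so
    -- those stay stable.
    obtain ⟨c, hc, hmax⟩ := Finset.exists_max_image (G.C v)
      (fun c => ((Finset.univ.filter fun k => (k, v) ∈ G.E ∧ s k = c).card : ℤ) + G.bonus v c)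
      (G.nonempty v)
    have hne : ∀ i, (σ.symm i : ℕ) < j → i ≠ v := by
      rintro i hi rfl
      omega
    obtain ⟨s', hs', hag⟩ := ih (j + 1) (by omega) (Function.update s v c) (fun i hi => by
      by_cases hiv : i = v
      · subst hiv
        have hkey : ∀ x, (Finset.univ.filter fun k => (k, v) ∈ G.E ∧
            Function.update s v c k = x) =
            Finset.univ.filter fun k => (k, v) ∈ G.E ∧ s k = x := by
          intro x
          ext k
          simp only [Finset.mem_filter, Finset.mem_univ, true_and]
          refine and_congr_right fun hk => ?_
          have : k ≠ v := by
            rintro rfl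
            exact G.loopless _ hk
          simp [this]
        refine ⟨by simpa using hc, fun x hx => ?_⟩
        rw [hkey, hkey]
        simpa using hmax x hx
      · have hij : (σ.symm i : ℕ) < j := by
          have : (σ.symm i : ℕ) ≠ j := fun h => hiv (by
            rw [hv, ← Equiv.symm_apply_eq]
            exact Fin.ext h)
          omega
        refine (hs i hij).congr (by simp [hiv]) fun k hk => ?_
        have : k ≠ v := hne k (by
          have := hσ _ hk
          simp only [Fin.lt_def] at this
          omega)
        simp [this]) (by omega)
    refine ⟨s', hs', fun i hi => ?_⟩
    rw [hag i (by omega)]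
    simp [hne i hi]

theorem Game.exists_isNash (G : Game n m) (σ : Fin n ≃ Fin n)
    (hσ : ∀ p ∈ G.E, σ.symm p.1 < σ.symm p.2) : ∃ s, G.IsNash s := by
  choose s _ using G.nonempty
  obtain ⟨s', h, _⟩ := G.exists_isNash_extend σ hσ 0 (Nat.zero_le _) s (by simp)
  exact ⟨s', h⟩

/-- The colour `c` is a best response of `v` to some colours `f k ∈ W k` of the
predecessors. -/
def Game.Supports (G : Game n m) (W : Fin n → Set (Fin m)) (v : Fin n) (c : Fin m) : Prop :=
  c ∈ G.C v ∧ ∃ f : Fin n → Fin m, (∀ k, (k, v) ∈ G.E → f k ∈ W k) ∧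
    ∀ x ∈ G.C v,
      ((Finset.univ.filter fun k => (k, v) ∈ G.E ∧ f k = x).card : ℤ) + G.bonus v x ≤
        ((Finset.univ.filter fun k => (k, v) ∈ G.E ∧ f k = c).card : ℤ) + G.bonus v c

/-- Arbitrary colours `r i ∈ W i` of the nodes without successor among the first `j` nodes
extend to a joint strategy that is stable on the first `j` nodes. -/
theorem Game.exists_stable_of_supports (G : Game n m) (σ : Fin n ≃ Fin n)
    (hσ : ∀ p ∈ G.E, σ.symm p.1 < σ.symm p.2) (hout : ∀ a b c, (a, b) ∈ G.E → (a, c) ∈ G.E → b = c)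
    (W : Fin n → Set (Fin m)) (hW : ∀ v, ∀ c ∈ W v, G.Supports W v c) (j : ℕ) (hj : j ≤ n)
    (r : Fin n → Fin m)
    (hr : ∀ i, (σ.symm i : ℕ) < j → (∀ b, (i, b) ∈ G.E → j ≤ (σ.symm b : ℕ)) → r i ∈ W i) :
    ∃ s, (∀ i, (σ.symm i : ℕ) < j → G.BestResponse s i) ∧
      ∀ i, (σ.symm i : ℕ) < j → (∀ b, (i, b) ∈ G.E → j ≤ (σ.symm b : ℕ)) → s i = r i := by
  induction j generalizing r with
  | zero => exact ⟨r, by simp, by simp⟩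
  | succ j ih =>
    have hjn : j < n := hj
    set v := σ ⟨j, hjn⟩ with hv
    have hvj : (σ.symm v : ℕ) = j := by simp [hv]
    have hveq : ∀ i, (σ.symm i : ℕ) = j → i = v := fun i h => by
      rw [hv, ← Equiv.symm_apply_eq]
      exact Fin.ext h
    have hlt : ∀ a b, (a, b) ∈ G.E → (σ.symm a : ℕ) < σ.symm b := fun a b h => by
      have := hσ _ h
      simpa only [Fin.lt_def] using this
    have hrv : r v ∈ W v := hr v (by omega) fun b hb => by
      have := hlt _ _ hb
      omega
    -- Without `v` its predecessors have no successor in the segment, so the induction hypothesis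
    -- may prescribe `f` on them and `r` on the other nodes.
    obtain ⟨hcv, f, hf, hbest⟩ := hW v _ hrv
    obtain ⟨s, hs, hsr⟩ := ih (by omega) (fun k => if (k, v) ∈ G.E then f k else r k)
      (fun i hi hb => by
        by_cases hiv : (i, v) ∈ G.E
        · simpa [hiv] using hf i hiv
        · simp only [hiv, if_false]
          refine hr i (by omega) fun b hib => ?_
          have h₁ := hb b hib
          have h₂ : (σ.symm b : ℕ) ≠ j := fun h => hiv (hveq b h ▸ hib)
          omega)
    -- Out-degree one enters here: `v`, at position `j`, is the only successor of `k`.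
    have hpred : ∀ k, (k, v) ∈ G.E → s k = f k := fun k hk => by
      rw [hsr k (by have := hlt _ _ hk; omega) fun b hb => by
        rw [hout _ _ _ hb hk]
        omega]
      simp [hk]
    have hnv : ∀ k, (k, v) ∈ G.E → k ≠ v := by
      rintro k hk rfl
      exact G.loopless _ hk
    refine ⟨Function.update s v (r v), fun i hi => ?_, fun i hi hb => ?_⟩
    · by_cases hiv : i = v
      · subst hiv
        have hkey : ∀ x, (Finset.univ.filter fun k => (k, v) ∈ G.E ∧
            Function.update s v (r v) k = x) =
            Finset.univ.filter fun k => (k, v) ∈ G.E ∧ f k = x := by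
          intro x
          ext k
          simp only [Finset.mem_filter, Finset.mem_univ, true_and]
          refine and_congr_right fun hk => ?_
          simp [hnv k hk, hpred k hk]
        refine ⟨by simpa using hcv, fun x hx => ?_⟩
        rw [hkey, hkey]
        simpa using hbest x hx
      · have hij : (σ.symm i : ℕ) < j := by
          have : (σ.symm i : ℕ) ≠ j := fun h => hiv (hveq i h)
          omega
        refine (hs i hij).congr (by simp [hiv]) fun k hk => ?_
        have : k ≠ v := by
          rintro rfl
          have := hlt _ _ hk
          omega
        simp [this]
    · by_cases hiv : i = v
      · subst hiv
        simp
      · have hij : (σ.symm i : ℕ) < j := by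
          have : (σ.symm i : ℕ) ≠ j := fun h => hiv (hveq i h)
          omega
        have hnE : (i, v) ∉ G.E := fun h => by
          have := hb v h
          omega
        rw [Function.update_of_ne hiv, hsr i hij fun b hib => by have := hb b hib; omega]
        simp [hnE]

/-- On an in-forest, a node has the colour `c` in some Nash equilibrium if and only if `c` is a
best response to colours that its predecessors have in Nash equilibria. -/
theorem Game.exists_isNash_iff_supports (G : Game n m) (σ : Fin n ≃ Fin n)
    (hσ : ∀ p ∈ G.E, σ.symm p.1 < σ.symm p.2) (hout : OutDegreeLeOne G.E) (v : Fin n)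
    (c : Fin m) :
    (∃ s, G.IsNash s ∧ s v = c) ↔
      G.Supports (fun k => {d | ∃ s, G.IsNash s ∧ s k = d}) v c := by
  set NE : Fin n → Set (Fin m) := fun k => {d | ∃ s, G.IsNash s ∧ s k = d} with hNE
  have hself : ∀ v, ∀ c ∈ NE v, G.Supports NE v c := by
    rintro v c ⟨s, hs, rfl⟩
    have hb := (G.isNash_iff s).1 hs v
    exact ⟨hb.1, s, fun k _ => ⟨s, hs, rfl⟩, hb.2⟩
  refine ⟨hself v c, fun hc => ?_⟩
  have hout' : ∀ a b c, (a, b) ∈ G.E → (a, c) ∈ G.E → b = c := by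
    intro a b c hb hc
    have := Finset.card_le_one.1 (hout a) (a, b) (by simp [hb]) (a, c) (by simp [hc])
    exact (Prod.ext_iff.1 this).2
  obtain ⟨s₀, hs₀⟩ := G.exists_isNash σ hσ
  -- The equilibrium colours, with `c` added at `v`. Larger sets only weaken `Supports`, so every
  -- member of `W` is still supported by `W`.
  let W : Fin n → Set (Fin m) := fun k => {d | d ∈ NE k ∨ k = v ∧ d = c}
  have hmono : ∀ u x, G.Supports NE u x → G.Supports W u x := by
    rintro u x ⟨h₁, f, h₂, h₃⟩
    exact ⟨h₁, f, fun k hk => Or.inl (h₂ k hk), h₃⟩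
  have hW : ∀ u, ∀ x ∈ W u, G.Supports W u x := by
    rintro u x (hx | ⟨rfl, rfl⟩)
    · exact hmono u x (hself u x hx)
    · exact hmono u x hc
  -- The segment ends with `v`, so `v` has no successor in it and may be prescribed `c`; the other
  -- such nodes take their colours from the equilibrium `s₀`.
  obtain ⟨s, hs, hsr⟩ := G.exists_stable_of_supports σ hσ hout' W hW (σ.symm v + 1)
    (σ.symm v).2 (Function.update s₀ v c) (fun i _ _ => by
      by_cases hiv : i = v
      · subst hiv
        exact Or.inr ⟨rfl, by simp⟩
      · exact Or.inl ⟨s₀, hs₀, by simp [hiv]⟩)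
  have hv := hsr v (Nat.lt_succ_self _) fun b hb => by
    have := hσ _ hb
    simp only [Fin.lt_def] at this
    omega
  obtain ⟨s', hs', hag⟩ := G.exists_isNash_extend σ hσ _ (σ.symm v).2 s hs
  exact ⟨s', hs', by rw [hag v (Nat.lt_succ_self _), hv]; simp⟩

end Nash

/-! ### Assignments with capacities -/

section Assignable

/-- Each `k ∈ L` can choose some `d ∈ D` with `A k d` so that the number `x` of those that choose
`d` satisfies `fits d x`, for all `d ∈ D`. -/
def Assignable (L : Finset ℕ) (A : ℕ → ℕ → Prop) (D : Finset ℕ) (fits : ℕ → ℕ → Prop) : Prop :=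
  ∃ f : ℕ → ℕ, (∀ k ∈ L, f k ∈ D ∧ A k (f k)) ∧
    ∀ d ∈ D, fits d (L.filter fun k => f k = d).card

theorem Assignable.congr {L D : Finset ℕ} {A A' : ℕ → ℕ → Prop} {fits fits' : ℕ → ℕ → Prop}
    (hA : ∀ k ∈ L, ∀ d ∈ D, A k d → A' k d) (h : ∀ d ∈ D, ∀ x, fits d x → fits' d x)
    (hf : Assignable L A D fits) : Assignable L A' D fits' := by
  obtain ⟨f, h₁, h₂⟩ := hf
  exact ⟨f, fun k hk => ⟨(h₁ k hk).1, hA k hk _ (h₁ k hk).1 (h₁ k hk).2⟩,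
    fun d hd => h d hd _ (h₂ d hd)⟩

open Classical in
/-- An element `d` that can take all of `L` may be removed together with its neighbours. -/
theorem assignable_erase_iff {L D : Finset ℕ} {A : ℕ → ℕ → Prop} {fits : ℕ → ℕ → Prop}
    (hanti : ∀ d x y, x ≤ y → fits d y → fits d x) {d : ℕ} (hd : d ∈ D) (hfit : fits d L.card) :
    Assignable (L.filter fun k => ¬ A k d) A (D.erase d) fits ↔ Assignable L A D fits := by
  constructor
  · rintro ⟨f, h₁, h₂⟩
    -- Everything that can choose `d` does so; `d` can take all of `L`, and no other load exceeds
    -- that under `f`.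
    refine ⟨fun k => if A k d then d else f k, fun k hk => ?_, fun x hx => ?_⟩
    · by_cases hA : A k d
      · simp [hA, hd]
      · have := h₁ k (by simp [hk, hA])
        simp only [hA, if_false]
        exact ⟨Finset.mem_of_mem_erase this.1, this.2⟩
    · by_cases hxd : x = d
      · subst hxd
        exact hanti _ _ _ (Finset.card_le_card (Finset.filter_subset _ _)) hfit
      · refine hanti _ _ _ (Finset.card_le_card fun k hk => ?_)
          (h₂ x (Finset.mem_erase.2 ⟨hxd, hx⟩))
        simp only [Finset.mem_filter] at hk ⊢
        by_cases hA : A k d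
        · simp only [hA, if_true] at hk
          exact absurd hk.2.symm hxd
        · simp only [hA, if_false] at hk
          exact ⟨⟨hk.1, hA⟩, hk.2⟩
  · rintro ⟨f, h₁, h₂⟩
    refine ⟨f, fun k hk => ?_, fun x hx => ?_⟩
    · simp only [Finset.mem_filter] at hk
      have := h₁ k hk.1
      refine ⟨Finset.mem_erase.2 ⟨?_, this.1⟩, this.2⟩
      intro h
      exact hk.2 (h ▸ this.2)
    · refine hanti _ _ _ (Finset.card_le_card ?_) (h₂ x (Finset.mem_of_mem_erase hx))
      exact Finset.filter_subset_filter _ (Finset.filter_subset _ _)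

/-- A violation of Hall's condition. -/
theorem not_assignable_of_sum_lt {L D U T : Finset ℕ} {A : ℕ → ℕ → Prop} {cap : ℕ → ℕ}
    (hU : U ⊆ L) (hT : T ⊆ D) (hN : ∀ k ∈ U, ∀ d ∈ D, A k d → 0 < cap d → d ∈ T)
    (hlt : ∑ d ∈ T, cap d < U.card) : ¬ Assignable L A D fun d x => x ≤ cap d := by
  rintro ⟨f, h₁, h₂⟩
  -- Since `k` itself counts towards the load of `f k`, the capacity of `f k` is positive, which
  -- puts `f k` into `T`.
  have hmaps : ∀ k ∈ U, f k ∈ T := by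
    intro k hk
    have hkL := h₁ k (hU hk)
    refine hN k hk _ hkL.1 hkL.2 (lt_of_lt_of_le ?_ (h₂ _ hkL.1))
    exact Finset.card_pos.2 ⟨k, by simp [hU hk]⟩
  have := Finset.card_eq_sum_card_fiberwise hmaps
  have h' : ∑ d ∈ T, (U.filter fun k => f k = d).card ≤ ∑ d ∈ T, cap d := by
    refine Finset.sum_le_sum fun d hd => ?_
    exact (Finset.card_le_card (Finset.filter_subset_filter _ hU)).trans (h₂ d (hT hd))
  omega

open Classical in
theorem exists_isMatching_card_eq_maxMatching {α β : Type} (F : Finset (α × β)) :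
    ∃ N, IsMatching F N ∧ N.card = maxMatching F := by
  obtain ⟨N, hN, h⟩ := Finset.exists_mem_eq_sup (F.powerset.filter fun N => IsMatching F N)
    ⟨∅, by simp [IsMatching]⟩ Finset.card
  refine ⟨N, (Finset.mem_filter.1 hN).2, ?_⟩
  rw [maxMatching, h]

open Classical in
theorem IsMatching.card_le_maxMatching {α β : Type} {F N : Finset (α × β)}
    (h : IsMatching F N) : N.card ≤ maxMatching F :=
  Finset.le_sup (f := Finset.card) (Finset.mem_filter.2 ⟨Finset.mem_powerset.2 h.1, h⟩)

/-- A matching that covers all of `L`, with `cap d` copies of each right node `d`, is an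
assignment with capacities. -/
theorem maxMatching_eq_card_iff (L D : Finset ℕ) (A : ℕ → ℕ → Prop) (cap : ℕ → ℕ)
    (F : Finset (ℕ × Σ _ : ℕ, ℕ))
    (hF : ∀ k d x, (k, (⟨d, x⟩ : Σ _ : ℕ, ℕ)) ∈ F ↔
      k ∈ L ∧ (d ∈ D ∧ 1 ≤ x ∧ x ≤ cap d) ∧ A k d) :
    maxMatching F = L.card ↔ Assignable L A D fun d x => x ≤ cap d := by
  have hle : ∀ N, IsMatching F N → Set.InjOn Prod.fst (N : Set (ℕ × Σ _ : ℕ, ℕ)) ∧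
      N.image Prod.fst ⊆ L := by
    intro N hN
    refine ⟨fun a ha b hb hab => hN.2 a ha b hb (Or.inl hab), fun k hk => ?_⟩
    obtain ⟨⟨k', d, x⟩, hp, rfl⟩ := Finset.mem_image.1 hk
    exact ((hF _ _ _).1 (hN.1 hp)).1
  constructor
  · intro h
    obtain ⟨N, hN, hc⟩ := exists_isMatching_card_eq_maxMatching F
    have himg : N.image Prod.fst = L := by
      refine Finset.eq_of_subset_of_card_le (hle N hN).2 ?_
      rw [Finset.card_image_of_injOn (hle N hN).1, hc, h]
    have hex : ∀ k, ∃ p : Σ _ : ℕ, ℕ, k ∈ L → (k, p) ∈ N := by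
      intro k
      by_cases hk : k ∈ L
      · rw [← himg] at hk
        obtain ⟨⟨k', p⟩, hp, rfl⟩ := Finset.mem_image.1 hk
        exact ⟨p, fun _ => hp⟩
      · exact ⟨⟨0, 0⟩, fun h => absurd h hk⟩
    choose g hg using hex
    refine ⟨fun k => (g k).1, fun k hk => ?_, fun d _ => ?_⟩
    · have := (hF k (g k).1 (g k).2).1 (hN.1 (hg k hk))
      exact ⟨this.2.1.1, this.2.2⟩
    · have : (L.filter fun k => (g k).1 = d).card ≤ (Finset.Icc 1 (cap d)).card := by
        refine Finset.card_le_card_of_injOn (fun k => (g k).2) ?_ ?_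
        · intro k hk
          obtain ⟨hkL, rfl⟩ := Finset.mem_filter.1 (Finset.mem_coe.1 hk)
          have := (hF k (g k).1 (g k).2).1 (hN.1 (hg k hkL))
          simpa using this.2.1.2
        · intro k hk k' hk' hkk
          obtain ⟨hkL, rfl⟩ := Finset.mem_filter.1 (Finset.mem_coe.1 hk)
          obtain ⟨hkL', hd⟩ := Finset.mem_filter.1 (Finset.mem_coe.1 hk')
          have := hN.2 _ (hg k hkL) _ (hg k' hkL')
            (Or.inr (Sigma.ext hd.symm (heq_of_eq hkk)))
          exact (Prod.ext_iff.1 this).1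
      simpa using this
  · rintro ⟨f, h₁, h₂⟩
    refine le_antisymm ?_ ?_
    · obtain ⟨N, hN, hc⟩ := exists_isMatching_card_eq_maxMatching F
      rw [← hc, ← Finset.card_image_of_injOn (hle N hN).1]
      exact Finset.card_le_card (hle N hN).2
    · let x : ℕ → ℕ := fun k => (L.filter fun k' => f k' = f k ∧ k' ≤ k).card
      have hx : ∀ k ∈ L, 1 ≤ x k ∧ x k ≤ cap (f k) := by
        intro k hk
        refine ⟨Finset.card_pos.2 ⟨k, by simp [hk]⟩, le_trans ?_ (h₂ _ (h₁ k hk).1)⟩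
        exact Finset.card_le_card fun k' hk' => by
          simp only [Finset.mem_filter] at hk' ⊢
          exact ⟨hk'.1, hk'.2.1⟩
      have hinj : ∀ k ∈ L, ∀ k' ∈ L, f k = f k' → x k = x k' → k ≤ k' := by
        intro k hk k' hk' hf hxx
        by_contra hlt
        push Not at hlt
        have : x k' < x k := by
          refine Finset.card_lt_card (Finset.ssubset_iff_of_subset ?_ |>.2 ⟨k, ?_, ?_⟩)
          · intro l hl
            simp only [Finset.mem_filter] at hl ⊢
            exact ⟨hl.1, hl.2.1.trans hf.symm, by omega⟩
          · simp [hk]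
          · simp only [Finset.mem_filter]
            omega
        omega
      have hcard : (L.image fun k => (k, (⟨f k, x k⟩ : Σ _ : ℕ, ℕ))).card = L.card :=
        Finset.card_image_of_injective _ fun a b h => (Prod.ext_iff.1 h).1
      rw [← hcard]
      refine IsMatching.card_le_maxMatching ⟨fun p hp => ?_, fun p hp p' hp' h => ?_⟩
      · obtain ⟨k, hk, rfl⟩ := Finset.mem_image.1 hp
        exact (hF _ _ _).2 ⟨hk, ⟨(h₁ k hk).1, hx k hk⟩, (h₁ k hk).2⟩
      · obtain ⟨k, hk, rfl⟩ := Finset.mem_image.1 hp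
        obtain ⟨k', hk', rfl⟩ := Finset.mem_image.1 hp'
        have : k = k' := by
          rcases h with h | h
          · exact h
          · have h1 : f k = f k' := (Sigma.mk.inj_iff.1 h).1
            have h2 : x k = x k' := eq_of_heq (Sigma.mk.inj_iff.1 h).2
            exact le_antisymm (hinj k hk k' hk' h1 h2) (hinj k' hk' k hk h1.symm h2.symm)
        subst this
        rfl

open Classical in
/-- Some choice of colours `f k` with `A k (f k)` for all `k ∈ P` makes the colour `c` the best
one if and only if the elements of `P` that cannot choose `c` can be assigned to other
colours. -/
theorem exists_best_iff_assignable (P : Finset ℕ) (A : ℕ → ℕ → Prop) (m c : ℕ)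
    (avail : ℕ → Prop) (β : ℕ → ℤ) (hA : ∀ k ∈ P, ∀ d, A k d → d < m) :
    (∃ f : ℕ → ℕ, (∀ k ∈ P, A k (f k)) ∧ ∀ d < m, avail d →
      ((P.filter fun k => f k = d).card : ℤ) + β d ≤
        ((P.filter fun k => f k = c).card : ℤ) + β c) ↔
    Assignable (P.filter fun k => ¬ A k c) A ((Finset.range m).erase c)
      fun d x => avail d → (x : ℤ) ≤ ((P.filter fun k => A k c).card : ℤ) + β c - β d := by
  constructor
  · rintro ⟨f, h₁, h₂⟩
    refine ⟨f, fun k hk => ?_, fun d hd hav => ?_⟩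
    · simp only [Finset.mem_filter] at hk
      have := h₁ k hk.1
      refine ⟨Finset.mem_erase.2 ⟨fun h => hk.2 (h ▸ this), ?_⟩, this⟩
      exact Finset.mem_range.2 (hA k hk.1 _ this)
    · have h := h₂ d (Finset.mem_range.1 (Finset.mem_of_mem_erase hd)) hav
      have h3 : ((P.filter fun k => ¬ A k c).filter fun k => f k = d).card ≤
          (P.filter fun k => f k = d).card :=
        Finset.card_le_card (Finset.filter_subset_filter _ (Finset.filter_subset _ _))
      -- Only those that can choose `c` do so, which bounds the payoff of `c` under any choice.
      have h4 : (P.filter fun k => f k = c).card ≤ (P.filter fun k => A k c).card := by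
        refine Finset.card_le_card fun k hk => ?_
        simp only [Finset.mem_filter] at hk ⊢
        exact ⟨hk.1, hk.2 ▸ h₁ k hk.1⟩
      omega
  · rintro ⟨f, h₁, h₂⟩
    -- This choice attains the bound for `c` and does not raise the load of any other colour.
    refine ⟨fun k => if A k c then c else f k, fun k hk => ?_, fun d hd hav => ?_⟩
    · by_cases h : A k c
      · simp [h]
      · simpa [h] using (h₁ k (by simp [hk, h])).2
    · by_cases hdc : d = c
      · subst hdc
        exact le_rfl
      · have h := h₂ d (Finset.mem_erase.2 ⟨hdc, Finset.mem_range.2 hd⟩) hav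
        have h3 : (P.filter fun k => (if A k c then c else f k) = d).card ≤
            ((P.filter fun k => ¬ A k c).filter fun k => f k = d).card := by
          refine Finset.card_le_card fun k hk => ?_
          simp only [Finset.mem_filter] at hk ⊢
          by_cases h : A k c
          · simp only [h, if_true] at hk
            exact absurd hk.2.symm hdc
          · simp only [h, if_false] at hk
            exact ⟨⟨hk.1, h⟩, hk.2⟩
        have h4 : (P.filter fun k => A k c).card ≤
            (P.filter fun k => (if A k c then c else f k) = c).card := by
          refine Finset.card_le_card fun k hk => ?_
          simp only [Finset.mem_filter] at hk ⊢
          exact ⟨hk.1, by simp [hk.2]⟩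
        beta_reduce
        omega

end Assignable

/-! ### A matching test by augmenting paths

The left nodes `k` with `Yp[k] = 1` are matched one after the other. For a matched left node `l`,
`tmp 0[l]` is its colour. While `r = tmp 0` is being matched, `tmp 1[d]` is a left node from which
the colour `d` was reached, or `-1`. The colour with a free copy that the search finds is
`tmp 3`, or `-1`. -/

/-- The number of copies of the colour `tmp 2`. -/
def tmpCopies : Expr :=
  .sub (.add (.var .sizeS) (.get .bonus (.var .v) (.var .c)))
    (.get .bonus (.var .v) (.var (.tmp 2)))

/-- Count the left nodes matched to the colour `d = tmp 2` and find one from which `d` can be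
reached. -/
def scanLeft : Prog :=
  .tmp 5 ≔ .lit 0 ;;
  .tmp 6 ≔ .lit (-1) ;;
  .for (.tmp 1) .n
    (.when (.and (.eq (.get1 .Yp (.var (.tmp 1))) (.lit 1))
        (.not (.lt (.var (.tmp 0)) (.var (.tmp 1)))))
      (.when (.eq (.get1 (.tmp 0) (.var (.tmp 1))) (.var (.tmp 2)))
        (.tmp 5 ≔ .add (.var (.tmp 5)) (.lit 1)) ;;
       .when (.and (.eq (.get .X (.var (.tmp 1)) (.var (.tmp 2))) (.lit 1))
          (.not (.lt (.get1 (.tmp 1) (.get1 (.tmp 0) (.var (.tmp 1)))) (.lit 0))))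
        (.tmp 6 ≔ .var (.tmp 1))))

/-- Mark the colour `tmp 2` if it can be reached. -/
def visitColour : Prog :=
  .when (.and (.and (.lt (.var (.tmp 3)) (.lit 0)) (.eq (.get1 .Cp (.var (.tmp 2))) (.lit 1)))
      (.and (.lt (.lit 0) tmpCopies) (.lt (.get1 (.tmp 1) (.var (.tmp 2))) (.lit 0))))
    (scanLeft ;;
     .when (.not (.lt (.var (.tmp 6)) (.lit 0)))
      (.store1 (.tmp 1) (.var (.tmp 2)) (.var (.tmp 6)) ;;
       .tmp 4 ≔ .lit 1 ;;
       .when (.lt (.var (.tmp 5)) tmpCopies) (.tmp 3 ≔ .var (.tmp 2))))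

/-- Search an augmenting path from the left node `tmp 0`. -/
def searchPath : Prog :=
  .store1 (.tmp 0) (.var (.tmp 0)) (.lit (-1)) ;;
  .for (.tmp 2) .m (.store1 (.tmp 1) (.var (.tmp 2)) (.lit (-1))) ;;
  -- The entry with index `-1` is a marked root: the unmatched node `tmp 0` carries the
  -- pseudo-colour `-1` and thus counts as reached without a special case in `scanLeft`.
  .store1 (.tmp 1) (.lit (-1)) (.lit 0) ;;
  .tmp 3 ≔ .lit (-1) ;;
  .tmp 4 ≔ .lit 1 ;;
  .while (.and (.eq (.var (.tmp 4)) (.lit 1)) (.lt (.var (.tmp 3)) (.lit 0)))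
    (.tmp 4 ≔ .lit 0 ;; .for (.tmp 2) .m visitColour)

/-- Shift the colours along the augmenting path that ends at the colour `tmp 3`. -/
def flipPath : Prog :=
  .while (.not (.lt (.var (.tmp 3)) (.lit 0)))
    -- The parent of the colour takes it and gives up its old one, which is treated next. The start
    -- of the path gives up `-1`, which ends the loop.
    (.tmp 6 ≔ .get1 (.tmp 1) (.var (.tmp 3)) ;;
     .tmp 7 ≔ .get1 (.tmp 0) (.var (.tmp 6)) ;;
     .store1 (.tmp 0) (.var (.tmp 6)) (.var (.tmp 3)) ;;
     .tmp 3 ≔ .var (.tmp 7))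

/-- Do the left nodes have a matching that covers all of them? -/
def matchingTest : Prog :=
  .tmp 8 ≔ .lit 1 ;;
  .for (.tmp 0) .n
    (.when (.and (.eq (.var (.tmp 8)) (.lit 1)) (.eq (.get1 .Yp (.var (.tmp 0))) (.lit 1)))
      (searchPath ;;
       .ite (.lt (.var (.tmp 3)) (.lit 0)) (.tmp 8 ≔ .lit 0) flipPath)) ;;
  .found ≔ .var (.tmp 8)

/-- The remaining colours. -/
def Store.coloursLeft (s : Store) : Finset ℕ :=
  (Finset.range (s.var .m).toNat).filter fun d : ℕ => s.arr .Cp d 0 = 1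

theorem mem_left {s : Store} {k : ℕ} :
    k ∈ s.left ↔ k < (s.var .n).toNat ∧ s.arr .Yp k 0 = 1 := by
  simp [Store.left]

theorem mem_coloursLeft {s : Store} {d : ℕ} :
    d ∈ s.coloursLeft ↔ d < (s.var .m).toNat ∧ s.arr .Cp d 0 = 1 := by
  simp [Store.coloursLeft]

theorem card_filter_le_and (L : Finset ℕ) (p : ℕ → Prop) [DecidablePred p] (i : ℕ) :
    (L.filter fun l => l ≤ i ∧ p l).card =
      (L.filter fun l => l < i ∧ p l).card + if i ∈ L ∧ p i then 1 else 0 := by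
  split_ifs with h
  · rw [← Finset.card_insert_of_notMem (a := i) (by simp)]
    congr 1
    ext l
    simp only [Finset.mem_filter, Finset.mem_insert]
    grind
  · rw [add_zero]
    congr 1
    ext l
    simp only [Finset.mem_filter]
    grind

/-- Only left nodes `l ≤ r` count: the scratch entries of later ones have not been set and may hold
anything. -/
theorem scanLeft_spec (s : Store) (r d : ℕ) (hr : s.var (.tmp 0) = r) (hd : s.var (.tmp 2) = d) :
    WP scanLeft s fun t s₁ => t ≤ 50 * ((s.var .n).toNat + 1) ∧
      s₁.var (.tmp 5) =
        (s.left.filter fun l => l ≤ r ∧ s.arr (.tmp 0) l 0 = d).card ∧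
      ((s₁.var (.tmp 6) = -1 ∧ ∀ l ∈ s.left, l ≤ r → s.arr .X l d = 1 →
          s.arr (.tmp 1) (s.arr (.tmp 0) l 0) 0 < 0) ∨
        ∃ l ∈ s.left, s₁.var (.tmp 6) = l ∧ l ≤ r ∧ s.arr .X l d = 1 ∧
          0 ≤ s.arr (.tmp 1) (s.arr (.tmp 0) l 0) 0) := by
  unfold scanLeft
  simp only [WP_seq, WP_assign]
  refine WP_for (N := (s.var .n).toNat) (fun i t s' => t ≤ 50 * i ∧
      s'.var (.tmp 5) =
        (s.left.filter fun l => l < i ∧ l ≤ r ∧ s.arr (.tmp 0) l 0 = d).card ∧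
      ((s'.var (.tmp 6) = -1 ∧ ∀ l ∈ s.left, l < i → l ≤ r → s.arr .X l d = 1 →
          s.arr (.tmp 1) (s.arr (.tmp 0) l 0) 0 < 0) ∨
        ∃ l ∈ s.left, s'.var (.tmp 6) = l ∧ l ≤ r ∧ s.arr .X l d = 1 ∧
          0 ≤ s.arr (.tmp 1) (s.arr (.tmp 0) l 0) 0)) rfl rfl (by decide) (by simp) ?_ ?_ ?_
  · simp
  · rintro i t s' hi hF hxi ⟨ht, h5, h6⟩
    have e0 : s'.var (.tmp 0) = r := by rw [← hr]; simpa using hF.1 (.tmp 0) rfl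
    have e2 : s'.var (.tmp 2) = d := by rw [← hd]; simpa using hF.1 (.tmp 2) rfl
    have a0 : s'.arr (.tmp 0) = s.arr (.tmp 0) := by simpa using hF.2 (.tmp 0) rfl
    have a1 : s'.arr (.tmp 1) = s.arr (.tmp 1) := by simpa using hF.2 (.tmp 1) rfl
    have aX : s'.arr .X = s.arr .X := by simpa using hF.2 .X rfl
    have aY : s'.arr .Yp = s.arr .Yp := by simpa using hF.2 .Yp rfl
    simp [e0, e2, a0, a1, aX, aY, hxi, card_filter_le_and]
    have hL : i ∈ s.left ↔ s.arr .Yp i 0 = 1 := by simp [mem_left, hi]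
    simp only [hL, h5]
    generalize (Finset.card _) = x
    refine ⟨fun hY hir => ⟨fun ha => ⟨?_, ?_⟩, fun ha => ⟨?_, ?_⟩⟩, ?_⟩ <;> grind
  · rintro t s' hF ⟨ht, h5, h6⟩
    refine ⟨by simp; omega, ?_, ?_⟩
    · rw [h5]
      congr 2
      ext l
      simp only [Finset.mem_filter, and_congr_right_iff]
      intro hl
      simp [(mem_left.1 hl).1]
    · refine h6.imp_left fun h => ⟨h.1, fun l hl => h.2 l hl (mem_left.1 hl).1⟩

/-! ### The search for an augmenting path and its invariant -/

/-- The number of left nodes up to `r` that are matched to `d`. -/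
def matchedTo (L : Finset ℕ) (r : ℕ) (a : ℤ → ℤ) (d : ℕ) : ℕ :=
  (L.filter fun l => l ≤ r ∧ a l = d).card

/-- The state of the search from the left node `r`: the set `V` of marked colours, the current
assignment `a`, the left nodes `par d` from which the marked colours were reached, the times `ρ d`
when they were reached, and the marked colour `free` with a free copy, or `-1`. -/
structure SearchInv (L D : Finset ℕ) (A : ℕ → ℕ → Prop) (cap : ℕ → ℤ) (r : ℕ)
    (a par : ℤ → ℤ) (free : ℤ) (V : Finset ℕ) (ρ : ℤ → ℕ) : Prop where
  sub : V ⊆ D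
  pos : ∀ d ∈ V, 0 < cap d
  root : 0 ≤ par (-1)
  rank_root : ρ (-1) = 0
  par_iff : ∀ d ∈ D, 0 ≤ par d ↔ d ∈ V
  parent : ∀ d ∈ V, ∃ l ∈ L, par d = l ∧ l ≤ r ∧ A l d ∧ (a l = -1 ∨ ∃ d' ∈ V, a l = (d' : ℕ)) ∧
    ρ (a l) < ρ d ∧ ρ d ≤ V.card
  full : ∀ d ∈ V, (d : ℤ) ≠ free → cap d ≤ matchedTo L r a d
  free_spec : free = -1 ∨ ∃ d ∈ V, free = (d : ℕ) ∧ (matchedTo L r a d : ℤ) < cap d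

section Search

variable {L D : Finset ℕ} {A : ℕ → ℕ → Prop} {cap : ℕ → ℤ} {r : ℕ} {a par : ℤ → ℤ} {free : ℤ}
  {V : Finset ℕ} {ρ : ℤ → ℕ}

/-- This translates the sign test in memory into reachability; the root entry at `-1` covers the
unmatched case. -/
theorem SearchInv.le_par_iff (h : SearchInv L D A cap r a par free V ρ) {x : ℤ}
    (hx : x = -1 ∨ ∃ d ∈ D, x = (d : ℕ)) : 0 ≤ par x ↔ x = -1 ∨ ∃ d ∈ V, x = (d : ℕ) := by
  rcases hx with rfl | ⟨d, hd, rfl⟩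
  · simp [h.root]
  · rw [h.par_iff d hd]
    constructor
    · exact fun hd => Or.inr ⟨d, hd, rfl⟩
    · rintro (h | ⟨d', hd', h⟩)
      · omega
      · rwa [Nat.cast_injective h]

/-- The rank of `d` is one more than that of the colour of its parent, so ranks fall strictly on the
way back to the root, and they never exceed the number of marked colours. This is what later bounds
the length of the path. -/
theorem SearchInv.mark (h : SearchInv L D A cap r a par (-1) V ρ) {d l : ℕ} (hd : d ∈ D)
    (hdV : d ∉ V) (hpos : 0 < cap d) (hl : l ∈ L) (hlr : l ≤ r) (hA : A l d)
    (hreach : a l = -1 ∨ ∃ d' ∈ V, a l = (d' : ℕ)) :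
    SearchInv L D A cap r a (Function.update par d l)
      (if (matchedTo L r a d : ℤ) < cap d then d else -1) (insert d V)
      (Function.update ρ d (ρ (a l) + 1)) := by
  have hne : ∀ d' ∈ V, (d' : ℤ) ≠ d := fun d' hd' he => hdV (Nat.cast_injective he ▸ hd')
  have hne' : (-1 : ℤ) ≠ d := by omega
  have hal : a l ≠ d := by
    rcases hreach with h | ⟨d', hd', h⟩
    · omega
    · rw [h]
      exact hne d' hd'
  have hcard : (insert d V).card = V.card + 1 := Finset.card_insert_of_notMem hdV
  have hρ : ρ (a l) ≤ V.card := by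
    rcases hreach with hr | ⟨d', hd', hr⟩
    · simp [hr, h.rank_root]
    · obtain ⟨_, _, _, _, _, _, _, h'⟩ := h.parent d' hd'
      rwa [hr]
  refine ⟨?_, ?_, ?_, ?_, ?_, ?_, ?_, ?_⟩
  · exact Finset.insert_subset hd h.sub
  · intro x hx
    rcases Finset.mem_insert.1 hx with rfl | hx
    · exact hpos
    · exact h.pos x hx
  · rw [Function.update_of_ne hne']
    exact h.root
  · rw [Function.update_of_ne hne']
    exact h.rank_root
  · intro x hx
    by_cases hxd : x = d
    · subst hxd
      simp
    · rw [Function.update_of_ne (by exact_mod_cast hxd), h.par_iff x hx]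
      simp [hxd]
  · intro x hx
    rcases Finset.mem_insert.1 hx with rfl | hx
    · refine ⟨l, hl, by simp, hlr, hA, ?_, ?_, ?_⟩
      · exact hreach.imp_right fun ⟨d', h₁, h₂⟩ => ⟨d', Finset.mem_insert_of_mem h₁, h₂⟩
      · rw [Function.update_of_ne hal, Function.update_self]
        omega
      · rw [Function.update_self]
        omega
    · obtain ⟨k, h₁, h₂, h₃, h₄, h₅, h₆, h₇⟩ := h.parent x hx
      have hak : a k ≠ d := by
        rcases h₅ with h | ⟨d', hd', h⟩
        · omega
        · rw [h]
          exact hne d' hd'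
      refine ⟨k, h₁, ?_, h₃, h₄, ?_, ?_, ?_⟩
      · rwa [Function.update_of_ne (hne x hx)]
      · exact h₅.imp_right fun ⟨d', h₁, h₂⟩ => ⟨d', Finset.mem_insert_of_mem h₁, h₂⟩
      · rwa [Function.update_of_ne (hne x hx), Function.update_of_ne hak]
      · rw [Function.update_of_ne (hne x hx)]
        omega
  · intro x hx hxf
    rcases Finset.mem_insert.1 hx with rfl | hx
    · by_contra hlt
      push Not at hlt
      simp [hlt] at hxf
    · exact h.full x hx (by omega)
  · split_ifs with hlt
    · exact Or.inr ⟨d, by simp, rfl, hlt⟩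
    · exact Or.inl rfl

/-- The number of marked colours is small. -/
theorem SearchInv.card_le (h : SearchInv L D A cap r a par free V ρ) : V.card ≤ L.card + 1 := by
  -- A full colour with positive capacity is used by some left node, so every marked colour except
  -- `free` is a value of `a`. If `free = -1`, the inserted `0` is a harmless dummy.
  have hsub : V ⊆ insert free.toNat (L.image fun l : ℕ => (a l).toNat) := by
    intro d hd
    by_cases hf : (d : ℤ) = free
    · simp [← hf]
    · have h₁ := h.full d hd hf
      have h₂ := h.pos d hd
      have : 0 < matchedTo L r a d := by omega
      obtain ⟨l, hl⟩ := Finset.card_pos.1 this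
      simp only [Finset.mem_filter] at hl
      refine Finset.mem_insert_of_mem (Finset.mem_image.2 ⟨l, hl.1, ?_⟩)
      simp [hl.2.2]
  have h₁ := Finset.card_le_card hsub
  have h₂ := Finset.card_insert_le free.toNat (L.image fun l : ℕ => (a l).toNat)
  have h₃ : (L.image fun l : ℕ => (a l).toNat).card ≤ L.card := Finset.card_image_le
  omega

/-- A search without success yields a violation of Hall's condition. -/
theorem SearchInv.not_assignable (h : SearchInv L D A cap r a par (-1) V ρ) (hr : r ∈ L)
    (har : a r = -1)
    (hclosed : ∀ d ∈ D, 0 < cap d → d ∉ V → ∀ l ∈ L, l ≤ r → A l d →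
      ¬ (a l = -1 ∨ ∃ d' ∈ V, a l = (d' : ℕ))) :
    ¬ Assignable L A D fun d x => x ≤ (cap d).toNat := by
  classical
  -- The left nodes matched to marked colours already fill these colours. They and `r` together can
  -- use only marked colours, so there is one left node too many.
  set B := L.filter fun l => l ≤ r ∧ ∃ d' ∈ V, a l = (d' : ℕ) with hB
  have hrB : r ∉ B := by
    simp only [hB, Finset.mem_filter, not_and, not_exists, har]
    intro _ _ d' _
    omega
  refine not_assignable_of_sum_lt (U := insert r B) (T := V)
    (Finset.insert_subset hr (Finset.filter_subset _ _)) h.sub ?_ ?_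
  · intro k hk d hd hA hpos
    by_contra hdV
    rcases Finset.mem_insert.1 hk with rfl | hk
    · exact hclosed d hd (by omega) hdV k hr le_rfl hA (Or.inl har)
    · simp only [hB, Finset.mem_filter] at hk
      exact hclosed d hd (by omega) hdV k hk.1 hk.2.1 hA (Or.inr hk.2.2)
  · rw [Finset.card_insert_of_notMem hrB]
    have hmaps : ∀ l ∈ B, (a l).toNat ∈ V := by
      intro l hl
      obtain ⟨_, _, d', hd', he⟩ := Finset.mem_filter.1 hl
      simpa [he] using hd'
    rw [Finset.card_eq_sum_card_fiberwise hmaps]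
    refine Nat.lt_succ_of_le (Finset.sum_le_sum fun d hd => ?_)
    have h₁ := h.full d hd (by omega)
    have h₂ : matchedTo L r a d ≤ (B.filter fun l : ℕ => (a l).toNat = d).card := by
      refine Finset.card_le_card fun l hl => ?_
      simp only [hB, Finset.mem_filter] at hl ⊢
      exact ⟨⟨hl.1, hl.2.1, d, hd, hl.2.2⟩, by simp [hl.2.2]⟩
    omega

end Search

/-- Either `V` grows, or nothing is marked and, unless a free colour is known, `d` satisfies the
closure condition of `SearchInv.not_assignable`. -/
theorem visitColour_spec (s : Store) (r d : ℕ) (V : Finset ℕ) (ρ : ℤ → ℕ)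
    (hr : s.var (.tmp 0) = r) (hd : s.var (.tmp 2) = d) (hdm : d < (s.var .m).toNat)
    (ha : ∀ l ∈ s.left, l ≤ r → s.arr (.tmp 0) l 0 = -1 ∨
      ∃ x ∈ s.coloursLeft, s.arr (.tmp 0) l 0 = (x : ℕ))
    (hI : SearchInv s.left s.coloursLeft (fun l x => s.arr .X l x = 1) s.copies r
      (fun l => s.arr (.tmp 0) l 0) (fun x => s.arr (.tmp 1) x 0) (s.var (.tmp 3)) V ρ) :
    WP visitColour s fun t s₁ => t ≤ 50 * (s.var .n).toNat + 150 ∧ ∃ V' ρ',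
      SearchInv s.left s.coloursLeft (fun l x => s.arr .X l x = 1) s.copies r
        (fun l => s.arr (.tmp 0) l 0) (fun x => s₁.arr (.tmp 1) x 0) (s₁.var (.tmp 3)) V' ρ' ∧
      ((s₁.var (.tmp 4) = 1 ∧ V.card < V'.card) ∨
        (s₁.var (.tmp 4) = s.var (.tmp 4) ∧ V' = V ∧
          (s₁.var (.tmp 3) = -1 → d ∈ s.coloursLeft → 0 < s.copies d → d ∉ V →
            ∀ l ∈ s.left, l ≤ r → s.arr .X l d = 1 →
              ¬ (s.arr (.tmp 0) l 0 = -1 ∨ ∃ x ∈ V, s.arr (.tmp 0) l 0 = (x : ℕ))))) := by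
  have hcap : tmpCopies.eval s = s.copies d := by simp [tmpCopies, Store.copies, hd]
  have hcost : tmpCopies.cost = 9 := by simp [tmpCopies]
  refine WP.intro fun Q hQ => ?_
  unfold visitColour
  rw [WP_when]
  constructor
  · intro hH
    simp only [Test.Holds, Expr.get1, Expr.eval, hcap, hd] at hH
    obtain ⟨⟨hf, hC⟩, hpos, hpar⟩ := hH
    have hdD : d ∈ s.coloursLeft := mem_coloursLeft.2 ⟨hdm, hC⟩
    have hfree : s.var (.tmp 3) = -1 := by
      rcases hI.free_spec with h | ⟨x, _, h, _⟩
      · exact h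
      · omega
    rw [hfree] at hI
    have hdV : d ∉ V := fun h => by
      have := (hI.par_iff d hdD).2 h
      omega
    have hreach := fun l hl hlr => hI.le_par_iff (ha l hl hlr)
    rw [WP_seq]
    refine (scanLeft_spec s r d hr hd).mono fun t s₁ hF ⟨ht, h5, h6⟩ => ?_
    have e2 : s₁.var (.tmp 2) = d := by rw [← hd]; exact hF.1 (.tmp 2) rfl
    have e3 : s₁.var (.tmp 3) = -1 := by rw [← hfree]; exact hF.1 (.tmp 3) rfl
    have e4 : s₁.var (.tmp 4) = s.var (.tmp 4) := hF.1 (.tmp 4) rfl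
    have ev : s₁.var .v = s.var .v := hF.1 .v rfl
    have ec : s₁.var .c = s.var .c := hF.1 .c rfl
    have es : s₁.var .sizeS = s.var .sizeS := hF.1 .sizeS rfl
    have a1 : s₁.arr (.tmp 1) = s.arr (.tmp 1) := hF.2 (.tmp 1) rfl
    have ab : s₁.arr .bonus = s.arr .bonus := hF.2 .bonus rfl
    rcases h6 with ⟨h6, hno⟩ | ⟨l, hl, h6, hlr, hX, hp⟩
    · simp [h6, hcost]
      refine hQ _ _ ⟨by omega, V, ρ, by simpa only [a1, e3] using hI,
        Or.inr ⟨e4, rfl, fun _ _ _ _ l hl hlr hX => ?_⟩⟩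
      have h₁ := hreach l hl hlr
      have h₂ := hno l hl hlr hX
      exact mt h₁.2 (by omega)
    · have hins := hI.mark hdD hdV hpos hl hlr hX ((hreach l hl hlr).1 hp)
      have hcnt : s₁.var (.tmp 5) = matchedTo s.left r (fun l => s.arr (.tmp 0) l 0) d := h5
      have hupd : (fun x => (s₁.setArr (.tmp 1) d 0 l).arr (.tmp 1) x 0) =
          Function.update (fun x => s.arr (.tmp 1) x 0) (d : ℤ) (l : ℤ) := by
        funext x
        simp [setArr_arr, a1, Function.update_apply]
      have hc2 : s.copies d = s₁.var .sizeS + s₁.arr .bonus (s₁.var .v) (s₁.var .c) -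
          s₁.arr .bonus (s₁.var .v) d := by
        rw [es, ev, ec, ab]
        rfl
      have hlt : V.card < (insert d V).card := by simp [hdV]
      simp [h6, hcost, e2]
      simp only [tmpCopies, Expr.eval, setVar_var, setVar_arr, setArr_var, e2]
      simp [setArr_arr_of_ne, ← hc2, hcnt]
      constructor
      · intro hlt'
        rw [if_pos hlt'] at hins
        refine hQ _ _ ⟨by omega, _, Function.update ρ d (ρ (s.arr (.tmp 0) l 0) + 1), ?_, Or.inl ⟨by simp, hlt⟩⟩
        simpa [hupd] using hins
      · intro hlt'
        rw [if_neg (by omega)] at hins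
        refine hQ _ _ ⟨by omega, _, Function.update ρ d (ρ (s.arr (.tmp 0) l 0) + 1), ?_, Or.inl ⟨by simp, hlt⟩⟩
        simpa [hupd, e3] using hins
  · intro hH
    simp only [Test.Holds, Expr.get1, Expr.eval, hcap, hd] at hH
    refine hQ _ _ ⟨by simp; omega, V, ρ, hI, Or.inr ⟨rfl, rfl, fun hf hD hpos hdV => ?_⟩⟩
    refine absurd ⟨⟨by omega, (mem_coloursLeft.1 hD).2⟩, hpos, ?_⟩ hH
    have := mt (hI.par_iff d hD).1 hdV
    simpa using this

theorem left_congr {s s' : Store} (h₁ : s'.var .n = s.var .n) (h₂ : s'.arr .Yp = s.arr .Yp) :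
    s'.left = s.left := by
  simp only [Store.left, h₁, h₂]

theorem coloursLeft_congr {s s' : Store} (h₁ : s'.var .m = s.var .m)
    (h₂ : s'.arr .Cp = s.arr .Cp) : s'.coloursLeft = s.coloursLeft := by
  simp only [Store.coloursLeft, h₁, h₂]

theorem copies_congr {s s' : Store} (h₁ : s'.var .v = s.var .v) (h₂ : s'.var .c = s.var .c)
    (h₃ : s'.var .sizeS = s.var .sizeS) (h₄ : s'.arr .bonus = s.arr .bonus) :
    s'.copies = s.copies := by
  funext d
  simp only [Store.copies, h₁, h₂, h₃, h₄]

theorem searchRound_spec (s : Store) (r : ℕ) (V : Finset ℕ) (ρ : ℤ → ℕ)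
    (hr : s.var (.tmp 0) = r)
    (ha : ∀ l ∈ s.left, l ≤ r → s.arr (.tmp 0) l 0 = -1 ∨
      ∃ x ∈ s.coloursLeft, s.arr (.tmp 0) l 0 = (x : ℕ))
    (hI : SearchInv s.left s.coloursLeft (fun l x => s.arr .X l x = 1) s.copies r
      (fun l => s.arr (.tmp 0) l 0) (fun x => s.arr (.tmp 1) x 0) (s.var (.tmp 3)) V ρ) :
    WP (.tmp 4 ≔ .lit 0 ;; .for (.tmp 2) .m visitColour) s fun t s₁ =>
      t ≤ (50 * (s.var .n).toNat + 158) * (s.var .m).toNat + 8 ∧ ∃ V' ρ',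
      SearchInv s.left s.coloursLeft (fun l x => s.arr .X l x = 1) s.copies r
        (fun l => s.arr (.tmp 0) l 0) (fun x => s₁.arr (.tmp 1) x 0) (s₁.var (.tmp 3)) V' ρ' ∧
      ((s₁.var (.tmp 4) = 1 ∧ V.card < V'.card) ∨
        (s₁.var (.tmp 4) = 0 ∧ V' = V ∧
          (s₁.var (.tmp 3) = -1 → ∀ d ∈ s.coloursLeft, 0 < s.copies d → d ∉ V →
            ∀ l ∈ s.left, l ≤ r → s.arr .X l d = 1 →
              ¬ (s.arr (.tmp 0) l 0 = -1 ∨ ∃ x ∈ V, s.arr (.tmp 0) l 0 = (x : ℕ))))) := by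
  rw [WP_seq, WP_assign]
  refine WP_for (N := (s.var .m).toNat) (fun i t s' =>
      t ≤ (50 * (s.var .n).toNat + 158) * i ∧ ∃ V' ρ',
      SearchInv s.left s.coloursLeft (fun l x => s.arr .X l x = 1) s.copies r
        (fun l => s.arr (.tmp 0) l 0) (fun x => s'.arr (.tmp 1) x 0) (s'.var (.tmp 3)) V' ρ' ∧
      ((s'.var (.tmp 4) = 1 ∧ V.card < V'.card) ∨
        (s'.var (.tmp 4) = 0 ∧ V' = V ∧
          (s'.var (.tmp 3) = -1 → ∀ d ∈ s.coloursLeft, d < i → 0 < s.copies d → d ∉ V →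
            ∀ l ∈ s.left, l ≤ r → s.arr .X l d = 1 →
              ¬ (s.arr (.tmp 0) l 0 = -1 ∨ ∃ x ∈ V, s.arr (.tmp 0) l 0 = (x : ℕ))))))
    rfl rfl (by decide) (by simp) ?_ ?_ ?_
  · refine ⟨by simp, V, ρ, ?_, Or.inr ⟨by simp, rfl, by simp⟩⟩
    simpa using hI
  · rintro i t s' hi hF hxi ⟨ht, V', ρ', hI', hcase⟩
    have e0 : s'.var (.tmp 0) = r := by rw [← hr]; simpa using hF.1 (.tmp 0) rfl
    have en : s'.var .n = s.var .n := by simpa using hF.1 .n rfl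
    have em : s'.var .m = s.var .m := by simpa using hF.1 .m rfl
    have eL : s'.left = s.left := left_congr en (by simpa using hF.2 .Yp rfl)
    have eD : s'.coloursLeft = s.coloursLeft := coloursLeft_congr em (by simpa using hF.2 .Cp rfl)
    have eC : s'.copies = s.copies := copies_congr (by simpa using hF.1 .v rfl)
      (by simpa using hF.1 .c rfl) (by simpa using hF.1 .sizeS rfl) (by simpa using hF.2 .bonus rfl)
    have a0 : s'.arr (.tmp 0) = s.arr (.tmp 0) := by simpa using hF.2 (.tmp 0) rfl
    have aX : s'.arr .X = s.arr .X := by simpa using hF.2 .X rfl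
    have hspec := visitColour_spec s' r i V' ρ' e0 hxi (by rw [em]; exact hi)
      (by rw [eL, eD, a0]; exact ha) (by rw [eL, eD, eC, a0, aX]; exact hI')
    rw [eL, eD, eC, a0, aX, en] at hspec
    refine hspec.mono fun t' s₁ _ ⟨ht', V₁, ρ₁, hI₁, hc₁⟩ => ?_
    refine ⟨by rw [Nat.mul_add]; omega, V₁, ρ₁, by simpa using hI₁, ?_⟩
    rcases hc₁ with ⟨h4, hlt⟩ | ⟨h4, rfl, hcl⟩
    · refine Or.inl ⟨by simpa using h4, ?_⟩
      rcases hcase with ⟨_, h⟩ | ⟨_, rfl, _⟩ <;> omega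
    · rcases hcase with ⟨h4', h⟩ | ⟨h4', rfl, hcl'⟩
      · exact Or.inl ⟨by simp [h4, h4'], h⟩
      · refine Or.inr ⟨by simp [h4, h4'], rfl, fun hf d hd hdi hpos hdV => ?_⟩
        replace hf : s₁.var (.tmp 3) = -1 := by simpa using hf
        rcases Nat.lt_succ_iff_lt_or_eq.1 hdi with hdi | rfl
        -- As `V` is unchanged and no free colour is known now, none was known before: it would have
        -- a free copy by the old invariant and be full by the new one.
        · refine hcl' ?_ d hd hdi hpos hdV
          rcases hI'.free_spec with h | ⟨y, hy, h, hlt⟩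
          · exact h
          · exfalso
            rcases hI₁.free_spec with h' | ⟨y', hy', h', _⟩
            · have h₃ := hI₁.full y hy (by omega)
              omega
            · omega
        · exact hcl hf hd hpos hdV
  · rintro t s' hF ⟨ht, V', ρ', hI', hcase⟩
    refine ⟨by simp; rw [mul_comm] at ht ⊢; omega, V', ρ', hI', hcase.imp_right ?_⟩
    rintro ⟨h4, rfl, hcl⟩
    exact ⟨h4, rfl, fun hf d hd => hcl hf d hd (mem_coloursLeft.1 hd).1⟩

theorem searchPath_spec (s : Store) (r : ℕ) (hr : s.var (.tmp 0) = r)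
    (ha : ∀ l ∈ s.left, l < r → ∃ x ∈ s.coloursLeft, s.arr (.tmp 0) l 0 = (x : ℕ)) :
    WP searchPath s fun t s₁ =>
      t ≤ (50 * (s.var .n).toNat + 200) * ((s.var .m).toNat + 1) *
        (min (s.var .n).toNat (s.var .m).toNat + 3) ∧
      (fun l => s₁.arr (.tmp 0) l 0) = Function.update (fun l => s.arr (.tmp 0) l 0) r (-1) ∧
      ∃ V ρ, SearchInv s.left s.coloursLeft (fun l x => s.arr .X l x = 1) s.copies r
        (fun l => s₁.arr (.tmp 0) l 0) (fun x => s₁.arr (.tmp 1) x 0) (s₁.var (.tmp 3)) V ρ ∧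
      (s₁.var (.tmp 3) = -1 → ∀ d ∈ s.coloursLeft, 0 < s.copies d → d ∉ V →
        ∀ l ∈ s.left, l ≤ r → s.arr .X l d = 1 →
          ¬ (s₁.arr (.tmp 0) l 0 = -1 ∨ ∃ x ∈ V, s₁.arr (.tmp 0) l 0 = (x : ℕ))) := by
  refine WP.intro fun Q hQ => ?_
  unfold searchPath
  simp only [WP_seq, WP_store1, WP_assign]
  refine WP_for (N := (s.var .m).toNat) (fun i t s' => t = 12 * i ∧
    ∀ d : ℕ, d < i → s'.arr (.tmp 1) d 0 = -1) rfl rfl (by decide) (by simp) (by simp) ?_ ?_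
  · rintro i t s' hi hF hxi ⟨ht, h1⟩
    simp only [WP_store1]
    refine ⟨by simp; omega, fun d hd => ?_⟩
    simp only [setVar_arr, setArr_arr, Expr.eval, hxi, Nat.cast_inj, true_and, and_true]
    split_ifs with h
    · rfl
    · exact h1 d (by omega)
  rintro t s' hF ⟨ht, h1⟩
  have en : s'.var .n = s.var .n := by simpa using hF.1 .n rfl
  have em : s'.var .m = s.var .m := by simpa using hF.1 .m rfl
  have eL : s'.left = s.left := left_congr en
    (by simpa [setArr_arr_of_ne] using hF.2 .Yp rfl)
  have eD : s'.coloursLeft = s.coloursLeft := coloursLeft_congr em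
    (by simpa [setArr_arr_of_ne] using hF.2 .Cp rfl)
  have eC : s'.copies = s.copies := copies_congr (by simpa using hF.1 .v rfl)
    (by simpa using hF.1 .c rfl) (by simpa using hF.1 .sizeS rfl)
    (by simpa [setArr_arr_of_ne] using hF.2 .bonus rfl)
  have a0 : (fun l => s'.arr (.tmp 0) l 0) =
      Function.update (fun l => s.arr (.tmp 0) l 0) r (-1) := by
    have := hF.2 (.tmp 0) rfl
    funext l
    rw [this]
    simp [setArr_arr, Function.update_apply, hr]
  have aX : s'.arr .X = s.arr .X := by simpa [setArr_arr_of_ne] using hF.2 .X rfl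
  have e0 : s'.var (.tmp 0) = r := by rw [← hr]; simpa using hF.1 (.tmp 0) rfl
  have ha' : ∀ l ∈ s.left, l ≤ r → s'.arr (.tmp 0) l 0 = -1 ∨
      ∃ x ∈ s.coloursLeft, s'.arr (.tmp 0) l 0 = (x : ℕ) := by
    intro l hl hlr
    rw [show s'.arr (.tmp 0) l 0 = _ from congrFun a0 l]
    rcases Nat.lt_or_eq_of_le hlr with h | rfl
    · rw [Function.update_of_ne (by omega)]
      exact Or.inr (ha l hl h)
    · simp
  set N := (s.var .n).toNat with hN
  set M := (s.var .m).toNat with hM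
  -- The bound for one round, with eight units for the test of the loop.
  set B := (50 * N + 158) * M + 8 + 8 with hB
  have hinit : SearchInv s.left s.coloursLeft (fun l x => s.arr .X l x = 1) s.copies r
      (fun l => s'.arr (.tmp 0) l 0)
      (fun x => (s'.setArr (.tmp 1) (-1) 0 0).arr (.tmp 1) x 0) (-1) ∅ (fun _ => 0) := by
    refine ⟨by simp, by simp, by simp [setArr_arr], rfl, fun d hd => ?_, by simp, by simp,
      Or.inl rfl⟩
    have hne : (d : ℤ) ≠ -1 := by omega
    simp [setArr_arr, hne, h1 d (mem_coloursLeft.1 hd).1]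
  -- Each round but the last marks a new colour, so the time is charged to `V` at the rate `B`, with
  -- one more `B` for a last round without change. The variant is what `V` leaves of `M + 1`, and
  -- `0` after such a last round.
  refine WP_while (fun t k s₁ => ∃ V ρ,
    SearchInv s.left s.coloursLeft (fun l x => s.arr .X l x = 1) s.copies r
      (fun l => s'.arr (.tmp 0) l 0) (fun x => s₁.arr (.tmp 1) x 0) (s₁.var (.tmp 3)) V ρ ∧
    ((s₁.var (.tmp 4) = 1 ∧ k + V.card = M + 1 ∧ t ≤ B * V.card) ∨
      (s₁.var (.tmp 4) = 0 ∧ k = 0 ∧ t ≤ B * (V.card + 1) ∧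
        (s₁.var (.tmp 3) = -1 → ∀ d ∈ s.coloursLeft, 0 < s.copies d → d ∉ V →
        ∀ l ∈ s.left, l ≤ r → s.arr .X l d = 1 →
          ¬ (s'.arr (.tmp 0) l 0 = -1 ∨ ∃ x ∈ V, s'.arr (.tmp 0) l 0 = (x : ℕ))))))
    (k₀ := M + 1) ?_ ?_ ?_
  · exact ⟨∅, fun _ => 0, by simpa using hinit, Or.inl ⟨by simp, by simp, by simp⟩⟩
  · rintro t₁ k s₁ hF₁ ⟨V, ρ, hI, hc⟩ hH
    have en' : s₁.var .n = s.var .n := by rw [← en]; simpa using hF₁.1 .n rfl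
    have em' : s₁.var .m = s.var .m := by rw [← em]; simpa using hF₁.1 .m rfl
    have eL' : s₁.left = s.left := eL ▸ left_congr (en'.trans en.symm)
      (by simpa [setArr_arr_of_ne] using hF₁.2 .Yp rfl)
    have eD' : s₁.coloursLeft = s.coloursLeft := eD ▸ coloursLeft_congr (em'.trans em.symm)
      (by simpa [setArr_arr_of_ne] using hF₁.2 .Cp rfl)
    have eC' : s₁.copies = s.copies := eC ▸ copies_congr (by simpa using hF₁.1 .v rfl)
      (by simpa using hF₁.1 .c rfl) (by simpa using hF₁.1 .sizeS rfl)
      (by simpa [setArr_arr_of_ne] using hF₁.2 .bonus rfl)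
    have a0' : s₁.arr (.tmp 0) = s'.arr (.tmp 0) := by
      simpa [setArr_arr_of_ne] using hF₁.2 (.tmp 0) rfl
    have aX' : s₁.arr .X = s.arr .X := by
      rw [← aX]
      simpa [setArr_arr_of_ne] using hF₁.2 .X rfl
    have hspec := searchRound_spec s₁ r V ρ (by rw [← e0]; simpa using hF₁.1 (.tmp 0) rfl)
      (by rw [eL', eD', a0']; exact ha') (by rw [eL', eD', eC', a0', aX']; exact hI)
    rw [eL', eD', eC', a0', aX', en', em', ← hN, ← hM] at hspec
    refine hspec.mono fun t₂ s₂ _ ⟨ht₂, V', ρ', hI', hc'⟩ => ?_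
    rcases hc with ⟨_, hk, ht₁⟩ | ⟨h4, _⟩
    swap
    · simp only [Test.Holds, Expr.eval] at hH
      omega
    have hVM : V'.card ≤ M := by
      have := Finset.card_le_card hI'.sub
      refine this.trans ((Finset.card_filter_le _ _).trans ?_)
      simp [hM]
    have hstep : t₁ + ((Test.and (.eq (.var (.tmp 4)) (.lit 1))
        (.lt (.var (.tmp 3)) (.lit 0))).cost + 1) + t₂ ≤ B * (V.card + 1) := by
      simp only [Test.cost, Expr.cost, Nat.mul_add]
      omega
    rcases hc' with ⟨h4, hlt⟩ | ⟨h4, rfl, hcl⟩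
    · refine ⟨M + 1 - V'.card, by omega, V', ρ', hI', Or.inl ⟨h4, by omega, ?_⟩⟩
      exact hstep.trans (Nat.mul_le_mul_left _ hlt)
    · exact ⟨0, by omega, V', ρ', hI', Or.inr ⟨h4, rfl, hstep, hcl⟩⟩
  · rintro t₁ k s₁ hF₁ ⟨V, ρ, hI, hc⟩ hH
    have a0' : s₁.arr (.tmp 0) = s'.arr (.tmp 0) := by
      simpa [setArr_arr_of_ne] using hF₁.2 (.tmp 0) rfl
    -- Bounding the rounds by `min N M`, and not by `M` alone, is what yields the exponent `5 / 2`.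
    have hV : V.card ≤ min N M + 1 := by
      have h₁ := hI.card_le
      have h₂ : V.card ≤ M := by
        have := Finset.card_le_card hI.sub
        refine this.trans ((Finset.card_filter_le _ _).trans ?_)
        simp [hM]
      have h₃ : s.left.card ≤ N := (Finset.card_filter_le _ _).trans (by simp [hN])
      omega
    have ht₁ : t₁ ≤ B * (min N M + 2) := by
      rcases hc with ⟨_, _, h⟩ | ⟨_, _, h, _⟩ <;>
        exact h.trans (Nat.mul_le_mul_left _ (by omega))
    refine hQ _ _ ⟨?_, by rw [a0', a0], V, ρ, by rw [a0']; exact hI, fun hf => ?_⟩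
    · simp only [Test.cost, Expr.cost]
      subst ht
      have h₁ : B + 12 * M + 42 ≤ (50 * N + 200) * (M + 1) := by
        rw [hB]
        ring_nf
        omega
      have h₂ : B * (min N M + 2) ≤ (50 * N + 200) * (M + 1) * (min N M + 2) :=
        Nat.mul_le_mul_right _ (by omega)
      rw [show min N M + 3 = min N M + 2 + 1 from rfl, Nat.mul_succ]
      simp only [Expr.eval] at *
      omega
    · rcases hc with ⟨h4, hk, _⟩ | ⟨_, _, _, hcl⟩
      · exact absurd (by simp [hf, h4]) hH
      · rw [a0']
        exact hcl hf

/-! ### Shifting the colours along an augmenting path -/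

/-- The state while the colours along an augmenting path from the left node `r` are shifted: the
colour `d` has a free copy. -/
structure FlipInv (L D : Finset ℕ) (A : ℕ → ℕ → Prop) (cap : ℕ → ℤ) (r : ℕ) (par : ℤ → ℤ)
    (V : Finset ℕ) (ρ : ℤ → ℕ) (a : ℤ → ℤ) (d : ℤ) : Prop where
  current : (d = -1 ∧ ∃ x ∈ D, a r = (x : ℕ) ∧ A r x) ∨
    (a r = -1 ∧ ∃ x ∈ V, d = (x : ℕ) ∧ (matchedTo L r a x : ℤ) < cap x)
  matched : ∀ l ∈ L, l < r → ∃ x ∈ D, a l = (x : ℕ) ∧ A l x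
  capacity : ∀ x ∈ D, matchedTo L r a x ≤ (cap x).toNat
  parent : ∀ x ∈ V, ρ (x : ℕ) ≤ ρ d → ∃ l ∈ L, par x = l ∧ l ≤ r ∧ A l x ∧
    (a l = -1 ∨ ∃ y ∈ V, a l = (y : ℕ)) ∧ ρ (a l) < ρ x

section Flip

variable {L D : Finset ℕ} {A : ℕ → ℕ → Prop} {cap : ℕ → ℤ} {r : ℕ} {par : ℤ → ℤ}
  {V : Finset ℕ} {ρ : ℤ → ℕ} {a : ℤ → ℤ} {d : ℤ}

theorem matchedTo_update_self_le (k x : ℕ) :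
    matchedTo L r (Function.update a k x) x ≤ matchedTo L r a x + 1 := by
  have : L.filter (fun l : ℕ => l ≤ r ∧ Function.update a k x l = x) ⊆
      insert k (L.filter fun l : ℕ => l ≤ r ∧ a l = x) := by
    intro l hl
    simp only [Finset.mem_filter, Finset.mem_insert] at hl ⊢
    by_cases hlk : l = k
    · exact Or.inl hlk
    · rw [Function.update_of_ne (by exact_mod_cast hlk)] at hl
      exact Or.inr hl
  exact (Finset.card_le_card this).trans (Finset.card_insert_le _ _)

theorem matchedTo_update_of_ne_le {x y : ℕ} (k : ℕ) (h : y ≠ x) :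
    matchedTo L r (Function.update a k x) y ≤ matchedTo L r a y := by
  refine Finset.card_le_card fun l hl => ?_
  simp only [Finset.mem_filter] at hl ⊢
  by_cases hlk : l = k
  · subst hlk
    rw [Function.update_self] at hl
    exact absurd (Nat.cast_injective hl.2.2.symm) h
  · rw [Function.update_of_ne (by exact_mod_cast hlk)] at hl
    exact hl

theorem matchedTo_update_lt {k x y : ℕ} (hk : k ∈ L) (hkr : k ≤ r) (hak : a k = y) (h : y ≠ x) :
    matchedTo L r (Function.update a k x) y < matchedTo L r a y := by
  refine Finset.card_lt_card ((Finset.ssubset_iff_of_subset fun l hl => ?_).2 ⟨k, ?_, ?_⟩)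
  · simp only [Finset.mem_filter] at hl ⊢
    by_cases hlk : l = k
    · subst hlk
      rw [Function.update_self] at hl
      exact absurd (Nat.cast_injective hl.2.2.symm) h
    · rw [Function.update_of_ne (by exact_mod_cast hlk)] at hl
      exact hl
  · simp [hk, hkr, hak]
  · simp only [Finset.mem_filter, Function.update_self, not_and, Nat.cast_inj]
    intro _ _ he
    exact h he.symm

/-- The parent of `d` takes the free copy and thereby frees a copy of its old colour, which has
smaller rank. If the parent had no colour it is `r`, as all earlier left nodes are matched, and the
shift is complete. -/
theorem FlipInv.step (hV : V ⊆ D) (hrL : r ∈ L) (h : FlipInv L D A cap r par V ρ a d)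
    (hd : 0 ≤ d) :
    FlipInv L D A cap r par V ρ (Function.update a (par d) d) (a (par d)) ∧
      ρ (a (par d)) < ρ d := by
  obtain ⟨har, x, hx, rfl, hlt⟩ : a r = -1 ∧ ∃ x ∈ V, d = (x : ℕ) ∧
      (matchedTo L r a x : ℤ) < cap x := by
    rcases h.current with ⟨h, _⟩ | h
    · omega
    · exact h
  obtain ⟨k, hk, hpk, hkr, hA, hak, hρ⟩ := h.parent x hx le_rfl
  rw [hpk]
  have hcapx : matchedTo L r (Function.update a k x) x ≤ (cap x).toNat := by
    have := matchedTo_update_self_le (L := L) (r := r) (a := a) k x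
    omega
  have hother : ∀ y ∈ D, matchedTo L r (Function.update a k x) y ≤ (cap y).toNat := by
    intro y hy
    by_cases hyx : y = x
    · subst hyx
      exact hcapx
    · exact (matchedTo_update_of_ne_le k hyx).trans (h.capacity y hy)
  refine ⟨⟨?_, ?_, hother, ?_⟩, hρ⟩
  · rcases hak with hak | ⟨y, hy, hak⟩
    · have hkr' : k = r := by
        by_contra hne
        obtain ⟨z, _, hz, _⟩ := h.matched k hk (lt_of_le_of_ne hkr hne)
        omega
      subst hkr'
      exact Or.inl ⟨hak, x, hV hx, by simp, hA⟩
    · have hkr' : (r : ℤ) ≠ k := by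
        intro he
        rw [← he] at hak
        omega
      have hyx : y ≠ x := by
        rintro rfl
        rw [hak] at hρ
        omega
      refine Or.inr ⟨by rwa [Function.update_of_ne hkr'], y, hy, hak, ?_⟩
      have h₁ := matchedTo_update_lt hk hkr hak hyx
      have h₂ := h.capacity y (hV hy)
      omega
  · intro l hl hlr
    by_cases hlk : l = k
    · subst hlk
      exact ⟨x, hV hx, by simp, hA⟩
    · rw [Function.update_of_ne (by exact_mod_cast hlk)]
      exact h.matched l hl hlr
  · intro y hy hρy
    obtain ⟨l, hl, hpl, hlr, hAl, hal, hρl⟩ := h.parent y hy (by omega)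
    -- The recoloured node `k` is no parent of a colour `y` of rank at most `ρ (a k)`: the old
    -- colour of a parent of `y` has rank below that of `y`.
    have hlk : l ≠ k := by
      rintro rfl
      omega
    refine ⟨l, hl, hpl, hlr, hAl, ?_, ?_⟩
    · rwa [Function.update_of_ne (by exact_mod_cast hlk)]
    · rwa [Function.update_of_ne (by exact_mod_cast hlk)]

end Flip

/-- The rank of the colour in hand is both the variant and the measure of the remaining time. -/
theorem flipPath_spec (s : Store) (r : ℕ) (L D : Finset ℕ) (A : ℕ → ℕ → Prop) (cap : ℕ → ℤ)
    (V : Finset ℕ) (ρ : ℤ → ℕ) (hV : V ⊆ D) (hrL : r ∈ L)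
    (h : FlipInv L D A cap r (fun x => s.arr (.tmp 1) x 0) V ρ
      (fun l => s.arr (.tmp 0) l 0) (s.var (.tmp 3))) :
    WP flipPath s fun t s₁ => t ≤ 25 * (ρ (s.var (.tmp 3)) + 1) ∧
      (∀ l ∈ L, l ≤ r → ∃ x ∈ D, s₁.arr (.tmp 0) l 0 = (x : ℕ) ∧ A l x) ∧
      ∀ x ∈ D, matchedTo L r (fun l => s₁.arr (.tmp 0) l 0) x ≤ (cap x).toNat := by
  unfold flipPath
  refine WP_while (fun t k s' => k = ρ (s'.var (.tmp 3)) ∧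
    t + 25 * ρ (s'.var (.tmp 3)) ≤ 25 * ρ (s.var (.tmp 3)) ∧
    FlipInv L D A cap r (fun x => s.arr (.tmp 1) x 0) V ρ
      (fun l => s'.arr (.tmp 0) l 0) (s'.var (.tmp 3))) (k₀ := ρ (s.var (.tmp 3)))
    ⟨rfl, by simp, h⟩ ?_ ?_
  · rintro t k s' hF ⟨rfl, ht, hI⟩ hH
    have hd : 0 ≤ s'.var (.tmp 3) := by simpa using hH
    have a1 : s'.arr (.tmp 1) = s.arr (.tmp 1) := hF.2 (.tmp 1) rfl
    obtain ⟨hI', hlt⟩ := hI.step hV hrL hd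
    refine WP.intro fun Q hQ => ?_
    simp
    refine hQ _ _ ⟨_, hlt, ?_, ?_, ?_⟩
    · simp [a1]
    · simp [a1]
      omega
    · simp only [setVar_arr, setVar_var, if_true, a1]
      convert hI' using 1
      funext l
      simp [setArr_arr, Function.update_apply]
  · rintro t k s' hF ⟨rfl, ht, hI⟩ hH
    have hd : s'.var (.tmp 3) < 0 := by simpa using hH
    refine ⟨by simp; omega, fun l hl hlr => ?_, hI.capacity⟩
    rcases hI.current with ⟨_, h⟩ | ⟨_, x, _, h, _⟩
    · rcases Nat.lt_or_eq_of_le hlr with hlt | rfl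
      · exact hI.matched l hl hlt
      · exact h
    · omega

theorem SearchInv.flipInv {L D : Finset ℕ} {A : ℕ → ℕ → Prop} {cap : ℕ → ℤ} {r : ℕ}
    {a par : ℤ → ℤ} {free : ℤ} {V : Finset ℕ} {ρ : ℤ → ℕ}
    (h : SearchInv L D A cap r a par free V ρ) (hfree : 0 ≤ free) (har : a r = -1)
    (hm : ∀ l ∈ L, l < r → ∃ x ∈ D, a l = (x : ℕ) ∧ A l x)
    (hc : ∀ x ∈ D, matchedTo L r a x ≤ (cap x).toNat) : FlipInv L D A cap r par V ρ a free := by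
  refine ⟨Or.inr ⟨har, ?_⟩, hm, hc, fun x hx _ => ?_⟩
  · rcases h.free_spec with h | h
    · omega
    · exact h
  · obtain ⟨l, h₁, h₂, h₃, h₄, h₅, h₆, _⟩ := h.parent x hx
    exact ⟨l, h₁, h₂, h₃, h₄, h₅, h₆⟩

theorem SearchInv.rank_le {L D : Finset ℕ} {A : ℕ → ℕ → Prop} {cap : ℕ → ℤ} {r : ℕ}
    {a par : ℤ → ℤ} {free : ℤ} {V : Finset ℕ} {ρ : ℤ → ℕ}
    (h : SearchInv L D A cap r a par free V ρ) : ρ free ≤ V.card := by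
  rcases h.free_spec with hf | ⟨x, hx, hf, _⟩
  · simp [hf, h.rank_root]
  · obtain ⟨_, _, _, _, _, _, _, h'⟩ := h.parent x hx
    rwa [hf]

/-! ### The complete matching test -/

/-- The bound on the running time of the augmentation from one left node. -/
def augmentBound (n m : ℕ) : ℕ := (50 * n + 250) * (m + 1) * (min n m + 3)

theorem maxMatching_bipartite_eq_iff (s : Store) : maxMatching s.bipartite = s.left.card ↔
    Assignable s.left (fun l x => s.arr .X l x = 1) s.coloursLeft
      fun d x => x ≤ (s.copies d).toNat := by
  refine maxMatching_eq_card_iff _ _ _ _ _ fun k d x => ?_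
  simp only [Store.bipartite, Store.right, Store.coloursLeft, Finset.mem_filter,
    Finset.mem_product, Finset.mem_sigma, Finset.mem_Icc, and_assoc]

/-- Augmentations are charged to the left nodes and not to all `n` indices, because the left nodes
are predecessors of one node, and over all nodes of the game the predecessors add up to the number
of edges. -/
theorem matchingTest_spec (s : Store) :
    WP matchingTest s fun t s₁ =>
      t ≤ 20 * ((s.var .n).toNat + 1) +
        s.left.card * augmentBound (s.var .n).toNat (s.var .m).toNat ∧
      (s₁.var .found = 1 ↔ maxMatching s.bipartite = s.left.card) := by
  rw [maxMatching_bipartite_eq_iff]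
  unfold matchingTest
  simp only [WP_seq, WP_assign]
  set N := (s.var .n).toNat with hN
  set M := (s.var .m).toNat with hM
  refine WP_for (N := N) (fun r t s' =>
    t ≤ 20 * r + (s.left.filter fun l => l < r).card * augmentBound N M ∧
    ((s'.var (.tmp 8) = 0 ∧ ¬ Assignable s.left (fun l x => s.arr .X l x = 1) s.coloursLeft
        fun d x => x ≤ (s.copies d).toNat) ∨
      (s'.var (.tmp 8) = 1 ∧
        (∀ l ∈ s.left, l < r → ∃ x ∈ s.coloursLeft, s'.arr (.tmp 0) l 0 = (x : ℕ) ∧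
          s.arr .X l x = 1) ∧
        ∀ x ∈ s.coloursLeft, (s.left.filter fun l : ℕ => l < r ∧
          s'.arr (.tmp 0) l 0 = x).card ≤ (s.copies x).toNat))) rfl rfl (by decide)
    (by simp [hN]) ?_ ?_ ?_
  · simp
  · rintro r t s' hr hF hxr ⟨ht, hcase⟩
    have en : s'.var .n = s.var .n := by simpa using hF.1 .n rfl
    have em : s'.var .m = s.var .m := by simpa using hF.1 .m rfl
    have aY : s'.arr .Yp = s.arr .Yp := hF.2 .Yp rfl
    have eL : s'.left = s.left := left_congr en aY
    have eD : s'.coloursLeft = s.coloursLeft := coloursLeft_congr em (hF.2 .Cp rfl)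
    have eC : s'.copies = s.copies := copies_congr (by simpa using hF.1 .v rfl)
      (by simpa using hF.1 .c rfl) (by simpa using hF.1 .sizeS rfl) (hF.2 .bonus rfl)
    have aX : s'.arr .X = s.arr .X := hF.2 .X rfl
    have hsucc : (s.left.filter fun l => l < r + 1).card =
        (s.left.filter fun l => l < r).card + if r ∈ s.left then 1 else 0 := by
      simpa [Nat.lt_succ_iff] using card_filter_le_and s.left (fun _ => True) r
    refine WP.intro fun Q hQ => ?_
    rw [WP_when]
    simp only [Test.Holds, Expr.eval, Expr.get1, hxr, aY]
    constructor
    · rintro ⟨h8, hY⟩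
      have hrL : r ∈ s.left := mem_left.2 ⟨hr, hY⟩
      obtain ⟨_, hm, hc⟩ := hcase.resolve_left fun h => by omega
      have hspec := searchPath_spec s' r hxr (by
        rw [eL, eD]
        exact fun l hl hlr => (hm l hl hlr).imp fun x h => ⟨h.1, h.2.1⟩)
      rw [eL, eD, eC, aX, en, em, ← hN, ← hM] at hspec
      rw [WP_seq]
      refine hspec.mono fun t₁ s₁ hF₁ ⟨ht₁, ha, V, ρ, hI, hcl⟩ => ?_
      have har : s₁.arr (.tmp 0) r 0 = -1 := by
        simpa using congrFun ha r
      have hother : ∀ l : ℕ, l < r → s₁.arr (.tmp 0) l 0 = s'.arr (.tmp 0) l 0 := by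
        intro l hl
        have := congrFun ha l
        rwa [Function.update_of_ne (by omega)] at this
      have hV : V.card ≤ min N M + 1 := by
        have h₁ := hI.card_le
        have h₂ : V.card ≤ M := by
          have := Finset.card_le_card hI.sub
          refine this.trans ((Finset.card_filter_le _ _).trans ?_)
          simp [hM]
        have h₃ : s.left.card ≤ N := (Finset.card_filter_le _ _).trans (by simp [hN])
        omega
      have htime : ∀ t₂, t₂ ≤ 25 * (V.card + 1) → t + (12 + (t₁ + (5 + t₂)) + 8) ≤
          20 * (r + 1) + (s.left.filter fun l => l < r + 1).card * augmentBound N M := by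
        intro t₂ ht₂
        rw [hsucc, if_pos hrL]
        have := Nat.add_mul (s.left.filter fun l => l < r).card 1 (augmentBound N M)
        -- The surplus over the bound for the search pays for the shifts along the path.
        have : augmentBound N M =
            (50 * N + 200) * (M + 1) * (min N M + 3) + 50 * ((M + 1) * (min N M + 3)) := by
          unfold augmentBound
          ring
        have : min N M + 3 ≤ (M + 1) * (min N M + 3) := Nat.le_mul_of_pos_left _ (by omega)
        omega
      rw [WP_ite]
      constructor
      · intro hf
        have hf' : s₁.var (.tmp 3) = -1 := by
          rcases hI.free_spec with h | ⟨x, _, h, _⟩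
          · exact h
          · simp at hf
            omega
        simp only [WP_assign]
        refine hQ _ _ ⟨?_, Or.inl ⟨by simp, ?_⟩⟩
        · have := htime 2 (by omega)
          simp only [Test.cost, Expr.cost]
          omega
        · rw [hf'] at hI
          exact hI.not_assignable hrL har (hcl hf')
      · intro hf
        have hf' : 0 ≤ s₁.var (.tmp 3) := by simpa using hf
        have hflip := hI.flipInv hf' har (fun l hl hlr => by
          rw [hother l hlr]
          exact hm l hl hlr) (fun x hx => by
          refine le_trans (Finset.card_le_card fun l hl => ?_) (hc x hx)
          simp only [Finset.mem_filter] at hl ⊢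
          obtain ⟨hl, hlr, hlx⟩ := hl
          have hne : l ≠ r := by
            rintro rfl
            omega
          have hlt : l < r := by omega
          exact ⟨hl, hlt, by rw [← hother l hlt]; exact hlx⟩)
        refine (flipPath_spec s₁ r _ _ _ _ V ρ hI.sub hrL hflip).mono
          fun t₂ s₂ hF₂ ⟨ht₂, hm₂, hc₂⟩ => ?_
        have e8 : s₂.var (.tmp 8) = 1 := by
          rw [hF₂.1 (.tmp 8) rfl, hF₁.1 (.tmp 8) rfl, h8]
        refine hQ _ _ ⟨?_, Or.inr ⟨by simpa using e8, fun l hl hlr => ?_, fun x hx => ?_⟩⟩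
        · have h₁ := hI.rank_le
          have := htime t₂ (by omega)
          simp only [Test.cost, Expr.cost]
          omega
        · exact hm₂ l hl (by omega)
        · simpa [matchedTo, Nat.lt_succ_iff] using hc₂ x hx
    · intro hH
      refine hQ _ _ ⟨?_, ?_⟩
      · rw [hsucc, Nat.add_mul]
        simp
        omega
      · rcases hcase with h | ⟨h8, hm, hc⟩
        · exact Or.inl (by simpa using h)
        · have hrL : r ∉ s.left := fun h => hH ⟨h8, (mem_left.1 h).2⟩
          refine Or.inr ⟨by simpa using h8, fun l hl hlr => ?_, fun x hx => ?_⟩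
          · have hne : l ≠ r := fun h => hrL (h ▸ hl)
            exact hm l hl (by omega)
          · refine le_trans (Finset.card_le_card fun l hl => ?_) (hc x hx)
            simp only [Finset.mem_filter] at hl ⊢
            have hne : l ≠ r := fun h => hrL (h ▸ hl.1)
            exact ⟨hl.1, by omega, hl.2.2⟩
  · rintro t s' hF ⟨ht, hcase⟩
    refine ⟨?_, ?_⟩
    · have : (s.left.filter fun l => l < N).card = s.left.card := by
        congr 1
        refine Finset.filter_true_of_mem fun l hl => (mem_left.1 hl).1
      rw [this] at ht
      simp
      omega
    · rcases hcase with ⟨h8, h⟩ | ⟨h8, hm, hc⟩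
      · simp [h8, h]
      · refine iff_of_true (by simp [h8]) ⟨fun l => (s'.arr (.tmp 0) l 0).toNat,
          fun l hl => ?_, fun x hx => ?_⟩
        · obtain ⟨x, hx, he, hA⟩ := hm l hl (mem_left.1 hl).1
          simpa [he] using ⟨hx, hA⟩
        · refine le_trans (Finset.card_le_card fun l hl => ?_) (hc x hx)
          simp only [Finset.mem_filter] at hl ⊢
          obtain ⟨y, _, he, _⟩ := hm l hl.1 (mem_left.1 hl.1).1
          refine ⟨hl.1, (mem_left.1 hl.1).1, ?_⟩
          rw [he] at hl ⊢
          simpa using hl.2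

theorem matchingTest_preserved {s s₁ : Store} (h : Frame matchingTest s s₁) :
    s.Preserved s₁ (fun x => x = .found) fun _ => False := by
  refine ⟨fun x hx hout => h.1 x ?_, fun a ha _ => h.2 a ?_⟩
  · cases x <;> first | rfl | exact absurd rfl hout | exact absurd rfl (hx _)
  · cases a <;> first | rfl | exact absurd rfl (ha _)

theorem isMatchingTest_matchingTest : IsMatchingTest matchingTest := by
  intro s
  obtain ⟨t, s₁, he, _, h⟩ := matchingTest_spec s
  exact ⟨t, s₁, he, h, matchingTest_preserved (Frame.of_exec he)⟩

/-! ### A topological sort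

`tmp 0[i]` tells whether the node `i` is in the sequence already, and `tmp 1[i]` whether it is in
the sequence or has a predecessor that is not. -/

/-- Mark the nodes that cannot come next. -/
def markBlocked : Prog :=
  .for (.tmp 1) .n (.store1 (.tmp 1) (.var (.tmp 1)) (.get1 (.tmp 0) (.var (.tmp 1)))) ;;
  .for (.tmp 2) .e
    (.when (.eq (.get1 (.tmp 0) (.get1 .src (.var (.tmp 2)))) (.lit 0))
      (.store1 (.tmp 1) (.get1 .dst (.var (.tmp 2))) (.lit 1)))

/-- Append a node without predecessors outside the sequence. -/
def appendNode : Prog :=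
  markBlocked ;;
  .for (.tmp 1) .n
    (.when (.eq (.get1 (.tmp 1) (.var (.tmp 1))) (.lit 0)) (.tmp 3 ≔ .var (.tmp 1))) ;;
  .store1 .ord (.var (.tmp 0)) (.var (.tmp 3)) ;;
  .store1 (.tmp 0) (.var (.tmp 3)) (.lit 1)

/-- Sort the nodes topologically. -/
def topologicalSort : Prog :=
  .for (.tmp 1) .n (.store1 (.tmp 0) (.var (.tmp 1)) (.lit 0)) ;;
  .for (.tmp 0) .n appendNode

theorem markBlocked_spec {n : ℕ} (E : Finset (Fin n × Fin n)) (s : Store) (h : s.HasGraph E) :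
    WP markBlocked s fun t s₁ => t ≤ 40 * (n + E.card + 1) ∧ ∀ i : Fin n,
      s₁.arr (.tmp 1) (i : ℕ) 0 = 0 ↔ s.arr (.tmp 0) (i : ℕ) 0 = 0 ∧
        ∀ p ∈ E, p.2 = i → s.arr (.tmp 0) (p.1 : ℕ) 0 ≠ 0 := by
  obtain ⟨hn, he, l, hnd, hl, hE⟩ := h
  have hlen : l.length = E.card := by rw [← hl, List.toFinset_card_of_nodup hnd]
  unfold markBlocked
  rw [WP_seq]
  refine WP_for (N := n) (fun i t s' => t = 14 * i ∧
    ∀ k : ℕ, k < i → s'.arr (.tmp 1) k 0 = s.arr (.tmp 0) k 0) rfl rfl (by decide)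
    (by simp [hn]) (by simp) ?_ ?_
  · rintro i t s' hi hF hxi ⟨ht, h1⟩
    simp only [WP_store1]
    refine ⟨by simp; omega, fun k hk => ?_⟩
    have a0 : s'.arr (.tmp 0) = s.arr (.tmp 0) := hF.2 (.tmp 0) rfl
    simp only [setVar_arr, setArr_arr, Expr.eval, Expr.get1, hxi, Nat.cast_inj, true_and,
      and_true, a0]
    split_ifs with h
    · rw [h]
    · exact h1 k (by omega)
  rintro t s' hF ⟨ht, h1⟩
  have he' : s'.var .e = E.card := by rw [← he]; simpa using hF.1 .e rfl
  refine WP_for (N := E.card) (fun i t s' => t ≤ 40 * i ∧ ∀ k : Fin n,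
    s'.arr (.tmp 1) (k : ℕ) 0 = 0 ↔ s.arr (.tmp 0) (k : ℕ) 0 = 0 ∧
      ∀ x (hx : x < l.length), x < i → l[x].2 = k → s.arr (.tmp 0) (l[x].1 : ℕ) 0 ≠ 0) rfl rfl
    (by decide) (by simp [he']) ?_ ?_ ?_
  · refine ⟨by simp, fun k => ?_⟩
    simp [h1 k k.2]
  · rintro i t₁ s₁ hi hF₁ hxi ⟨ht₁, h2⟩
    have a0 : s₁.arr (.tmp 0) = s.arr (.tmp 0) := by
      rw [hF₁.2 (.tmp 0) rfl, hF.2 (.tmp 0) rfl]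
    have as : s₁.arr .src = s.arr .src := by rw [hF₁.2 .src rfl, hF.2 .src rfl]
    have ad : s₁.arr .dst = s.arr .dst := by rw [hF₁.2 .dst rfl, hF.2 .dst rfl]
    have hil : i < l.length := by omega
    obtain ⟨hs, hd⟩ := hE i hil
    refine WP.intro fun Q hQ => ?_
    have hstep : ∀ k : Fin n, (∀ x (hx : x < l.length), x < i + 1 → l[x].2 = k →
        s.arr (.tmp 0) (l[x].1 : ℕ) 0 ≠ 0) ↔ (∀ x (hx : x < l.length), x < i → l[x].2 = k →
        s.arr (.tmp 0) (l[x].1 : ℕ) 0 ≠ 0) ∧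
        (l[i].2 = k → s.arr (.tmp 0) (l[i].1 : ℕ) 0 ≠ 0) := by
      intro k
      constructor
      · exact fun h => ⟨fun x hx hxi => h x hx (by omega), h i hil (by omega)⟩
      · rintro ⟨h, h'⟩ x hx hxi
        rcases Nat.lt_succ_iff_lt_or_eq.1 hxi with hxi | rfl
        · exact h x hx hxi
        · exact h'
    rw [WP_when]
    simp only [Test.Holds, Expr.get1, Expr.eval, hxi, a0, as, hs, WP_store1, ad, hd]
    constructor
    · intro hz
      refine hQ _ _ ⟨by simp; omega, fun k => ?_⟩
      rw [hstep]
      simp only [setVar_arr, setArr_arr, Nat.cast_inj, true_and, and_true]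
      by_cases hk : (k : ℕ) = l[i].2
      · have : l[i].2 = k := (Fin.ext hk).symm
        simp [hk, this, hz]
      · have : l[i].2 ≠ k := fun h => hk (by rw [h])
        simp [hk, this, h2]
    · intro hz
      refine hQ _ _ ⟨by simp; omega, fun k => ?_⟩
      rw [hstep]
      simp [h2, hz]
  · rintro t₁ s₁ hF₁ ⟨ht₁, h2⟩
    refine ⟨by omega, fun i => ?_⟩
    rw [h2]
    refine and_congr_right fun _ => ?_
    constructor
    · intro h p hp hpi
      rw [← hl, List.mem_toFinset] at hp
      obtain ⟨x, hx, rfl⟩ := List.mem_iff_getElem.1 hp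
      exact h x hx (by omega) hpi
    · intro h x hx _ hxi
      exact h _ (by rw [← hl, List.mem_toFinset]; exact List.getElem_mem hx) hxi

/-- In a set of nodes of an acyclic graph, some node has no predecessor in the set. -/
theorem IsAcyclic.exists_minimal {n : ℕ} {E : Finset (Fin n × Fin n)} (h : IsAcyclic E)
    (U : Set (Fin n)) (hU : U.Nonempty) : ∃ v ∈ U, ∀ p ∈ E, p.2 = v → p.1 ∉ U := by
  let R : Fin n → Fin n → Prop := Relation.TransGen fun a b => (a, b) ∈ E
  have : IsTrans (Fin n) R := ⟨fun _ _ _ => Relation.TransGen.trans⟩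
  have : Std.Irrefl R := ⟨h⟩
  obtain ⟨v, hv, hmin⟩ := (Finite.wellFounded_of_trans_of_irrefl R).has_min U hU
  exact ⟨v, hv, fun p hp hpv hpU => hmin p.1 hpU (Relation.TransGen.single (hpv ▸ hp))⟩

theorem HasGraph.congr {n : ℕ} {E : Finset (Fin n × Fin n)} {s s' : Store} (h : s.HasGraph E)
    (h₁ : s'.var .n = s.var .n) (h₂ : s'.var .e = s.var .e) (h₃ : s'.arr .src = s.arr .src)
    (h₄ : s'.arr .dst = s.arr .dst) : s'.HasGraph E := by
  unfold Store.HasGraph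
  rw [h₁, h₂, h₃, h₄]
  exact h

/-- By acyclicity some node outside the sequence has all its predecessors inside. Any such node will
do; the scan keeps the last one that it meets. -/
theorem appendNode_spec {n : ℕ} (E : Finset (Fin n × Fin n)) (hE : IsAcyclic E) (s : Store)
    (h : s.HasGraph E) (j : ℕ) (hj : s.var (.tmp 0) = j)
    (hU : ∃ i : Fin n, s.arr (.tmp 0) (i : ℕ) 0 = 0) :
    WP appendNode s fun t s₁ => t ≤ 100 * (n + E.card + 1) ∧ ∃ v : Fin n,
      s.arr (.tmp 0) (v : ℕ) 0 = 0 ∧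
      (∀ p ∈ E, p.2 = v → s.arr (.tmp 0) (p.1 : ℕ) 0 ≠ 0) ∧
      (∀ k, s₁.arr .ord k 0 = if k = j then ((v : ℕ) : ℤ) else s.arr .ord k 0) ∧
      ∀ i, s₁.arr (.tmp 0) i 0 = if i = (v : ℕ) then 1 else s.arr (.tmp 0) i 0 := by
  unfold appendNode
  rw [WP_seq]
  refine (markBlocked_spec E s h).mono fun t₁ s₁ hF₁ ⟨ht₁, h1⟩ => ?_
  rw [WP_seq]
  have hn : s₁.var .n = n := by rw [hF₁.1 .n rfl, h.1]
  refine WP_for (N := n) (fun i t s' => t ≤ 20 * i ∧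
    ((∃ k : Fin n, (k : ℕ) < i ∧ s₁.arr (.tmp 1) (k : ℕ) 0 = 0) → ∃ v : Fin n,
      s₁.arr (.tmp 1) (v : ℕ) 0 = 0 ∧ s'.var (.tmp 3) = (v : ℕ))) rfl rfl
    (by decide) (by simp [hn]) (by simp) ?_ ?_
  · rintro i t s' hi hF hxi ⟨ht, hv⟩
    have a1 : s'.arr (.tmp 1) = s₁.arr (.tmp 1) := hF.2 (.tmp 1) rfl
    refine WP.intro fun Q hQ => ?_
    simp only [WP_when, Test.Holds, Expr.get1, Expr.eval, hxi, a1, WP_assign]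
    constructor
    · intro hz
      exact hQ _ _ ⟨by simp; omega, fun _ => ⟨⟨i, hi⟩, hz, by simp⟩⟩
    · intro hz
      refine hQ _ _ ⟨by simp; omega, fun ⟨k, hk, hkz⟩ => ?_⟩
      have hki : (k : ℕ) ≠ i := fun h => hz (h ▸ hkz)
      obtain ⟨v, hv₁, hv₂⟩ := hv ⟨k, by omega, hkz⟩
      exact ⟨v, hv₁, by simpa using hv₂⟩
  · rintro t s' hF ⟨ht, hv⟩
    obtain ⟨u, hu, hmin⟩ := hE.exists_minimal {i : Fin n | s.arr (.tmp 0) (i : ℕ) 0 = 0} hU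
    obtain ⟨v, hv₁, hv₂⟩ := hv ⟨u, u.2, (h1 u).2 ⟨hu, hmin⟩⟩
    obtain ⟨hv₃, hv₄⟩ := (h1 v).1 hv₁
    have e0 : s'.var (.tmp 0) = j := by rw [hF.1 (.tmp 0) rfl, hF₁.1 (.tmp 0) rfl, hj]
    have a0 : s'.arr (.tmp 0) = s.arr (.tmp 0) := by
      rw [hF.2 (.tmp 0) rfl, hF₁.2 (.tmp 0) rfl]
    have ao : s'.arr .ord = s.arr .ord := by rw [hF.2 .ord rfl, hF₁.2 .ord rfl]
    simp only [WP_seq, WP_store1]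
    refine ⟨by simp; omega, v, hv₃, hv₄, fun k => ?_, fun i => ?_⟩
    · simp [setArr_arr, e0, hv₂, ao]
    · simp [setArr_arr, hv₂, a0]

theorem topologicalSort_spec {n : ℕ} (E : Finset (Fin n × Fin n)) (hE : IsAcyclic E) (s : Store)
    (h : s.HasGraph E) :
    WP topologicalSort s fun t s₁ => t ≤ 130 * (n + 1) * (n + E.card + 1) ∧
      ∃ σ : Fin n ≃ Fin n, (∀ k : Fin n, s₁.arr .ord (k : ℕ) 0 = (σ k : ℕ)) ∧
        ∀ p ∈ E, σ.symm p.1 < σ.symm p.2 := by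
  unfold topologicalSort
  rw [WP_seq]
  refine WP_for (N := n) (fun i t s' => t = 12 * i ∧
    ∀ k : ℕ, k < i → s'.arr (.tmp 0) k 0 = 0) rfl rfl (by decide) (by simp [h.1]) (by simp) ?_ ?_
  · rintro i t s' hi hF hxi ⟨ht, h1⟩
    simp only [WP_store1]
    refine ⟨by simp; omega, fun k hk => ?_⟩
    simp only [setVar_arr, setArr_arr, Expr.eval, hxi, Nat.cast_inj, true_and, and_true]
    split_ifs with h
    · rfl
    · exact h1 k (by omega)
  rintro t s' hF ⟨ht, h1⟩
  have hG : s'.HasGraph E := HasGraph.congr h (hF.1 .n rfl) (hF.1 .e rfl) (hF.2 .src rfl)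
    (hF.2 .dst rfl)
  refine WP_for (N := n) (fun j t s₁ => t ≤ (100 * (n + E.card + 1) + 8) * j ∧
    ∃ f : ℕ → ℕ, (∀ k < j, f k < n ∧ s₁.arr .ord k 0 = f k) ∧
      (∀ k < j, ∀ k' < j, f k = f k' → k = k') ∧
      (∀ i < n, ((∃ k < j, f k = i) ∧ s₁.arr (.tmp 0) i 0 = 1) ∨
        ((¬ ∃ k < j, f k = i) ∧ s₁.arr (.tmp 0) i 0 = 0)) ∧
      ∀ p ∈ E, ∀ k < j, f k = p.2 → ∃ k' < k, f k' = p.1) rfl rfl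
    (by decide) (by simp [hG.1]) ?_ ?_ ?_
  · refine ⟨by simp, fun _ => 0, by simp, by simp, fun i hi => Or.inr ⟨by simp, ?_⟩, by simp⟩
    simpa using h1 i hi
  · rintro j t₁ s₁ hj hF₁ hxj ⟨ht₁, f, hf₁, hf₂, hf₃, hf₄⟩
    have hU : ∃ i : Fin n, s₁.arr (.tmp 0) (i : ℕ) 0 = 0 := by
      by_contra hno
      push Not at hno
      -- If no node were missing, the `j < n` listed nodes would be all `n` nodes.
      have hsub : Finset.range n ⊆ (Finset.range j).image f := by
        intro i hi
        rcases hf₃ i (Finset.mem_range.1 hi) with ⟨⟨k, hk, rfl⟩, _⟩ | ⟨_, hz⟩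
        · exact Finset.mem_image_of_mem f (Finset.mem_range.2 hk)
        · exact absurd hz (hno ⟨i, Finset.mem_range.1 hi⟩)
      have := (Finset.card_le_card hsub).trans Finset.card_image_le
      simp only [Finset.card_range] at this
      omega
    have hG₁ : s₁.HasGraph E := HasGraph.congr hG (hF₁.1 .n rfl) (hF₁.1 .e rfl) (hF₁.2 .src rfl)
      (hF₁.2 .dst rfl)
    refine (appendNode_spec E hE s₁ hG₁ j hxj hU).mono
      fun t₂ s₂ _ ⟨ht₂, v, hv, hpred, ho, h0⟩ => ?_
    have hvn : ¬ ∃ k < j, f k = v := by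
      rcases hf₃ v v.2 with ⟨_, h⟩ | ⟨h, _⟩
      · omega
      · exact h
    have hfj : ∀ k < j, Function.update f j (v : ℕ) k = f k := fun k hk =>
      Function.update_of_ne (by omega) _ _
    refine ⟨by rw [Nat.mul_succ]; omega, Function.update f j v, ?_, ?_, ?_, ?_⟩
    · intro k hk
      rcases Nat.lt_succ_iff_lt_or_eq.1 hk with hk | rfl
      · rw [hfj k hk]
        refine ⟨(hf₁ k hk).1, ?_⟩
        rw [setVar_arr, ho, if_neg (by omega)]
        exact (hf₁ k hk).2
      · simp [ho]
    · intro k hk k' hk' he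
      rcases Nat.lt_succ_iff_lt_or_eq.1 hk with hk | rfl <;>
        rcases Nat.lt_succ_iff_lt_or_eq.1 hk' with hk' | rfl
      · rw [hfj k hk, hfj k' hk'] at he
        exact hf₂ k hk k' hk' he
      · rw [hfj k hk, Function.update_self] at he
        exact absurd ⟨k, hk, he⟩ hvn
      · rw [hfj k' hk', Function.update_self] at he
        exact absurd ⟨k', hk', he.symm⟩ hvn
      · rfl
    · intro i hi
      rw [setVar_arr, h0]
      by_cases hiv : i = v
      · subst hiv
        exact Or.inl ⟨⟨j, by omega, by simp⟩, by simp⟩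
      · rw [if_neg (by exact_mod_cast hiv)]
        refine (hf₃ i hi).imp (And.imp_left ?_) (And.imp_left (mt ?_))
        · rintro ⟨k, hk, rfl⟩
          exact ⟨k, by omega, hfj k hk⟩
        · rintro ⟨k, hk, hki⟩
          rcases Nat.lt_succ_iff_lt_or_eq.1 hk with hk | rfl
          · exact ⟨k, hk, by rw [← hki, hfj k hk]⟩
          · rw [Function.update_self] at hki
            exact absurd hki.symm hiv
    · intro p hp k hk hkp
      rcases Nat.lt_succ_iff_lt_or_eq.1 hk with hk | rfl
      · rw [hfj k hk] at hkp
        obtain ⟨k', hk', h⟩ := hf₄ p hp k hk hkp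
        exact ⟨k', hk', by rw [hfj k' (by omega), h]⟩
      · rw [Function.update_self] at hkp
        have hz := hpred p hp (Fin.ext hkp.symm)
        rcases hf₃ p.1 p.1.2 with ⟨⟨k', hk', h⟩, _⟩ | ⟨_, h⟩
        · exact ⟨k', hk', by rw [hfj k' hk', h]⟩
        · exact absurd h hz
  · rintro t₁ s₁ hF₁ ⟨ht₁, f, hf₁, hf₂, hf₃, hf₄⟩
    refine ⟨?_, ?_⟩
    · subst ht
      nlinarith [Nat.zero_le (n * E.card), Nat.zero_le (n * n), Nat.zero_le E.card]
    -- The list has `n` distinct entries below `n`, so it is a permutation.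
    · have hinj : Function.Injective fun k : Fin n => (⟨f k, (hf₁ k k.2).1⟩ : Fin n) :=
        fun a b hab => Fin.ext (hf₂ a a.2 b b.2 (Fin.mk.inj_iff.1 hab))
      let σ := Equiv.ofBijective _ (Finite.injective_iff_bijective.1 hinj)
      refine ⟨σ, fun k => (hf₁ k k.2).2, fun p hp => ?_⟩
      have hσ : ∀ k, (σ k : ℕ) = f k := fun k => rfl
      obtain ⟨k', hk', h'⟩ := hf₄ p hp (σ.symm p.2) (σ.symm p.2).2 (by
        rw [← hσ, Equiv.apply_symm_apply])
      have hk'n : k' < n := by omega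
      have : σ.symm p.1 = ⟨k', hk'n⟩ := by
        rw [Equiv.symm_apply_eq]
        exact Fin.ext (by rw [hσ]; exact h'.symm)
      rw [this, Fin.lt_def]
      exact hk'

theorem topologicalSort_preserved {s s₁ : Store} (h : Frame topologicalSort s s₁) :
    s.Preserved s₁ (fun _ => False) fun a => a = .ord := by
  refine ⟨fun x hx _ => h.1 x ?_, fun a ha hout => h.2 a ?_⟩
  · cases x <;> first | rfl | exact absurd rfl (hx _)
  · cases a <;> first | rfl | exact absurd rfl hout | exact absurd rfl (ha _)

theorem isTopologicalSort_topologicalSort : IsTopologicalSort topologicalSort := by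
  intro n E s hE h
  obtain ⟨t, s₁, he, _, hσ⟩ := topologicalSort_spec E hE s h
  exact ⟨t, s₁, he, hσ, topologicalSort_preserved (Frame.of_exec he)⟩

/-! ### The parts of the algorithm -/

/-- The predecessors listed in `Y`. -/
def Store.predsY (s : Store) : Finset ℕ :=
  (Finset.range (s.var .n).toNat).filter fun k : ℕ => s.arr .Y k 0 = 1

theorem mem_predsY {s : Store} {k : ℕ} :
    k ∈ s.predsY ↔ k < (s.var .n).toNat ∧ s.arr .Y k 0 = 1 := by
  simp [Store.predsY]

theorem card_filter_lt_succ_and (L : Finset ℕ) (p : ℕ → Prop) [DecidablePred p] (i : ℕ) :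
    (L.filter fun l => l < i + 1 ∧ p l).card =
      (L.filter fun l => l < i ∧ p l).card + if i ∈ L ∧ p i then 1 else 0 := by
  simpa only [Nat.lt_succ_iff] using card_filter_le_and L p i

theorem splitY_spec (s : Store) (c : ℕ) (hc : s.var .c = c) :
    WP splitY s fun t s₁ => t ≤ 50 * ((s.var .n).toNat + 1) ∧
      s₁.left = s.predsY.filter (fun k : ℕ => ¬ s.arr .X k c = 1) ∧
      s₁.var .sizeS = (s.predsY.filter fun k : ℕ => s.arr .X k c = 1).card ∧
      s₁.var .sizeY = s₁.left.card := by
  unfold splitY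
  simp only [WP_seq, WP_assign]
  refine WP_for (N := (s.var .n).toNat) (fun i t s' => t ≤ 50 * i ∧
    (∀ k : ℕ, k < i → (s'.arr .Yp k 0 = 1 ↔ s.arr .Y k 0 = 1 ∧ ¬ s.arr .X k c = 1)) ∧
    s'.var .sizeS = (s.predsY.filter fun k : ℕ => k < i ∧ s.arr .X k c = 1).card ∧
    s'.var .sizeY = (s.predsY.filter fun k : ℕ => k < i ∧ ¬ s.arr .X k c = 1).card) rfl rfl
    (by decide) (by simp) ?_ ?_ ?_
  · simp
  · rintro i t s' hi hF hxi ⟨ht, h1, h2, h3⟩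
    have e0 : s'.var .c = c := by rw [← hc]; simpa using hF.1 .c rfl
    have aY : s'.arr .Y = s.arr .Y := by simpa using hF.2 .Y rfl
    have aX : s'.arr .X = s.arr .X := by simpa using hF.2 .X rfl
    have hL : i ∈ s.predsY ↔ s.arr .Y i 0 = 1 := by simp [mem_predsY, hi]
    have hYp : ∀ (z : ℤ) (s₁ : Store), (∀ k : ℕ, s₁.arr .Yp k 0 =
        if k = i then z else s'.arr .Yp k 0) →
        (z = 1 ↔ s.arr .Y i 0 = 1 ∧ ¬ s.arr .X i c = 1) → ∀ k : ℕ, k < i + 1 →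
        (s₁.arr .Yp k 0 = 1 ↔ s.arr .Y k 0 = 1 ∧ ¬ s.arr .X k c = 1) := by
      intro z s₁ h hz k hk
      rw [h]
      split_ifs with hki
      · rw [hki]
        exact hz
      · exact h1 k (by omega)
    refine WP.intro fun Q hQ => ?_
    simp only [WP_seq, WP_store1, WP_when, WP_ite, WP_assign, Test.Holds, Expr.get1, Expr.eval,
      setArr_var, setArr_arr_of_ne, ne_eq, reduceCtorEq, not_false_eq_true, hxi, aY, aX, e0]
    refine ⟨fun hY => ⟨fun hX => ?_, fun hX => ?_⟩, fun hY => ?_⟩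
    · refine hQ _ _ ⟨by simp; omega, hYp 0 _ ?_ (by simp [hX]), ?_, ?_⟩
      · intro k
        simp [setArr_arr]
      · rw [card_filter_lt_succ_and]
        simp [hL, hY, hX, h2]
      · rw [card_filter_lt_succ_and]
        simp [hL, hX, h3]
    · refine hQ _ _ ⟨by simp; omega, hYp 1 _ ?_ (by simp [hX, hY]), ?_, ?_⟩
      · intro k
        simp only [setVar_arr, setArr_arr, Nat.cast_inj, true_and, and_true]
        split_ifs <;> rfl
      · rw [card_filter_lt_succ_and]
        simp [hX, h2]
      · rw [card_filter_lt_succ_and]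
        simp [hL, hX, hY, h3]
    · refine hQ _ _ ⟨by simp; omega, hYp 0 _ ?_ (by simp [hY]), ?_, ?_⟩
      · intro k
        simp [setArr_arr]
      · rw [card_filter_lt_succ_and]
        simp [hL, hY, h2]
      · rw [card_filter_lt_succ_and]
        simp [hL, hY, h3]
  · rintro t s' hF ⟨ht, h1, h2, h3⟩
    have en : s'.var .n = s.var .n := by simpa using hF.1 .n rfl
    have hleft : s'.left = s.predsY.filter (fun k : ℕ => ¬ s.arr .X k c = 1) := by
      ext k
      simp only [mem_left, Finset.mem_filter, mem_predsY, en, and_assoc]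
      exact and_congr_right fun hk => h1 k hk
    have hall : ∀ (p : ℕ → Prop) [DecidablePred p], (s.predsY.filter fun k : ℕ =>
        k < (s.var .n).toNat ∧ p k) = s.predsY.filter p := by
      intro p _
      refine Finset.filter_congr fun k hk => ?_
      simp [(mem_predsY.1 hk).1]
    rw [hall] at h2 h3
    refine ⟨by simp; omega, hleft, h2, ?_⟩
    rw [hleft, h3]

theorem initColours_spec (s : Store) (c : ℕ) (hc : s.var .c = c) :
    WP initColours s fun t s₁ => t ≤ 30 * ((s.var .m).toNat + 1) ∧
      s₁.coloursLeft = (Finset.range (s.var .m).toNat).erase c := by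
  unfold initColours
  refine WP_for (N := (s.var .m).toNat) (fun i t s' => t ≤ 30 * i ∧
    ∀ d : ℕ, d < i → (s'.arr .Cp d 0 = 1 ↔ d ≠ c)) rfl rfl (by decide) rfl (by simp) ?_ ?_
  · rintro i t s' hi hF hxi ⟨ht, h1⟩
    have e0 : s'.var .c = c := by rw [← hc]; exact hF.1 .c rfl
    refine WP.intro fun Q hQ => ?_
    simp only [WP_ite, WP_store1, Test.Holds, Expr.eval, hxi, e0, Nat.cast_inj]
    constructor <;> intro h <;> refine hQ _ _ ⟨by simp; omega, fun d hd => ?_⟩ <;>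
      simp only [setVar_arr, setArr_arr, Nat.cast_inj, true_and, and_true] <;>
      split_ifs with hdi
    · simp [hdi, h]
    · exact h1 d (by omega)
    · simp [hdi, h]
    · exact h1 d (by omega)
  · rintro t s' hF ⟨ht, h1⟩
    have em : s'.var .m = s.var .m := hF.1 .m rfl
    refine ⟨by omega, ?_⟩
    ext d
    simp only [mem_coloursLeft, em, Finset.mem_erase, Finset.mem_range]
    constructor
    · exact fun h => ⟨(h1 d h.1).1 h.2, h.1⟩
    · exact fun h => ⟨h.2, (h1 d h.2).2 h.1⟩

theorem copiesExpr_eval (s : Store) (d : ℕ) (hd : s.var .d = d) :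
    copiesExpr.eval s = s.copies d := by
  simp [copiesExpr, Store.copies, hd]

theorem copiesExpr_cost : copiesExpr.cost = 9 := by simp [copiesExpr]

theorem checkSkip_spec (s : Store) (v : ℕ) (hv : s.var .v = v) :
    WP checkSkip s fun t s₁ => t ≤ 50 * ((s.var .m).toNat + 1) ∧
      (s₁.var .skip = 0 ↔ ∀ d ∈ s.coloursLeft, s.arr .avail v d = 1 → 0 ≤ s.copies d) := by
  unfold checkSkip
  simp only [WP_seq, WP_assign]
  refine WP_for (N := (s.var .m).toNat) (fun i t s' => t ≤ 50 * i ∧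
    (s'.var .skip = 0 ↔ ∀ d ∈ s.coloursLeft, d < i → s.arr .avail v d = 1 → 0 ≤ s.copies d))
    rfl rfl (by decide) (by simp) (by simp) ?_ ?_
  · rintro i t s' hi hF hxi ⟨ht, h1⟩
    have ev : s'.var .v = v := by rw [← hv]; simpa using hF.1 .v rfl
    have aC : s'.arr .Cp = s.arr .Cp := hF.2 .Cp rfl
    have aA : s'.arr .avail = s.arr .avail := hF.2 .avail rfl
    have eC : s'.copies = s.copies := copies_congr (by simpa using hF.1 .v rfl)
      (by simpa using hF.1 .c rfl) (by simpa using hF.1 .sizeS rfl) (hF.2 .bonus rfl)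
    have hstep : (∀ d ∈ s.coloursLeft, d < i + 1 → s.arr .avail v d = 1 → 0 ≤ s.copies d) ↔
        (∀ d ∈ s.coloursLeft, d < i → s.arr .avail v d = 1 → 0 ≤ s.copies d) ∧
        (s.arr .Cp i 0 = 1 → s.arr .avail v i = 1 → 0 ≤ s.copies i) := by
      constructor
      · exact fun h => ⟨fun d hd hdi => h d hd (by omega),
          fun hC => h i (mem_coloursLeft.2 ⟨hi, hC⟩) (by omega)⟩
      · rintro ⟨h, h'⟩ d hd hdi
        rcases Nat.lt_succ_iff_lt_or_eq.1 hdi with hdi | rfl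
        · exact h d hd hdi
        · exact h' (mem_coloursLeft.1 hd).2
    refine WP.intro fun Q hQ => ?_
    simp only [WP_when, WP_assign, Test.Holds, availTest, Expr.get1, copiesExpr_eval s' i hxi,
      eC]
    simp only [Expr.eval, hxi, ev, aC, aA]
    constructor
    · rintro ⟨hC, hA, hlt⟩
      refine hQ _ _ ⟨by simp [copiesExpr_cost]; omega, ?_⟩
      rw [hstep]
      simp [hC, hA, hlt]
    · intro h
      refine hQ _ _ ⟨by simp [copiesExpr_cost]; omega, ?_⟩
      rw [hstep, setVar_var, if_neg (by decide), h1]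
      refine (and_iff_left fun hC hA => ?_).symm
      by_contra hlt
      exact h ⟨hC, hA, by omega⟩
  · rintro t s' hF ⟨ht, h1⟩
    refine ⟨by simp; omega, h1.trans ?_⟩
    exact ⟨fun h d hd => h d hd (mem_coloursLeft.1 hd).1, fun h d hd _ => h d hd⟩

/-! ### Pruning the colours -/

/-- Remove from `Y'` all members that contain `d`. -/
def removeSets : Prog :=
  .for .k .n
    (.when (.and (.eq (.get1 .Yp (.var .k)) (.lit 1))
        (.eq (.get .X (.var .k) (.var .d)) (.lit 1)))
      (.store1 .Yp (.var .k) (.lit 0) ;;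
       .sizeY ≔ .sub (.var .sizeY) (.lit 1)))

/-- Remove the colour `d` if it can take all members of `Y'`. -/
def pruneColour : Prog :=
  .when (.and (.eq (.get1 .Cp (.var .d)) (.lit 1))
      (.or (.not availTest) (.not (.lt copiesExpr (.var .sizeY)))))
    (.changed ≔ .lit 1 ;; .store1 .Cp (.var .d) (.lit 0) ;; removeSets)

theorem pruneColours_eq : pruneColours =
    (.changed ≔ .lit 1 ;;
      .while (.eq (.var .changed) (.lit 1)) (.changed ≔ .lit 0 ;; .for .d .m pruneColour)) :=
  rfl

theorem removeSets_spec (s : Store) (d : ℕ) (hd : s.var .d = d)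
    (hY : s.var .sizeY = s.left.card) :
    WP removeSets s fun t s₁ => t ≤ 40 * ((s.var .n).toNat + 1) ∧
      s₁.left = s.left.filter (fun k : ℕ => ¬ s.arr .X k d = 1) ∧
      s₁.var .sizeY = s₁.left.card := by
  unfold removeSets
  refine WP_for (N := (s.var .n).toNat) (fun i t s' => t ≤ 40 * i ∧
    (∀ k : ℕ, s'.arr .Yp k 0 = 1 ↔ s.arr .Yp k 0 = 1 ∧ ¬ (k < i ∧ s.arr .X k d = 1)) ∧
    s'.var .sizeY = (s.left.card : ℤ) -
      (s.left.filter fun k : ℕ => k < i ∧ s.arr .X k d = 1).card) rfl rfl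
    (by decide) rfl ?_ ?_ ?_
  · simp [hY]
  · rintro i t s' hi hF hxi ⟨ht, h1, h2⟩
    have ed : s'.var .d = d := by rw [← hd]; exact hF.1 .d rfl
    have aX : s'.arr .X = s.arr .X := hF.2 .X rfl
    have hL : i ∈ s.left ↔ s.arr .Yp i 0 = 1 := by simp [mem_left, hi]
    have hi' : s'.arr .Yp i 0 = 1 ↔ s.arr .Yp i 0 = 1 := by simp [h1]
    refine WP.intro fun Q hQ => ?_
    simp only [WP_seq, WP_store1, WP_when, WP_assign, Test.Holds, Expr.get1, Expr.eval,
      setArr_var, hxi, aX, ed, hi']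
    constructor
    · rintro ⟨hp, hX⟩
      refine hQ _ _ ⟨by simp; omega, fun k => ?_, ?_⟩
      · simp only [setVar_arr, setArr_arr, Nat.cast_inj, true_and, and_true]
        by_cases hk : k = i
        · subst hk
          simp [hX]
        · have : k < i + 1 ↔ k < i := by omega
          simp [hk, h1, this]
      · rw [card_filter_lt_succ_and]
        simp [hL, hp, hX, h2]
        ring
    · intro hn
      refine hQ _ _ ⟨by simp; omega, fun k => ?_, ?_⟩
      · simp only [setVar_arr, h1]
        by_cases hk : k = i
        · subst hk
          simp only [lt_self_iff_false, false_and, not_false_eq_true, and_true]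
          tauto
        · have : k < i + 1 ↔ k < i := by omega
          simp [this]
      · rw [card_filter_lt_succ_and, if_neg (by rwa [hL])]
        simp [h2]
  · rintro t s' hF ⟨ht, h1, h2⟩
    have en : s'.var .n = s.var .n := hF.1 .n rfl
    have hleft : s'.left = s.left.filter (fun k : ℕ => ¬ s.arr .X k d = 1) := by
      ext k
      simp only [mem_left, Finset.mem_filter, en, and_assoc, h1]
      refine and_congr_right fun hk => ?_
      simp [hk]
    refine ⟨by omega, hleft, ?_⟩
    have h3 : (s.left.filter fun k : ℕ => k < (s.var .n).toNat ∧ s.arr .X k d = 1) =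
        s.left.filter fun k : ℕ => s.arr .X k d = 1 := by
      refine Finset.filter_congr fun k hk => ?_
      simp [(mem_left.1 hk).1]
    have h4 := Finset.card_filter_add_card_filter_not (s := s.left)
      (fun k : ℕ => s.arr .X k d = 1)
    rw [h2, h3, hleft]
    omega

theorem pruneColour_spec (s : Store) (d v : ℕ) (hd : s.var .d = d) (hv : s.var .v = v)
    (hdm : d < (s.var .m).toNat) (hY : s.var .sizeY = s.left.card) :
    WP pruneColour s fun t s₁ => s₁.var .sizeY = s₁.left.card ∧
      ((d ∈ s.coloursLeft ∧ (s.arr .avail v d = 1 → (s.left.card : ℤ) ≤ s.copies d) ∧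
          s₁.coloursLeft = s.coloursLeft.erase d ∧
          s₁.left = s.left.filter (fun k : ℕ => ¬ s.arr .X k d = 1) ∧
          s₁.var .changed = 1 ∧ t ≤ 40 * ((s.var .n).toNat + 1) + 50) ∨
        ((d ∈ s.coloursLeft → s.arr .avail v d = 1 ∧ s.copies d < s.left.card) ∧
          s₁ = s ∧ t ≤ 50)) := by
  have hD : d ∈ s.coloursLeft ↔ s.arr .Cp d 0 = 1 := by simp [mem_coloursLeft, hdm]
  refine WP.intro fun Q hQ => ?_
  unfold pruneColour
  simp only [WP_seq, WP_store1, WP_when, WP_assign, Test.Holds, availTest, Expr.get1,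
    copiesExpr_eval s d hd]
  simp only [Expr.eval, hd, hv, hY, ← hD, setVar_var, reduceCtorEq, if_false]
  constructor
  · rintro ⟨hdD, hcond⟩
    set s' := (s.setVar .changed 1).setArr .Cp d 0 0 with hs'
    have eL : s'.left = s.left := left_congr (by simp [hs']) (by simp [hs', setArr_arr_of_ne])
    refine (removeSets_spec s' d (by simp [hs', hd]) (by simp [hs', hY, ← eL])).mono
      fun t s₁ hF ⟨ht, hL, hY₁⟩ => hQ _ _ ⟨hY₁, Or.inl ⟨hdD, fun hA => ?_, ?_, ?_, ?_, ?_⟩⟩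
    · rcases hcond with h | h
      · exact absurd hA h
      · omega
    · have aC : s₁.arr .Cp = s'.arr .Cp := hF.2 .Cp rfl
      have em : s₁.var .m = s.var .m := by rw [hF.1 .m rfl]; simp [hs']
      ext x
      simp only [mem_coloursLeft, Finset.mem_erase, aC, em, hs', setArr_arr, setVar_arr,
        Nat.cast_inj, true_and, and_true]
      by_cases hx : x = d <;> simp [hx]
    · rw [hL, eL]
      simp [hs', setArr_arr_of_ne]
    · rw [hF.1 .changed rfl]
      simp [hs']
    · simp only [hs', setArr_var, setVar_var, reduceCtorEq, if_false] at ht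
      simp [copiesExpr_cost]
      omega
  · intro hn
    refine hQ _ _ ⟨hY, Or.inr ⟨fun hdD => ?_, rfl, by simp [copiesExpr_cost]⟩⟩
    constructor
    · by_contra hA
      exact hn ⟨hdD, Or.inl hA⟩
    · by_contra hlt
      exact hn ⟨hdD, Or.inr (by simpa using hlt)⟩

/-- The restriction on the number of predecessors that choose a colour different from `c`. -/
def Store.fits (s : Store) (v : ℕ) (d x : ℕ) : Prop :=
  s.arr .avail v d = 1 → (x : ℤ) ≤ s.copies d

/-- The result `L', D'` of pruning the sets `L` and the colours `D`. -/
structure PruneInv (s : Store) (v : ℕ) (L D L' D' : Finset ℕ) : Prop where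
  left_sub : L' ⊆ L
  colours_sub : D' ⊆ D
  assignable : Assignable L' (fun k d => s.arr .X k d = 1) D' (s.fits v) ↔
    Assignable L (fun k d => s.arr .X k d = 1) D (s.fits v)

/-- The hypothesis `hfit` covers both reasons for a removal: an unavailable colour fits every load,
an available one must have enough copies for all of `L'`. -/
theorem PruneInv.erase {s : Store} {v : ℕ} {L D L' D' : Finset ℕ} (h : PruneInv s v L D L' D')
    {d : ℕ} (hd : d ∈ D') (hfit : s.fits v d L'.card) :
    PruneInv s v L D (L'.filter fun k : ℕ => ¬ s.arr .X k d = 1) (D'.erase d) := by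
  refine ⟨(Finset.filter_subset _ _).trans h.left_sub,
    (Finset.erase_subset _ _).trans h.colours_sub, ?_⟩
  rw [← h.assignable, ← assignable_erase_iff (fits := s.fits v) ?_ hd hfit]
  · congr! 2
  · intro d x y hxy hy hA
    have := hy hA
    omega

/-- Each removal of a colour costs a scan of `Y'`, which the term with `coloursLeft.card` pays for.
The last clause rests on the test depending on `Y'` only through its size: while `Y'` has not
shrunk, a colour that was kept remains unremovable. -/
theorem pruneRound_spec (s : Store) (v : ℕ) (hv : s.var .v = v)
    (hY : s.var .sizeY = s.left.card) :
    WP (.changed ≔ .lit 0 ;; .for .d .m pruneColour) s fun t s₁ =>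
      t + 40 * ((s.var .n).toNat + 1) * s₁.coloursLeft.card ≤ 60 * ((s.var .m).toNat + 1) +
        40 * ((s.var .n).toNat + 1) * s.coloursLeft.card ∧
      s₁.var .sizeY = s₁.left.card ∧
      PruneInv s v s.left s.coloursLeft s₁.left s₁.coloursLeft ∧
      ((s₁.var .changed = 0 ∧ s₁.coloursLeft = s.coloursLeft ∧ s₁.left = s.left) ∨
        (s₁.var .changed = 1 ∧ s₁.coloursLeft.card < s.coloursLeft.card ∧
          ∃ d ∈ s.coloursLeft, ¬ (s.arr .avail v d = 1 ∧ s.copies d < s.left.card))) ∧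
      (s₁.left.card < s.left.card ∨
        ∀ d ∈ s₁.coloursLeft, s.arr .avail v d = 1 ∧ s.copies d < s.left.card) := by
  rw [WP_seq, WP_assign]
  refine WP_for (N := (s.var .m).toNat) (fun i t s₁ =>
    t + 40 * ((s.var .n).toNat + 1) * s₁.coloursLeft.card ≤ 60 * i +
      40 * ((s.var .n).toNat + 1) * s.coloursLeft.card ∧
    s₁.var .sizeY = s₁.left.card ∧
    PruneInv s v s.left s.coloursLeft s₁.left s₁.coloursLeft ∧
    ((s₁.var .changed = 0 ∧ s₁.coloursLeft = s.coloursLeft ∧ s₁.left = s.left) ∨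
      (s₁.var .changed = 1 ∧ s₁.coloursLeft.card < s.coloursLeft.card ∧
        ∃ d ∈ s.coloursLeft, ¬ (s.arr .avail v d = 1 ∧ s.copies d < s.left.card))) ∧
    (s₁.left.card < s.left.card ∨
      ∀ d ∈ s₁.coloursLeft, d < i → s.arr .avail v d = 1 ∧ s.copies d < s.left.card))
    rfl rfl (by decide) (by simp) ?_ ?_ ?_
  · have eL : ((s.setVar .changed (Expr.eval s (.lit 0))).setVar .d 0).left = s.left :=
      left_congr (by simp) (by simp)
    have eD : ((s.setVar .changed (Expr.eval s (.lit 0))).setVar .d 0).coloursLeft =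
      s.coloursLeft := coloursLeft_congr (by simp) (by simp)
    rw [eL, eD]
    exact ⟨by omega, by simp [hY], ⟨subset_rfl, subset_rfl, Iff.rfl⟩, Or.inl ⟨by simp, rfl, rfl⟩,
      Or.inr (by simp)⟩
  · rintro i t s' hi hF hxi ⟨ht, hY', hI, hch, hst⟩
    have en : s'.var .n = s.var .n := by simpa using hF.1 .n rfl
    have em : s'.var .m = s.var .m := by simpa using hF.1 .m rfl
    have ev : s'.var .v = v := by rw [← hv]; simpa using hF.1 .v rfl
    have eC : s'.copies = s.copies := copies_congr (by simpa using hF.1 .v rfl)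
      (by simpa using hF.1 .c rfl) (by simpa using hF.1 .sizeS rfl) (hF.2 .bonus rfl)
    have aX : s'.arr .X = s.arr .X := hF.2 .X rfl
    have aA : s'.arr .avail = s.arr .avail := hF.2 .avail rfl
    refine (pruneColour_spec s' i v hxi ev (by rw [em]; exact hi) hY').mono
      fun t₁ s₁ hF₁ ⟨hY₁, hcase⟩ => ?_
    rw [eC, aX, aA, en] at hcase
    have eL₁ : (s₁.setVar .d (i + 1 : ℕ)).left = s₁.left := left_congr (by simp) (by simp)
    have eD₁ : (s₁.setVar .d (i + 1 : ℕ)).coloursLeft = s₁.coloursLeft :=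
      coloursLeft_congr (by simp) (by simp)
    rw [eL₁, eD₁]
    simp only [setVar_var, reduceCtorEq, if_false]
    rcases hcase with ⟨hiD, hfit, hD₁, hL₁, hc₁, ht₁⟩ | ⟨hno, rfl, ht₁⟩
    · have hcard : s₁.coloursLeft.card + 1 = s'.coloursLeft.card := by
        rw [hD₁, Finset.card_erase_add_one hiD]
      have hle : s'.coloursLeft.card ≤ s.coloursLeft.card := Finset.card_le_card hI.colours_sub
      refine ⟨?_, hY₁, ?_, Or.inr ⟨hc₁, by omega, ?_⟩, ?_⟩
      · rw [← hcard, Nat.mul_succ] at ht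
        omega
      · rw [hD₁, hL₁]
        exact hI.erase hiD hfit
      · rcases hch with ⟨_, hD', hL'⟩ | ⟨_, _, h⟩
        · refine ⟨i, hD' ▸ hiD, fun ⟨hA, hlt⟩ => ?_⟩
          have := hfit hA
          rw [hL'] at this
          omega
        · exact h
      · have hsub : s₁.left ⊆ s'.left := by
          rw [hL₁]
          exact Finset.filter_subset _ _
        have hc := Finset.card_le_card hsub
        refine hst.imp (fun h => by omega) fun h d hd hdi => ?_
        rw [hD₁, Finset.mem_erase] at hd
        exact h d hd.2 (by omega)
    · refine ⟨by omega, hY₁, hI, hch, ?_⟩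
      refine (or_iff_not_imp_left.2 fun hlt => ?_)
      have hle := Finset.card_le_card hI.left_sub
      have heq : s₁.left.card = s.left.card := by omega
      intro d hd hdi
      rcases Nat.lt_succ_iff_lt_or_eq.1 hdi with hdi | rfl
      · exact hst.resolve_left hlt d hd hdi
      · rw [← heq]
        exact hno hd
  · rintro t s' hF ⟨ht, hY', hI, hch, hst⟩
    refine ⟨by simp; omega, hY', hI, hch, hst.imp_right fun h d hd => ?_⟩
    have em : s'.var .m = s.var .m := by simpa using hF.1 .m rfl
    exact h d hd (em ▸ (mem_coloursLeft.1 hd).1)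

theorem pruneColours_spec (s : Store) (v : ℕ) (hv : s.var .v = v)
    (hY : s.var .sizeY = s.left.card) :
    WP pruneColours s fun t s₁ =>
      t ≤ 500 * (((s.var .n).toNat + 1) * ((s.var .m).toNat + 1)) ∧
      PruneInv s v s.left s.coloursLeft s₁.left s₁.coloursLeft ∧
      ∀ d ∈ s₁.coloursLeft, s.arr .avail v d = 1 := by
  rw [pruneColours_eq, WP_seq, WP_assign]
  set N := (s.var .n).toNat with hN
  set M := (s.var .m).toNat with hM
  -- The cost of a round apart from removals, including the test of the loop.
  set B := 60 * (M + 1) + 5 with hB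
  -- A round that shrinks `Y'` is paid by a lost member. One that removes colours but no member
  -- leaves nothing removable, so the next one is the last: at most `2 * B` remains unpaid. Counting
  -- rounds by members of `Y'` avoids a term quadratic in `M`.
  refine WP_while (fun t k s₁ =>
    s₁.var .sizeY = s₁.left.card ∧ PruneInv s v s.left s.coloursLeft s₁.left s₁.coloursLeft ∧
    ((s₁.var .changed = 1 ∧ k = s₁.coloursLeft.card + 1 ∧
        (t + B * s₁.left.card + 40 * (N + 1) * s₁.coloursLeft.card ≤
            B * s.left.card + 40 * (N + 1) * s.coloursLeft.card ∨
          (∀ d ∈ s₁.coloursLeft, s.arr .avail v d = 1 ∧ s.copies d < s₁.left.card) ∧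
          t + B * s₁.left.card + 40 * (N + 1) * s₁.coloursLeft.card ≤
            B * s.left.card + 40 * (N + 1) * s.coloursLeft.card + B)) ∨
      (s₁.var .changed = 0 ∧ k = 0 ∧ (∀ d ∈ s₁.coloursLeft, s.arr .avail v d = 1) ∧
        t + B * s₁.left.card + 40 * (N + 1) * s₁.coloursLeft.card ≤
          B * s.left.card + 40 * (N + 1) * s.coloursLeft.card + 2 * B)))
    (k₀ := s.coloursLeft.card + 1) ?_ ?_ ?_
  · have eL : (s.setVar .changed (Expr.eval s (.lit 1))).left = s.left :=
      left_congr (by simp) (by simp)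
    have eD : (s.setVar .changed (Expr.eval s (.lit 1))).coloursLeft =
      s.coloursLeft := coloursLeft_congr (by simp) (by simp)
    rw [eL, eD]
    exact ⟨by simp [hY], ⟨subset_rfl, subset_rfl, Iff.rfl⟩,
      Or.inl ⟨by simp, rfl, Or.inl (by omega)⟩⟩
  · rintro t k s₁ hF ⟨hY₁, hI, hcase⟩ hH
    have en : s₁.var .n = s.var .n := by simpa using hF.1 .n rfl
    have em : s₁.var .m = s.var .m := by simpa using hF.1 .m rfl
    have ev : s₁.var .v = v := by rw [← hv]; simpa using hF.1 .v rfl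
    have eC : s₁.copies = s.copies := copies_congr (by simpa using hF.1 .v rfl)
      (by simpa using hF.1 .c rfl) (by simpa using hF.1 .sizeS rfl) (hF.2 .bonus rfl)
    have aX : s₁.arr .X = s.arr .X := hF.2 .X rfl
    have aA : s₁.arr .avail = s.arr .avail := hF.2 .avail rfl
    have hch : s₁.var .changed = 1 := by simpa using hH
    obtain ⟨_, rfl, hpot⟩ := hcase.resolve_right fun h => by omega
    refine (pruneRound_spec s₁ v ev hY₁).mono fun t₂ s₂ _ ⟨ht₂, hY₂, hI₂, hch₂, hst₂⟩ => ?_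
    rw [eC, aA] at hch₂ hst₂
    rw [en, em, ← hN, ← hM] at ht₂
    have hI' : PruneInv s v s.left s.coloursLeft s₂.left s₂.coloursLeft := by
      refine ⟨hI₂.left_sub.trans hI.left_sub, hI₂.colours_sub.trans hI.colours_sub, ?_⟩
      have h := hI₂.assignable
      have hfits : s₁.fits v = s.fits v := by
        unfold Store.fits
        rw [eC, aA]
      rw [aX, hfits] at h
      exact h.trans hI.assignable
    have hle := Finset.card_le_card hI₂.left_sub
    have hmul : B * s₂.left.card ≤ B * s₁.left.card := Nat.mul_le_mul_left _ hle
    simp only [Test.cost, Expr.cost]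
    have hpot' : t + B * s₁.left.card + 40 * (N + 1) * s₁.coloursLeft.card ≤
        B * s.left.card + 40 * (N + 1) * s.coloursLeft.card + B := by
      rcases hpot with h | h <;> omega
    rcases hch₂ with ⟨hc, hD, hL⟩ | ⟨hc, hlt, d, hd, hbad⟩
    · refine ⟨0, by omega, hY₂, hI', Or.inr ⟨hc, rfl, fun d hd => ?_, by omega⟩⟩
      exact ((hst₂.resolve_left (by rw [hL]; exact lt_irrefl _)) d hd).1
    · refine ⟨s₂.coloursLeft.card + 1, by omega, hY₂, hI', Or.inl ⟨hc, rfl, ?_⟩⟩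
      have hpot₁ := hpot.resolve_right fun h => hbad (h.1 d hd)
      rcases Nat.lt_or_ge s₂.left.card s₁.left.card with hlt | hge
      · left
        have : B * (s₂.left.card + 1) ≤ B * s₁.left.card := Nat.mul_le_mul_left _ hlt
        rw [Nat.mul_succ] at this
        omega
      · right
        have heq : s₂.left.card = s₁.left.card := by omega
        refine ⟨?_, by omega⟩
        rw [heq]
        exact hst₂.resolve_left (by omega)
  · rintro t k s₁ hF ⟨hY₁, hI, hcase⟩ hH
    obtain ⟨_, rfl, hav, ht⟩ := hcase.resolve_left fun h => hH (by simp [h.1])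
    refine ⟨?_, hI, hav⟩
    have h₁ : s.left.card ≤ N := (Finset.card_filter_le _ _).trans (by simp [hN])
    have h₂ : s.coloursLeft.card ≤ M := (Finset.card_filter_le _ _).trans (by simp [hM])
    have h₃ : B * s.left.card ≤ B * N := Nat.mul_le_mul_left _ h₁
    have h₄ : 40 * (N + 1) * s.coloursLeft.card ≤ 40 * (N + 1) * M := Nat.mul_le_mul_left _ h₂
    have h₅ : B * N + 40 * (N + 1) * M + 2 * B + 10 ≤ 500 * ((N + 1) * (M + 1)) := by
      rw [hB]
      ring_nf
      omega
    simp
    omega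

theorem Store.Preserved.trans {s s₁ s₂ : Store} {out : Var → Prop} {outArr : Arr → Prop}
    (h : s.Preserved s₁ out outArr) (h' : s₁.Preserved s₂ out outArr) :
    s.Preserved s₂ out outArr :=
  ⟨fun x h₁ h₂ => (h'.1 x h₁ h₂).trans (h.1 x h₁ h₂),
    fun a h₁ h₂ => (h'.2 a h₁ h₂).trans (h.2 a h₁ h₂)⟩

theorem Store.Preserved.mono {s s₁ : Store} {out out' : Var → Prop} {outArr outArr' : Arr → Prop}
    (h : s.Preserved s₁ out outArr) (hv : ∀ x, out x → out' x) (ha : ∀ a, outArr a → outArr' a) :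
    s.Preserved s₁ out' outArr' :=
  ⟨fun x h₁ h₂ => h.1 x h₁ (mt (hv x) h₂), fun a h₁ h₂ => h.2 a h₁ (mt (ha a) h₂)⟩

theorem Frame.preserved {P : Prog} {s s₁ : Store} {out : Var → Prop} {outArr : Arr → Prop}
    (h : Frame P s s₁) (hv : ∀ x, (∀ k, x ≠ .tmp k) → ¬ out x → P.writesVar x = false)
    (ha : ∀ a, (∀ k, a ≠ .tmp k) → ¬ outArr a → P.writesArr a = false) :
    s.Preserved s₁ out outArr :=
  ⟨fun x h₁ h₂ => h.1 x (hv x h₁ h₂), fun a h₁ h₂ => h.2 a (ha a h₁ h₂)⟩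

/-! ### Deciding a single colour -/

/-- The specification of a matching test, with a bound on its running time if `b` holds. -/
def MatchingSpec (b : Prop) (P : Prog) : Prop :=
  ∀ s : Store, WP P s fun t s₁ =>
    (b → t ≤ 20 * ((s.var .n).toNat + 1) +
      s.left.card * augmentBound (s.var .n).toNat (s.var .m).toNat) ∧
    (s₁.var .found = 1 ↔ maxMatching s.bipartite = s.left.card) ∧
    s.Preserved s₁ (fun x => x = .found) fun _ => False

/-- The variables that `tryColour` writes. -/
def tryVars (x : Var) : Prop :=
  x = .k ∨ x = .d ∨ x = .sizeS ∨ x = .sizeY ∨ x = .skip ∨ x = .changed ∨ x = .found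

/-- The arrays that `tryColour` writes. -/
def tryArrs (a : Arr) : Prop :=
  a = .Yp ∨ a = .Cp ∨ a = .X

/-- The predecessors in `Y` can choose colours that make `c` a best response of `v`. -/
def Store.Supports (s : Store) (v c : ℕ) : Prop :=
  Assignable (s.predsY.filter fun k : ℕ => ¬ s.arr .X k c = 1) (fun k d => s.arr .X k d = 1)
    ((Finset.range (s.var .m).toNat).erase c) fun d x => s.arr .avail v d = 1 →
      (x : ℤ) ≤ ((s.predsY.filter fun k : ℕ => s.arr .X k c = 1).card : ℤ) +
        s.arr .bonus v c - s.arr .bonus v d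

/-- Pruning leaves `Assignable` unchanged, and for the colours that survive, the numbers of copies
are exact bounds, so the matching test answers the question for `c`. -/
theorem tryColour_spec {b : Prop} {matching : Prog} (hM : MatchingSpec b matching) (s : Store)
    (v c : ℕ) (hv : s.var .v = v) (hc : s.var .c = c) :
    WP (tryColour matching) s fun t s₁ =>
      (b → t ≤ 800 * (((s.var .n).toNat + 1) * ((s.var .m).toNat + 1)) +
        s.predsY.card * augmentBound (s.var .n).toNat (s.var .m).toNat) ∧
      s.Preserved s₁ tryVars tryArrs ∧
      ((s.Supports v c ∧ ∀ k d, s₁.arr .X k d = if k = v ∧ d = c then 1 else s.arr .X k d) ∨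
        (¬ s.Supports v c ∧ s₁.arr .X = s.arr .X)) := by
  refine WP.intro fun Q hQ => ?_
  unfold tryColour
  simp only [WP_seq]
  refine (splitY_spec s c hc).mono fun t₁ s₁ hF₁ ⟨ht₁, hL₁, hS₁, hY₁⟩ => ?_
  have hc₁ : s₁.var .c = c := by rw [← hc]; exact hF₁.1 .c rfl
  have hm₁ : s₁.var .m = s.var .m := hF₁.1 .m rfl
  have hn₁ : s₁.var .n = s.var .n := hF₁.1 .n rfl
  refine (initColours_spec s₁ c hc₁).mono fun t₂ s₂ hF₂ ⟨ht₂, hD₂⟩ => ?_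
  have hv₂ : s₂.var .v = v := by rw [← hv, hF₂.1 .v rfl, hF₁.1 .v rfl]
  have hm₂ : s₂.var .m = s.var .m := by rw [hF₂.1 .m rfl, hm₁]
  have hn₂ : s₂.var .n = s.var .n := by rw [hF₂.1 .n rfl, hn₁]
  refine (checkSkip_spec s₂ v hv₂).mono fun t₃ s₃ hF₃ ⟨ht₃, hskip⟩ => ?_
  have hv₃ : s₃.var .v = v := by rw [← hv₂, hF₃.1 .v rfl]
  have hm₃ : s₃.var .m = s.var .m := by rw [hF₃.1 .m rfl, hm₂]
  have hn₃ : s₃.var .n = s.var .n := by rw [hF₃.1 .n rfl, hn₂]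
  have aX₃ : s₃.arr .X = s.arr .X := by
    rw [hF₃.2 .X rfl, hF₂.2 .X rfl, hF₁.2 .X rfl]
  have aA₃ : s₃.arr .avail = s.arr .avail := by
    rw [hF₃.2 .avail rfl, hF₂.2 .avail rfl, hF₁.2 .avail rfl]
  have aA₂ : s₂.arr .avail = s.arr .avail := by
    rw [hF₂.2 .avail rfl, hF₁.2 .avail rfl]
  have hL₃ : s₃.left = s.predsY.filter fun k : ℕ => ¬ s.arr .X k c = 1 := by
    rw [← hL₁]
    exact left_congr (by rw [hn₃, hn₁]) (by rw [hF₃.2 .Yp rfl, hF₂.2 .Yp rfl])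
  have hY₃ : s₃.var .sizeY = s₃.left.card := by
    rw [hF₃.1 .sizeY rfl, hF₂.1 .sizeY rfl, hY₁, hL₁, hL₃]
  have hD₃ : s₃.coloursLeft = (Finset.range (s.var .m).toNat).erase c := by
    rw [← hm₁, ← hD₂]
    exact coloursLeft_congr (hF₃.1 .m rfl) (hF₃.2 .Cp rfl)
  have hcop₃ : s₃.copies = s₂.copies := copies_congr (hF₃.1 .v rfl) (hF₃.1 .c rfl)
    (hF₃.1 .sizeS rfl) (hF₃.2 .bonus rfl)
  have hcop : ∀ d : ℕ, s₃.copies d = ((s.predsY.filter fun k : ℕ => s.arr .X k c = 1).card : ℤ) +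
      s.arr .bonus v c - s.arr .bonus v d := by
    intro d
    have : s₃.arr .bonus = s.arr .bonus := by
      rw [hF₃.2 .bonus rfl, hF₂.2 .bonus rfl, hF₁.2 .bonus rfl]
    rw [Store.copies, this, hv₃, hF₃.1 .sizeS rfl, hF₂.1 .sizeS rfl, hS₁, hF₃.1 .c rfl,
      hF₂.1 .c rfl, hc₁]
  have hsup : s.Supports v c ↔ Assignable s₃.left (fun k d => s₃.arr .X k d = 1) s₃.coloursLeft
      (s₃.fits v) := by
    unfold Store.Supports Store.fits
    simp only [hL₃, aX₃, hD₃, hcop, aA₃]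
  have hP₃ : s.Preserved s₃ tryVars tryArrs := by
    refine (hF₁.preserved ?_ ?_).trans ((hF₂.preserved ?_ ?_).trans (hF₃.preserved ?_ ?_)) <;>
      intro x <;> cases x <;> simp [tryVars, tryArrs] <;> rfl
  have hle : s₃.left.card ≤ s.predsY.card := by
    rw [hL₃]
    exact Finset.card_filter_le _ _
  rw [hm₁] at ht₂ hD₂
  rw [hm₂] at ht₃
  set N := (s.var .n).toNat with hN
  set M := (s.var .m).toNat with hMd
  have hNM : N + M + 1 ≤ (N + 1) * (M + 1) := by
    ring_nf
    omega
  rw [WP_when]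
  simp only [Test.Holds, Expr.eval]
  constructor
  · intro hs0
    have hcap := hskip.1 hs0
    simp only [WP_seq]
    refine (pruneColours_spec s₃ v hv₃ hY₃).mono fun t₄ s₄ hF₄ ⟨ht₄, hI₄, hav₄⟩ => ?_
    have hm₄ : s₄.var .m = s.var .m := by rw [hF₄.1 .m rfl, hm₃]
    have hn₄ : s₄.var .n = s.var .n := by rw [hF₄.1 .n rfl, hn₃]
    have aX₄ : s₄.arr .X = s.arr .X := by rw [hF₄.2 .X rfl, aX₃]
    have hcop₄ : s₄.copies = s₃.copies := copies_congr (hF₄.1 .v rfl) (hF₄.1 .c rfl)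
      (hF₄.1 .sizeS rfl) (hF₄.2 .bonus rfl)
    have hP₄ : s.Preserved s₄ tryVars tryArrs := by
      refine hP₃.trans (hF₄.preserved ?_ ?_) <;>
        intro x <;> cases x <;> simp [tryVars, tryArrs] <;> rfl
    refine (hM s₄).mono fun t₅ s₅ _ ⟨ht₅, hf₅, hP⟩ => ?_
    have hP₅ : s.Preserved s₅ tryVars tryArrs :=
      hP₄.trans (hP.mono (by simp +contextual [tryVars]) (by simp))
    have aX₅ : s₅.arr .X = s.arr .X := by rw [hP.2 .X (by simp) (by simp), aX₄]
    have hv₅ : s₅.var .v = v := by rw [hP.1 .v (by simp) (by simp), hF₄.1 .v rfl, hv₃]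
    have hc₅ : s₅.var .c = c := by
      rw [hP.1 .c (by simp) (by simp), hF₄.1 .c rfl, hF₃.1 .c rfl, hF₂.1 .c rfl, hc₁]
    have hfound : s₅.var .found = 1 ↔ s.Supports v c := by
      rw [hf₅, maxMatching_bipartite_eq_iff, hsup, ← hI₄.assignable, hcop₄, aX₄, aX₃]
      -- Surviving colours are available, and test (b) made their copies nonnegative, so `toNat`
      -- loses nothing.
      have hfit : ∀ d ∈ s₄.coloursLeft, ∀ x, x ≤ (s₃.copies d).toNat ↔ s₃.fits v d x := by
        intro d hd x
        have h₁ := hav₄ d hd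
        have h₂ := hcap d (by
          have := hI₄.colours_sub hd
          rwa [hD₃, ← hD₂] at this) (by rw [aA₂, ← aA₃]; exact h₁)
        rw [← hcop₃] at h₂
        simp only [Store.fits, h₁, forall_true_left]
        omega
      exact ⟨Assignable.congr (fun _ _ _ _ => id) fun d hd x => (hfit d hd x).1,
        Assignable.congr (fun _ _ _ _ => id) fun d hd x => (hfit d hd x).2⟩
    rw [hn₃, hm₃, ← hN, ← hMd] at ht₄
    rw [hn₄, hm₄, ← hN, ← hMd] at ht₅
    have hle₄ : s₄.left.card * augmentBound N M ≤ s.predsY.card * augmentBound N M :=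
      Nat.mul_le_mul_right _ ((Finset.card_le_card hI₄.left_sub).trans hle)
    rw [WP_when, WP_store]
    simp only [Test.Holds, Expr.eval, Expr.cost, Test.cost, hv₅, hc₅]
    constructor
    · intro hf
      refine hQ _ _ ⟨fun hb => ?_, ?_, Or.inl ⟨hfound.1 hf, fun k d => ?_⟩⟩
      · have := ht₅ hb
        omega
      · refine hP₅.trans ⟨fun _ _ _ => rfl, fun a _ ha => setArr_arr_of_ne _ ?_ _ _ _⟩
        rintro rfl
        exact ha (by simp [tryArrs])
      · simp [setArr_arr, aX₅]
    · intro hf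
      refine hQ _ _ ⟨fun hb => ?_, hP₅, Or.inr ⟨mt hfound.2 hf, aX₅⟩⟩
      have := ht₅ hb
      omega
  · intro hs0
    refine hQ _ _ ⟨fun _ => by simp; omega, hP₃, Or.inr ⟨fun hS => ?_, aX₃⟩⟩
    -- Even a load of zero needs a nonnegative capacity, so skipping `c` is justified.
    obtain ⟨f, _, hf⟩ := hsup.1 hS
    refine hs0 (hskip.2 fun d hd hA => ?_)
    have := hf d (by rw [hD₃, ← hD₂]; exact hd) (by rw [aA₃, ← aA₂]; exact hA)
    rw [← hcop₃]
    omega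

/-- Some choice of colours `f k` with `A k (f k)` for all `k ∈ P` makes `c` a colour with the
highest payoff. -/
def BestFor (P : Finset ℕ) (A : ℕ → ℕ → Prop) (m : ℕ) (avail : ℕ → Prop) (β : ℕ → ℤ) (c : ℕ) :
    Prop :=
  ∃ f : ℕ → ℕ, (∀ k ∈ P, f k < m ∧ A k (f k)) ∧ ∀ d < m, avail d →
    ((P.filter fun k => f k = d).card : ℤ) + β d ≤ ((P.filter fun k => f k = c).card : ℤ) + β c

theorem BestFor.congr {P : Finset ℕ} {A A' : ℕ → ℕ → Prop} {m : ℕ} {avail : ℕ → Prop}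
    {β : ℕ → ℤ} {c : ℕ} (hA : ∀ k ∈ P, ∀ d, A k d → A' k d) (h : BestFor P A m avail β c) :
    BestFor P A' m avail β c := by
  obtain ⟨f, h₁, h₂⟩ := h
  exact ⟨f, fun k hk => ⟨(h₁ k hk).1, hA k hk _ (h₁ k hk).2⟩, h₂⟩

/-- The columns of `X` from `m` on hold arbitrary values, so the relation must be cut down to `d <
m` before `exists_best_iff_assignable` applies. -/
theorem Store.supports_iff (s : Store) (v c : ℕ) (hc : c < (s.var .m).toNat) :
    s.Supports v c ↔ BestFor s.predsY (fun k d => s.arr .X k d = 1) (s.var .m).toNat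
      (fun d => s.arr .avail v d = 1) (fun d => s.arr .bonus v d) c := by
  have h := exists_best_iff_assignable s.predsY
    (fun k d => d < (s.var .m).toNat ∧ s.arr .X k d = 1) (s.var .m).toNat c
    (fun d => s.arr .avail v d = 1) (fun d => s.arr .bonus v d) (fun _ _ _ h => h.1)
  unfold BestFor
  rw [h]
  have e₁ : (s.predsY.filter fun k : ℕ => ¬ s.arr .X k c = 1) =
      s.predsY.filter fun k : ℕ => ¬ (c < (s.var .m).toNat ∧ s.arr .X k c = 1) := by
    simp [hc]
  have e₂ : (s.predsY.filter fun k : ℕ => s.arr .X k c = 1) =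
      s.predsY.filter fun k : ℕ => c < (s.var .m).toNat ∧ s.arr .X k c = 1 := by
    simp [hc]
  unfold Store.Supports
  rw [e₁, e₂]
  constructor <;> intro h'
  · convert h'.congr (A' := fun k d => d < (s.var .m).toNat ∧ s.arr .X k d = 1) ?_
      (fun _ _ _ => id)
    intro k _ d hd hX
    exact ⟨Finset.mem_range.1 (Finset.mem_of_mem_erase hd), hX⟩
  · refine Assignable.congr (A := fun k d => d < (s.var .m).toNat ∧ s.arr .X k d = 1)
      (fun k _ d _ h => h.2) (fun _ _ _ => id) ?_
    convert h'

/-! ### Computing the set of colours of one node -/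

/-- The predecessors of `v`. -/
def predsNat {n : ℕ} (E : Finset (Fin n × Fin n)) (v : Fin n) : Finset ℕ :=
  (Finset.univ.filter fun k => (k, v) ∈ E).map Fin.valEmbedding

theorem mem_predsNat {n : ℕ} {E : Finset (Fin n × Fin n)} {v : Fin n} {k : ℕ} :
    k ∈ predsNat E v ↔ ∃ x : Fin n, (x, v) ∈ E ∧ (x : ℕ) = k := by
  simp [predsNat]

/-- The part of `computeX` before the loop over the colours. -/
def initX : Prog :=
  .for .c .m (.store .X (.var .v) (.var .c) (.lit 0)) ;;
  .for .k .n (.store1 .Y (.var .k) (.lit 0)) ;;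
  .for .k .e
    (.when (.eq (.get1 .dst (.var .k)) (.var .v))
      (.store1 .Y (.get1 .src (.var .k)) (.lit 1)))

theorem initX_spec {n : ℕ} (E : Finset (Fin n × Fin n)) (s : Store) (h : s.HasGraph E)
    (v : Fin n) (hv : s.var .v = (v : ℕ)) :
    WP initX s fun t s₁ => t ≤ 30 * (n + (s.var .m).toNat + E.card + 1) ∧
      s₁.predsY = predsNat E v ∧ (∀ k d, k ≠ ((v : ℕ) : ℤ) → s₁.arr .X k d = s.arr .X k d) ∧
      ∀ d : ℕ, d < (s.var .m).toNat → s₁.arr .X (v : ℕ) d = 0 := by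
  obtain ⟨hn, he, l, hnd, hl, hE⟩ := h
  have hlen : l.length = E.card := by rw [← hl, List.toFinset_card_of_nodup hnd]
  unfold initX
  rw [WP_seq]
  refine WP_for (N := (s.var .m).toNat) (fun i t s' => t ≤ 20 * i ∧
    (∀ k d, k ≠ ((v : ℕ) : ℤ) → s'.arr .X k d = s.arr .X k d) ∧
    ∀ d : ℕ, d < i → s'.arr .X (v : ℕ) d = 0) rfl rfl (by decide) rfl (by simp) ?_ ?_
  · rintro i t s' hi hF hxi ⟨ht, h1, h2⟩
    have ev : s'.var .v = (v : ℕ) := by rw [← hv]; exact hF.1 .v rfl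
    refine WP.intro fun Q hQ => ?_
    simp only [WP_store, Expr.eval, ev, hxi]
    refine hQ _ _ ⟨by simp; omega, fun k d hk => ?_, fun d hd => ?_⟩
    · simp [setArr_arr, hk, h1]
    · simp only [setVar_arr, setArr_arr, Nat.cast_inj, true_and]
      split_ifs with hdi
      · rfl
      · exact h2 d (by omega)
  rintro t s' hF ⟨ht, h1, h2⟩
  have hn' : s'.var .n = n := by rw [← hn]; exact hF.1 .n rfl
  rw [WP_seq]
  refine WP_for (N := n) (fun i t s' => t ≤ 20 * i ∧ ∀ k : ℕ, k < i → s'.arr .Y k 0 = 0)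
    rfl rfl (by decide) (by simp [hn']) (by simp) ?_ ?_
  · rintro i t₁ s₁ hi hF₁ hxi ⟨ht₁, h3⟩
    refine WP.intro fun Q hQ => ?_
    simp only [WP_store1, Expr.eval, hxi]
    refine hQ _ _ ⟨by simp; omega, fun k hk => ?_⟩
    simp only [setVar_arr, setArr_arr, Nat.cast_inj, true_and, and_true]
    split_ifs with hki
    · rfl
    · exact h3 k (by omega)
  rintro t₁ s₁ hF₁ ⟨ht₁, h3⟩
  have he' : s₁.var .e = E.card := by rw [← he, hF₁.1 .e rfl, hF.1 .e rfl]
  refine WP_for (N := E.card) (fun i t s' => t ≤ 25 * i ∧ ∀ k : Fin n,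
    s'.arr .Y (k : ℕ) 0 = 1 ↔ ∃ x, ∃ hx : x < l.length, x < i ∧ l[x] = (k, v)) rfl rfl
    (by decide) (by simp [he']) ?_ ?_ ?_
  · refine ⟨by simp, fun k => ?_⟩
    simp [h3 k k.2]
  · rintro i t₂ s₂ hi hF₂ hxi ⟨ht₂, h4⟩
    have ev : s₂.var .v = (v : ℕ) := by rw [← hv, hF₂.1 .v rfl, hF₁.1 .v rfl, hF.1 .v rfl]
    have as : s₂.arr .src = s.arr .src := by
      rw [hF₂.2 .src rfl, hF₁.2 .src rfl, hF.2 .src rfl]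
    have ad : s₂.arr .dst = s.arr .dst := by
      rw [hF₂.2 .dst rfl, hF₁.2 .dst rfl, hF.2 .dst rfl]
    have hil : i < l.length := by omega
    obtain ⟨hs, hd⟩ := hE i hil
    have hstep : ∀ k : Fin n, (∃ x, ∃ hx : x < l.length, x < i + 1 ∧ l[x] = (k, v)) ↔
        (∃ x, ∃ hx : x < l.length, x < i ∧ l[x] = (k, v)) ∨ l[i] = (k, v) := by
      intro k
      constructor
      · rintro ⟨x, hx, hxi, hk⟩
        rcases Nat.lt_succ_iff_lt_or_eq.1 hxi with hxi | rfl
        · exact Or.inl ⟨x, hx, hxi, hk⟩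
        · exact Or.inr hk
      · rintro (⟨x, hx, hxi, hk⟩ | hk)
        · exact ⟨x, hx, by omega, hk⟩
        · exact ⟨i, hil, by omega, hk⟩
    refine WP.intro fun Q hQ => ?_
    simp only [WP_when, WP_store1, Test.Holds, Expr.get1, Expr.eval, hxi, ev, as, ad, hs, hd,
      Nat.cast_inj]
    constructor
    · intro hv'
      have hv'' : l[i].2 = v := Fin.ext hv'
      refine hQ _ _ ⟨by simp; omega, fun k => ?_⟩
      rw [hstep]
      simp only [setVar_arr, setArr_arr, Nat.cast_inj, true_and, and_true, ← h4]
      by_cases hk : (k : ℕ) = l[i].1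
      · have : l[i].1 = k := (Fin.ext hk).symm
        simp [hk, Prod.ext_iff, this, hv'']
      · have : l[i].1 ≠ k := fun h => hk (by rw [h])
        simp [hk, Prod.ext_iff, this]
    · intro hv'
      have hv'' : l[i].2 ≠ v := fun h => hv' (by rw [h])
      refine hQ _ _ ⟨by simp; omega, fun k => ?_⟩
      rw [hstep]
      simp [h4, Prod.ext_iff, hv'']
  · rintro t₂ s₂ hF₂ ⟨ht₂, h4⟩
    have aX : s₂.arr .X = s'.arr .X := by rw [hF₂.2 .X rfl, hF₁.2 .X rfl]
    have hn₂ : s₂.var .n = n := by rw [hF₂.1 .n rfl, hF₁.1 .n rfl, hn']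
    refine ⟨by omega, ?_, by rw [aX]; exact h1, by rw [aX]; exact h2⟩
    ext k
    rw [mem_predsY, mem_predsNat, hn₂, Int.toNat_natCast]
    constructor
    · rintro ⟨hk, hY⟩
      obtain ⟨x, hx, _, hlx⟩ := (h4 ⟨k, hk⟩).1 hY
      refine ⟨⟨k, hk⟩, ?_, rfl⟩
      rw [← hl, List.mem_toFinset, ← hlx]
      exact List.getElem_mem hx
    · rintro ⟨k, hk, rfl⟩
      refine ⟨k.2, (h4 k).2 ?_⟩
      rw [← hl, List.mem_toFinset] at hk
      obtain ⟨x, hx, hlx⟩ := List.mem_iff_getElem.1 hk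
      exact ⟨x, hx, by omega, hlx⟩

/-- The variables that `computeX` writes. -/
def computeVars (x : Var) : Prop := x = .c ∨ tryVars x

/-- The arrays that `computeX` writes. -/
def computeArrs (a : Arr) : Prop := a = .Y ∨ tryArrs a

theorem computeX_spec {b : Prop} {matching : Prog} (hM : MatchingSpec b matching) {n : ℕ}
    (E : Finset (Fin n × Fin n)) (s : Store) (h : s.HasGraph E) (v : Fin n)
    (hv : s.var .v = (v : ℕ)) (hloop : (v, v) ∉ E) :
    WP (computeX matching) s fun t s₁ =>
      (b → t ≤ 900 * (((n + 1) * ((s.var .m).toNat + 1)) * ((s.var .m).toNat + 1)) +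
        30 * (E.card + 1) +
        (predsNat E v).card * ((s.var .m).toNat * augmentBound n (s.var .m).toNat)) ∧
      s.Preserved s₁ computeVars computeArrs ∧
      (∀ k d, k ≠ ((v : ℕ) : ℤ) → s₁.arr .X k d = s.arr .X k d) ∧
      ∀ c < (s.var .m).toNat, s₁.arr .X (v : ℕ) c = 1 ↔ s.arr .avail (v : ℕ) c = 1 ∧
        BestFor (predsNat E v) (fun k d => s.arr .X k d = 1) (s.var .m).toNat
          (fun d => s.arr .avail (v : ℕ) d = 1) (fun d => s.arr .bonus (v : ℕ) d) c := by
  have hassoc : ∀ Q, WP (computeX matching) s Q ↔ WP (initX ;; .for .c .m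
      (.when (.eq (.get .avail (.var .v) (.var .c)) (.lit 1)) (tryColour matching))) s Q := by
    intro Q
    unfold computeX initX
    simp only [WP_seq, add_assoc]
  rw [hassoc, WP_seq]
  refine (initX_spec E s h v hv).mono fun t₀ s₀ hF₀ ⟨ht₀, hP₀, hX₀, hv₀⟩ => ?_
  have hn₀ : s₀.var .n = n := by rw [hF₀.1 .n rfl, h.1]
  have hm₀ : s₀.var .m = s.var .m := hF₀.1 .m rfl
  have hvv₀ : s₀.var .v = (v : ℕ) := by rw [hF₀.1 .v rfl, hv]
  have hpre : s.Preserved s₀ computeVars computeArrs := by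
    refine hF₀.preserved ?_ ?_ <;>
      intro x <;> cases x <;> simp [computeVars, computeArrs, tryVars, tryArrs] <;> rfl
  set M := (s.var .m).toNat with hMd
  set K := 800 * ((n + 1) * (M + 1)) + (predsNat E v).card * augmentBound n M + 20 with hK
  -- The body contains an unknown `matching`, for which `writesVar` does not compute, so
  -- preservation of the loop variable and the bound has to be proved by hand.
  refine WP_for_of_preserved (N := M) (fun i t s' => (b → t ≤ K * i) ∧
    s₀.Preserved s' computeVars tryArrs ∧
    (∀ k d, k ≠ ((v : ℕ) : ℤ) → s'.arr .X k d = s.arr .X k d) ∧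
    (∀ d : ℕ, i ≤ d → d < M → s'.arr .X (v : ℕ) d = 0) ∧
    ∀ c < i, s'.arr .X (v : ℕ) c = 1 ↔ s.arr .avail (v : ℕ) c = 1 ∧
      BestFor (predsNat E v) (fun k d => s.arr .X k d = 1) M
        (fun d => s.arr .avail (v : ℕ) d = 1) (fun d => s.arr .bonus (v : ℕ) d) c)
    (by decide) (by rw [hm₀]) ?_ ?_ ?_
  · refine ⟨by simp, ⟨fun x _ hx => ?_, fun _ _ _ => rfl⟩, hX₀, fun d _ hd => hv₀ d hd, by simp⟩
    have : x ≠ .c := by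
      rintro rfl
      exact hx (Or.inl rfl)
    simp [this]
  · rintro i t s' hi - hci ⟨ht, hP, hX, hz, hdone⟩
    have ev : s'.var .v = (v : ℕ) := by
      rw [hP.1 .v (by simp) (by simp [computeVars, tryVars]), hvv₀]
    have em : s'.var .m = s.var .m := by
      rw [hP.1 .m (by simp) (by simp [computeVars, tryVars]), hm₀]
    have en : s'.var .n = n := by
      rw [hP.1 .n (by simp) (by simp [computeVars, tryVars]), hn₀]
    have aA : s'.arr .avail = s.arr .avail := by
      rw [hP.2 .avail (by simp) (by simp [tryArrs]), hF₀.2 .avail rfl]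
    have aB : s'.arr .bonus = s.arr .bonus := by
      rw [hP.2 .bonus (by simp) (by simp [tryArrs]), hF₀.2 .bonus rfl]
    have aY : s'.arr .Y = s₀.arr .Y := hP.2 .Y (by simp) (by simp [tryArrs])
    have hPY : s'.predsY = predsNat E v := by
      rw [← hP₀]
      simp only [Store.predsY, en, hn₀, aY]
    have hsetP : ∀ (s₁ : Store) (z : ℤ), s₀.Preserved s₁ computeVars tryArrs →
        s₀.Preserved (s₁.setVar .c z) computeVars tryArrs := by
      refine fun s₁ z h => ⟨fun x h₁ h₂ => ?_, h.2⟩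
      have : x ≠ .c := by
        rintro rfl
        exact h₂ (Or.inl rfl)
      simp [this, h.1 x h₁ h₂]
    have hsup : s'.Supports v i ↔ BestFor (predsNat E v) (fun k d => s.arr .X k d = 1) M
        (fun d => s.arr .avail (v : ℕ) d = 1) (fun d => s.arr .bonus (v : ℕ) d) i := by
      rw [s'.supports_iff v i (by rw [em]; exact hi), hPY, em, aA, aB]
      -- Only row `v` of `X` is being written, and `v` is not its own predecessor.
      have hrow : ∀ k ∈ predsNat E v, ∀ d : ℕ, s'.arr .X k d = s.arr .X k d := by
        intro k hk d
        refine hX k d fun hkv => ?_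
        obtain ⟨x, hx, rfl⟩ := mem_predsNat.1 hk
        rw [Nat.cast_inj] at hkv
        exact hloop (by rwa [Fin.ext hkv] at hx)
      exact ⟨BestFor.congr fun k hk d hd => by rwa [← hrow k hk d],
        BestFor.congr fun k hk d hd => by rwa [hrow k hk d]⟩
    rw [WP_when]
    simp only [Test.Holds, Expr.eval, ev, hci, aA]
    constructor
    · intro hA
      refine (tryColour_spec hM s' v i ev hci).mono fun t₁ s₁ _ ⟨ht₁, hP₁, hcase⟩ => ?_
      rw [hPY, en, em, Int.toNat_natCast, ← hMd] at ht₁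
      refine ⟨⟨?_, ?_⟩, fun hb => ?_, hsetP s₁ _ (hP.trans (hP₁.mono (fun _ => Or.inr)
        fun _ => id)), ?_⟩
      · exact (hP₁.1 .c (by simp) (by simp [tryVars])).trans hci
      · exact hP₁.1 .m (by simp) (by simp [tryVars])
      · have h₁ := ht hb
        have h₂ := ht₁ hb
        rw [Nat.mul_succ]
        simp only [Test.cost, Expr.cost]
        omega
      · simp only [setVar_arr]
        rcases hcase with ⟨hS, hX₁⟩ | ⟨hS, hX₁⟩
        · refine ⟨fun k d hk => ?_, fun d hid hd => ?_, fun c hc => ?_⟩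
          · rw [hX₁, if_neg (fun h => hk h.1), hX k d hk]
          · rw [hX₁, if_neg (by omega), hz d (by omega) hd]
          · rw [hX₁]
            rcases Nat.lt_succ_iff_lt_or_eq.1 hc with hc | rfl
            · rw [if_neg (by omega), hdone c hc]
            · simp [hA, ← hsup, hS]
        · rw [hX₁]
          refine ⟨hX, fun d hid hd => hz d (by omega) hd, fun c hc => ?_⟩
          rcases Nat.lt_succ_iff_lt_or_eq.1 hc with hc | rfl
          · exact hdone c hc
          · rw [hz c le_rfl hi, ← hsup]
            simp [hS]
    · intro hA
      refine ⟨by simp, fun hb => ?_, hsetP _ _ hP, hX, fun d hid hd => hz d (by omega) hd,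
        fun c hc => ?_⟩
      · have h₁ := ht hb
        rw [Nat.mul_succ]
        simp only [Test.cost, Expr.cost]
        omega
      · rcases Nat.lt_succ_iff_lt_or_eq.1 hc with hc | rfl
        · exact hdone c hc
        · simp [hz c le_rfl hi, hA]
  · rintro t s' ⟨ht, hP, hX, _, hdone⟩ -
    refine ⟨fun hb => ?_, hpre.trans (hP.mono (fun _ => id) fun _ => Or.inr), hX, hdone⟩
    have h₁ := ht hb
    have h₂ : K * M = 800 * ((n + 1) * (M + 1) * M) +
        (predsNat E v).card * (M * augmentBound n M) + 20 * M := by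
      rw [hK]
      ring
    have h₃ : (n + 1) * (M + 1) * (M + 1) = (n + 1) * (M + 1) * M + (n + 1) * (M + 1) := by ring
    have h₄ : n + M + 1 ≤ (n + 1) * (M + 1) := by
      ring_nf
      omega
    rw [h₃]
    omega

/-- The condition `X(v) = {q(v)}` is an equivalence for every column; its failure covers both a
missing `q(v)` and a superfluous colour. -/
theorem checkQuery_spec (s : Store) (v : ℕ) (hv : s.var .v = v) :
    WP checkQuery s fun t s₁ => t ≤ 60 * ((s.var .m).toNat + 1) ∧
      ((0 ≤ s.arr .query v 0 ∧ ∃ c < (s.var .m).toNat,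
          ¬ ((c : ℤ) = s.arr .query v 0 ↔ s.arr .X v c = 1)) → s₁.var .ans = 0) ∧
      (¬ (0 ≤ s.arr .query v 0 ∧ ∃ c < (s.var .m).toNat,
          ¬ ((c : ℤ) = s.arr .query v 0 ↔ s.arr .X v c = 1)) → s₁.var .ans = s.var .ans) := by
  refine WP.intro fun Q hQ => ?_
  unfold checkQuery
  rw [WP_when]
  simp only [Test.Holds, Expr.get1, Expr.eval, hv, not_lt]
  constructor
  · intro hq
    refine WP_for (N := (s.var .m).toNat) (fun i t s' => t ≤ 40 * i ∧
      ((∃ c < i, ¬ ((c : ℤ) = s.arr .query v 0 ↔ s.arr .X v c = 1)) → s'.var .ans = 0) ∧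
      ((¬ ∃ c < i, ¬ ((c : ℤ) = s.arr .query v 0 ↔ s.arr .X v c = 1)) →
        s'.var .ans = s.var .ans)) rfl rfl (by decide) rfl (by simp) ?_ ?_
    · rintro i t s' hi hF hci ⟨ht, h1, h2⟩
      have ev : s'.var .v = v := by rw [← hv]; exact hF.1 .v rfl
      have aX : s'.arr .X = s.arr .X := hF.2 .X rfl
      have aq : s'.arr .query = s.arr .query := hF.2 .query rfl
      have hstep : (∃ c < i + 1, ¬ ((c : ℤ) = s.arr .query v 0 ↔ s.arr .X v c = 1)) ↔
          (∃ c < i, ¬ ((c : ℤ) = s.arr .query v 0 ↔ s.arr .X v c = 1)) ∨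
            ¬ ((i : ℤ) = s.arr .query v 0 ↔ s.arr .X v i = 1) := by
        constructor
        · rintro ⟨c, hc, h⟩
          rcases Nat.lt_succ_iff_lt_or_eq.1 hc with hc | rfl
          · exact Or.inl ⟨c, hc, h⟩
          · exact Or.inr h
        · rintro (⟨c, hc, h⟩ | h)
          · exact ⟨c, by omega, h⟩
          · exact ⟨i, by omega, h⟩
      refine WP.intro fun Q' hQ' => ?_
      simp only [WP_ite, WP_when, WP_assign, Test.Holds, Expr.eval, hci, ev, aX, aq]
      refine ⟨fun hc => ⟨fun hX => ?_, fun hX => ?_⟩, fun hc => ⟨fun hX => ?_, fun hX => ?_⟩⟩ <;>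
        refine hQ' _ _ ⟨by simp; omega, ?_⟩ <;> rw [hstep]
      · exact ⟨fun _ => by simp, fun h => absurd (Or.inr (by tauto)) h⟩
      · have hg : (i : ℤ) = s.arr .query v 0 ↔ s.arr .X v i = 1 := by tauto
        exact ⟨fun h => h1 (h.resolve_right (not_not.2 hg)), fun h => h2 fun h' => h (Or.inl h')⟩
      · exact ⟨fun _ => by simp, fun h => absurd (Or.inr (by tauto)) h⟩
      · have hg : (i : ℤ) = s.arr .query v 0 ↔ s.arr .X v i = 1 := by tauto
        exact ⟨fun h => h1 (h.resolve_right (not_not.2 hg)), fun h => h2 fun h' => h (Or.inl h')⟩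
    · rintro t s' hF ⟨ht, h1, h2⟩
      exact hQ _ _ ⟨by simp; omega, fun h => h1 h.2, fun h => h2 fun h' => h ⟨hq, h'⟩⟩
  · intro hq
    exact hQ _ _ ⟨by simp; omega, fun h => absurd h.1 hq, fun _ => rfl⟩

theorem card_predsNat_filter {n m : ℕ} (E : Finset (Fin n × Fin n)) (v : Fin n)
    (f : ℕ → ℕ) (f' : Fin n → Fin m) (h : ∀ k, (k, v) ∈ E → f (k : ℕ) = (f' k : ℕ))
    (x : Fin m) :
    ((predsNat E v).filter fun k => f k = x).card =
      (Finset.univ.filter fun k => (k, v) ∈ E ∧ f' k = x).card := by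
  rw [predsNat, Finset.filter_map, Finset.card_map, Finset.filter_filter]
  congr 1
  ext k
  simp only [Finset.mem_filter, Finset.mem_univ, true_and, Function.comp,
    Fin.valEmbedding_apply]
  exact and_congr_right fun hk => by rw [h k hk, Fin.val_inj]

/-- The transfer between natural numbers in memory and `Fin`. The default values outside the ranges
are never met at predecessors of `v`. -/
theorem bestFor_iff_supports {n m : ℕ} (G : Game n m) (W : Fin n → Set (Fin m))
    (A : ℕ → ℕ → Prop) (avail : ℕ → Prop) (β : ℕ → ℤ) (v : Fin n) (c : Fin m)
    (hA : ∀ k : Fin n, (k, v) ∈ G.E → ∀ d : Fin m, A (k : ℕ) (d : ℕ) ↔ d ∈ W k)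
    (hav : ∀ d : Fin m, avail (d : ℕ) ↔ d ∈ G.C v) (hβ : ∀ d : Fin m, β (d : ℕ) = G.bonus v d) :
    avail (c : ℕ) ∧ BestFor (predsNat G.E v) A m avail β (c : ℕ) ↔ G.Supports W v c := by
  unfold Game.Supports BestFor
  rw [hav]
  refine and_congr_right fun _ => ?_
  constructor
  · rintro ⟨f, h₁, h₂⟩
    let f' : Fin n → Fin m := fun k => if h : f k < m then ⟨f k, h⟩ else c
    have hf : ∀ k, (k, v) ∈ G.E → f (k : ℕ) = (f' k : ℕ) := by
      intro k hk
      have := (h₁ k (mem_predsNat.2 ⟨k, hk, rfl⟩)).1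
      simp [f', this]
    refine ⟨f', fun k hk => ?_, fun x hx => ?_⟩
    · rw [← hA k hk, ← hf k hk]
      exact (h₁ k (mem_predsNat.2 ⟨k, hk, rfl⟩)).2
    · have := h₂ x x.2 ((hav x).2 hx)
      rwa [card_predsNat_filter G.E v f f' hf, card_predsNat_filter G.E v f f' hf, hβ, hβ] at this
  · rintro ⟨f', h₁, h₂⟩
    let f : ℕ → ℕ := fun k => if h : k < n then f' ⟨k, h⟩ else 0
    have hf : ∀ k, (k, v) ∈ G.E → f (k : ℕ) = (f' k : ℕ) := by
      intro k _
      simp [f]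
    refine ⟨f, fun k hk => ?_, fun d hd hda => ?_⟩
    · obtain ⟨x, hx, rfl⟩ := mem_predsNat.1 hk
      rw [hf x hx]
      exact ⟨(f' x).2, (hA x hx _).2 (h₁ x hx)⟩
    · have := h₂ ⟨d, hd⟩ ((hav ⟨d, hd⟩).1 hda)
      rw [← card_predsNat_filter G.E v f f' hf, ← card_predsNat_filter G.E v f f' hf, ← hβ,
        ← hβ] at this
      exact this

/-! ### The main loop -/

/-- The variables that the main loop writes. -/
def mainVars (x : Var) : Prop := x ≠ .n ∧ x ≠ .m ∧ x ≠ .e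

/-- The arrays that the main loop writes. -/
def mainArrs (a : Arr) : Prop :=
  a ≠ .src ∧ a ≠ .dst ∧ a ≠ .avail ∧ a ≠ .bonus ∧ a ≠ .query ∧ a ≠ .ord

theorem Store.HasInput.of_preserved {n m : ℕ} {G : Game n m} {q : Query G} {s s₁ : Store}
    (h : s.HasInput G q) {out : Var → Prop} {outArr : Arr → Prop}
    (hP : s.Preserved s₁ out outArr) (hv : ∀ x, out x → mainVars x)
    (ha : ∀ a, outArr a → mainArrs a ∨ a = .ord) : s₁.HasInput G q := by
  have hvar : ∀ x, (∀ k, x ≠ .tmp k) → ¬ mainVars x → s₁.var x = s.var x :=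
    fun x h₁ h₂ => hP.1 x h₁ (mt (hv x) h₂)
  have harr : ∀ a, (∀ k, a ≠ .tmp k) → ¬ (mainArrs a ∨ a = .ord) → s₁.arr a = s.arr a :=
    fun a h₁ h₂ => hP.2 a h₁ (mt (ha a) h₂)
  have e₁ := hvar .n (by simp) (by simp [mainVars])
  have e₂ := hvar .m (by simp) (by simp [mainVars])
  have e₃ := hvar .e (by simp) (by simp [mainVars])
  have e₄ := harr .src (by simp) (by simp [mainArrs])
  have e₅ := harr .dst (by simp) (by simp [mainArrs])
  have e₆ := harr .avail (by simp) (by simp [mainArrs])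
  have e₇ := harr .bonus (by simp) (by simp [mainArrs])
  have e₈ := harr .query (by simp) (by simp [mainArrs])
  exact ⟨HasGraph.congr h.graph e₁ e₃ e₄ e₅, by rw [e₂, h.colours], by rw [e₆]; exact h.avail,
    by rw [e₇]; exact h.bonus, by rw [e₈]; exact h.query, by rw [e₈]; exact h.noQuery⟩

section Main

variable {n m : ℕ}

/-- After the node `v` was processed, `X(v)` is the set of its colours in Nash equilibria if this
holds for the predecessors of `v`. -/
theorem computeX_correct {b : Prop} {matching : Prog} (hM : MatchingSpec b matching)
    (G : Game n m) (q : Query G) (s : Store) (hs : s.HasInput G q) (σ : Fin n ≃ Fin n)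
    (hσ : ∀ p ∈ G.E, σ.symm p.1 < σ.symm p.2) (hout : OutDegreeLeOne G.E) (v : Fin n)
    (hv : s.var .v = (v : ℕ))
    (hX : ∀ k, (k, v) ∈ G.E → ∀ c : Fin m, s.arr .X (k : ℕ) (c : ℕ) = 1 ↔
      ∃ ρ, G.IsNash ρ ∧ ρ k = c) :
    WP (computeX matching) s fun t s₁ =>
      (b → t ≤ 900 * ((n + 1) * (m + 1) * (m + 1)) + 30 * (G.E.card + 1) +
        (predsNat G.E v).card * (m * augmentBound n m)) ∧
      s.Preserved s₁ computeVars computeArrs ∧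
      (∀ k d, k ≠ ((v : ℕ) : ℤ) → s₁.arr .X k d = s.arr .X k d) ∧
      ∀ c : Fin m, s₁.arr .X (v : ℕ) (c : ℕ) = 1 ↔ ∃ ρ, G.IsNash ρ ∧ ρ v = c := by
  have hm : (s.var .m).toNat = m := by simp [hs.colours]
  have h := computeX_spec hM G.E s hs.graph v hv (G.loopless v)
  rw [hm] at h
  refine h.mono fun t s₁ _ ⟨ht, hP, hrow, hc⟩ => ⟨ht, hP, hrow, fun c => ?_⟩
  rw [hc c c.2, G.exists_isNash_iff_supports σ hσ hout]
  refine bestFor_iff_supports G _ (fun k d => s.arr .X k d = 1) (fun d => s.arr .avail (v : ℕ) d = 1)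
    (fun d => s.arr .bonus (v : ℕ) d) v c (fun k hk d => hX k hk d) (fun d => ?_)
    (fun d => hs.bonus v d)
  rw [hs.avail]
  split_ifs with h <;> simp [h]

theorem checkQuery_correct (G : Game n m) (q : Query G) (s : Store) (hs : s.HasInput G q)
    (v : Fin n) (hv : s.var .v = (v : ℕ)) (hNE : ∃ ρ, G.IsNash ρ)
    (hX : ∀ c : Fin m, s.arr .X (v : ℕ) (c : ℕ) = 1 ↔ ∃ ρ, G.IsNash ρ ∧ ρ v = c) :
    WP checkQuery s fun t s₁ => t ≤ 60 * (m + 1) ∧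
      ((∃ i : q.Q, i = v ∧ (∃ ρ, G.IsNash ρ ∧ ρ i ≠ q.q i) ∧ s₁.var .ans = 0) ∨
        (∀ i : q.Q, i = v → ∀ ρ, G.IsNash ρ → ρ i = q.q i) ∧ s₁.var .ans = s.var .ans) := by
  have hm : (s.var .m).toNat = m := by simp [hs.colours]
  have h := checkQuery_spec s v hv
  rw [hm] at h
  refine h.mono fun t s₁ _ ⟨ht, h1, h2⟩ => ⟨ht, ?_⟩
  by_cases hvQ : v ∈ q.Q
  · have hq := hs.query ⟨v, hvQ⟩
    simp only at hq
    by_cases hbad : ∃ c < m, ¬ ((c : ℤ) = s.arr .query (v : ℕ) 0 ↔ s.arr .X (v : ℕ) c = 1)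
    · refine Or.inl ⟨⟨v, hvQ⟩, rfl, ?_, h1 ⟨by omega, hbad⟩⟩
      obtain ⟨c, hc, hne⟩ := hbad
      rw [hX ⟨c, hc⟩, hq, Nat.cast_inj] at hne
      -- If `q(v)` is missing from `X(v)`, any equilibrium refutes the query; this is where the
      -- existence of equilibria is needed.
      obtain ⟨ρ₀, hρ₀⟩ := hNE
      by_cases hcq : c = q.q ⟨v, hvQ⟩
      · refine ⟨ρ₀, hρ₀, fun he => hne (iff_of_true hcq ⟨ρ₀, hρ₀, ?_⟩)⟩
        exact Fin.ext ((congrArg Fin.val he).trans hcq.symm)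
      · have : ∃ ρ, G.IsNash ρ ∧ ρ v = ⟨c, hc⟩ := by
          by_contra hno
          exact hne (iff_of_false hcq hno)
        obtain ⟨ρ, hρ, hρv⟩ := this
        exact ⟨ρ, hρ, fun he => hcq (by rw [← he, hρv])⟩
    · refine Or.inr ⟨?_, h2 fun h => hbad h.2⟩
      rintro ⟨i, hi⟩ rfl ρ hρ
      by_contra hne
      refine hbad ⟨ρ i, (ρ i).2, fun hiff => hne (Fin.ext ?_)⟩
      rw [hX (ρ i), hq, Nat.cast_inj] at hiff
      exact hiff.2 ⟨ρ, hρ, rfl⟩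
  · have hq := hs.noQuery v hvQ
    refine Or.inr ⟨?_, h2 fun h => by omega⟩
    rintro ⟨i, hi⟩ rfl
    exact absurd hi hvQ

/-- The bound on the running time for a node, except for the matching tests. -/
def nodeBound (n m e : ℕ) : ℕ := 1000 * ((n + 1) * (m + 1) * (m + 1)) + 30 * (e + 1)

/-- The invariant speaks only of positions below `j`, since a NO may end the loop early. The
matching tests are charged to the edges whose target has been processed. -/
theorem algorithm_spec {b : Prop} {topsort matching : Prog} (hM : MatchingSpec b matching)
    (G : Game n m) (q : Query G) (s : Store) (hout : OutDegreeLeOne G.E)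
    (hs : s.HasInput G q) {T : ℕ}
    (htop : WP topsort s fun t s₁ => (b → t ≤ T) ∧
      (∃ σ : Fin n ≃ Fin n, (∀ k : Fin n, s₁.arr .ord (k : ℕ) 0 = (σ k : ℕ)) ∧
        ∀ p ∈ G.E, σ.symm p.1 < σ.symm p.2) ∧
      s.Preserved s₁ (fun _ => False) fun a => a = .ord) :
    WP (algorithm topsort matching) s fun t s₁ => s₁.Correct G q ∧
      (b → t ≤ T + nodeBound n m G.E.card * n + G.E.card * (m * augmentBound n m) + 20) := by
  unfold algorithm
  simp only [WP_seq, WP_assign]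
  refine htop.mono fun t₀ s₀ _ ⟨ht₀, ⟨σ, hord, hσ⟩, hP₀⟩ => ?_
  have hs₀ : s₀.HasInput G q := hs.of_preserved hP₀ (by simp) (by simp +contextual)
  have hNE := G.exists_isNash σ hσ
  refine WP_while (fun t k s' => ∃ j : ℕ, j + k = n ∧ s'.var .j = j ∧
    s₀.Preserved s' mainVars mainArrs ∧
    (∀ i : Fin n, (σ.symm i : ℕ) < j → ∀ c : Fin m, s'.arr .X (i : ℕ) (c : ℕ) = 1 ↔
      ∃ ρ, G.IsNash ρ ∧ ρ i = c) ∧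
    ((s'.var .ans = 0 ∧ ∃ i : q.Q, ∃ ρ, G.IsNash ρ ∧ ρ i ≠ q.q i) ∨
      (s'.var .ans = 1 ∧ ∀ i : q.Q, (σ.symm i : ℕ) < j → ∀ ρ, G.IsNash ρ → ρ i = q.q i)) ∧
    (b → t ≤ nodeBound n m G.E.card * j +
      (G.E.filter fun p => (σ.symm p.2 : ℕ) < j).card * (m * augmentBound n m)))
    (k₀ := n) ?_ ?_ ?_
  · refine ⟨0, by simp, by simp, ⟨fun x _ hx => ?_, fun _ _ _ => rfl⟩, by simp, by simp, by simp⟩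
    have h₁ : x ≠ .j := by
      rintro rfl
      exact hx (by simp [mainVars])
    have h₂ : x ≠ .ans := by
      rintro rfl
      exact hx (by simp [mainVars])
    simp [h₁, h₂]
  · rintro t k s' - ⟨j, hjk, hj, hP, hX, hans, ht⟩ hH
    have hn : s'.var .n = n := by
      rw [hP.1 .n (by simp) (by simp [mainVars]), hs₀.graph.1]
    simp only [Test.Holds, Expr.eval, hj, hn, Nat.cast_lt] at hH
    obtain ⟨hjn, hans1⟩ := hH
    have hans' := (hans.resolve_left fun h => by omega).2
    set v := σ ⟨j, hjn⟩ with hv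
    have hvj : (σ.symm v : ℕ) = j := by simp [hv]
    have hlt : ∀ k, (k, v) ∈ G.E → (σ.symm k : ℕ) < j := by
      intro k hk
      have : σ.symm k < σ.symm v := hσ _ hk
      rw [Fin.lt_def] at this
      omega
    have hordj : s'.arr .ord j 0 = (v : ℕ) := by
      rw [hP.2 .ord (by simp) (by simp [mainArrs])]
      exact hord ⟨j, hjn⟩
    simp only [WP_seq, WP_assign, Expr.get1, Expr.eval, hj, hordj]
    set s₁ := s'.setVar .v (v : ℕ) with hs₁
    have hP₁ : s'.Preserved s₁ mainVars mainArrs := by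
      refine ⟨fun x _ hx => ?_, fun _ _ _ => rfl⟩
      have : x ≠ .v := by
        rintro rfl
        exact hx (by simp [mainVars])
      simp [hs₁, this]
    have hI₁ : s₁.HasInput G q :=
      hs₀.of_preserved (hP.trans hP₁) (fun _ => id) fun _ => Or.inl
    refine (computeX_correct hM G q s₁ hI₁ σ hσ hout v (by simp [hs₁])
      fun k hk => hX k (hlt k hk)).mono fun t₂ s₂ _ ⟨ht₂, hP₂, hrow, hXv⟩ => ?_
    have hP₂' : s₁.Preserved s₂ mainVars mainArrs := hP₂.mono
      (by intro x; cases x <;> simp [computeVars, tryVars, mainVars])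
      (by intro x; cases x <;> simp [computeArrs, tryArrs, mainArrs])
    have hI₂ : s₂.HasInput G q := hI₁.of_preserved hP₂' (fun _ => id) fun _ => Or.inl
    have hv₂ : s₂.var .v = (v : ℕ) := by
      rw [hP₂.1 .v (by simp) (by simp [computeVars, tryVars])]
      simp [hs₁]
    refine (checkQuery_correct G q s₂ hI₂ v hv₂ hNE hXv).mono fun t₃ s₃ hF₃ ⟨ht₃, hcase⟩ => ?_
    have hj₃ : s₃.var .j = j := by
      rw [hF₃.1 .j rfl, hP₂.1 .j (by simp) (by simp [computeVars, tryVars])]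
      simp [hs₁, hj]
    have hX₃ : s₃.arr .X = s₂.arr .X := hF₃.2 .X rfl
    have ha₂ : s₂.var .ans = 1 := by
      rw [hP₂.1 .ans (by simp) (by simp [computeVars, tryVars])]
      simpa [hs₁] using hans1
    have hP₃ : s₂.Preserved s₃ mainVars mainArrs := by
      refine hF₃.preserved ?_ ?_ <;> intro x <;> cases x <;> simp [mainVars, mainArrs] <;> rfl
    refine ⟨k - 1, by omega, j + 1, by omega, by simp [hj₃], ?_, ?_, ?_, ?_⟩
    · have h := hP.trans (hP₁.trans (hP₂'.trans hP₃))
      refine ⟨fun x h₁ h₂ => ?_, h.2⟩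
      have : x ≠ .j := by
        rintro rfl
        exact h₂ (by simp [mainVars])
      simp [this, h.1 x h₁ h₂]
    · intro i hi c
      rw [setVar_arr, hX₃]
      by_cases hiv : i = v
      · rw [hiv]
        exact hXv c
      · have hij : (σ.symm i : ℕ) ≠ j := fun h => hiv (by
          rw [hv, ← Equiv.symm_apply_eq]
          exact Fin.ext h)
        rw [hrow _ _ (by
          rw [Ne, Nat.cast_inj]
          exact fun h => hiv (Fin.ext h))]
        exact hX i (by omega) c
    · simp only [setVar_var, reduceCtorEq, if_false]
      rcases hcase with ⟨i, _, hρ, ha⟩ | ⟨hall, ha⟩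
      · exact Or.inl ⟨ha, i, hρ⟩
      · refine Or.inr ⟨by rw [ha, ha₂], fun i hi => ?_⟩
        by_cases hiv : (i : Fin n) = v
        · exact hall i hiv
        · have hij : (σ.symm i : ℕ) ≠ j := fun h => hiv (by
            rw [hv, ← Equiv.symm_apply_eq]
            exact Fin.ext h)
          exact hans' i (by omega)
    · intro hb
      have h₁ := ht hb
      have h₂ := ht₂ hb
      -- The edges into `v` have not been charged before, as `v` has position `j`; so every edge
      -- pays once.
      have hcard : (G.E.filter fun p => (σ.symm p.2 : ℕ) < j).card + (predsNat G.E v).card ≤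
          (G.E.filter fun p => (σ.symm p.2 : ℕ) < j + 1).card := by
        have himg : (predsNat G.E v).card =
            ((Finset.univ.filter fun k => (k, v) ∈ G.E).image fun k => (k, v)).card := by
          rw [predsNat, Finset.card_map, Finset.card_image_of_injective]
          exact fun a b h => (Prod.ext_iff.1 h).1
        rw [himg, ← Finset.card_union_of_disjoint]
        · refine Finset.card_le_card fun p hp => ?_
          simp only [Finset.mem_union, Finset.mem_filter, Finset.mem_image, Finset.mem_univ,
            true_and] at hp ⊢
          rcases hp with hp | ⟨k, hk, rfl⟩
          · exact ⟨hp.1, by omega⟩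
          · exact ⟨hk, (hvj.trans_lt j.lt_succ_self :)⟩
        · rw [Finset.disjoint_left]
          intro p hp hp'
          simp only [Finset.mem_filter, Finset.mem_image, Finset.mem_univ, true_and] at hp hp'
          obtain ⟨k, hk, rfl⟩ := hp'
          exact (hp.2.trans_eq hvj.symm).false
      have h₃ := Nat.mul_le_mul_right (m * augmentBound n m) hcard
      rw [Nat.add_mul] at h₃
      rw [Nat.mul_succ]
      have h₄ : m + 1 ≤ (n + 1) * (m + 1) * (m + 1) := Nat.le_mul_of_pos_left _ (by positivity)
      simp only [Test.cost, Expr.cost]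
      have h₅ : nodeBound n m G.E.card =
        1000 * ((n + 1) * (m + 1) * (m + 1)) + 30 * (G.E.card + 1) := rfl
      omega
  · rintro t k s' - ⟨j, hjk, hj, hP, hX, hans, ht⟩ hH
    have hn : s'.var .n = n := by
      rw [hP.1 .n (by simp) (by simp [mainVars]), hs₀.graph.1]
    simp only [Test.Holds, Expr.eval, hj, hn, Nat.cast_lt] at hH
    refine ⟨?_, fun hb => ?_⟩
    · have hthird : ∀ (i : Fin n) (k : ℕ), (k : ℤ) < s'.var .j → s'.arr .ord k 0 = (i : ℕ) →
          ∀ c : Fin m, s'.arr .X (i : ℕ) (c : ℕ) = 1 ↔ ∃ ρ, G.IsNash ρ ∧ ρ i = c := by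
        intro i k hk hi
        rw [hj, Nat.cast_lt] at hk
        have hkn : k < n := by omega
        rw [hP.2 .ord (by simp) (by simp [mainArrs]), hord ⟨k, hkn⟩, Nat.cast_inj] at hi
        have hik : σ.symm i = ⟨k, hkn⟩ := by
          rw [Equiv.symm_apply_eq]
          exact Fin.ext hi.symm
        exact hX i (by rw [hik]; exact hk)
      rcases hans with ⟨ha, i, ρ, hρ, hne⟩ | ⟨ha, hall⟩
      · refine ⟨iff_of_false (by omega) fun h => hne (h ρ hρ i).symm,
          iff_of_true ha ⟨i, ρ, hρ, hne⟩, hthird⟩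
      · have hjn : j = n := by
          by_contra hne
          exact hH ⟨by omega, ha⟩
        have hall' : ∀ i : q.Q, ∀ ρ, G.IsNash ρ → ρ i = q.q i := fun i =>
          hall i (by rw [hjn]; exact (σ.symm i).2)
        refine ⟨iff_of_true ha fun ρ hρ i => (hall' i ρ hρ).symm,
          iff_of_false (by omega) ?_, hthird⟩
        rintro ⟨i, ρ, hρ, hne⟩
        exact hne (hall' i ρ hρ)
    · have h₁ := ht hb
      have h₂ := ht₀ hb
      have h₃ : (G.E.filter fun p => (σ.symm p.2 : ℕ) < j).card * (m * augmentBound n m) ≤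
          G.E.card * (m * augmentBound n m) :=
        Nat.mul_le_mul_right _ (Finset.card_filter_le _ _)
      have h₄ : nodeBound n m G.E.card * j ≤ nodeBound n m G.E.card * n :=
        Nat.mul_le_mul_left _ (by omega)
      simp only [Test.cost, Expr.cost]
      omega

end Main

/-! ### From the explicit bounds to the exponent `5 / 2` -/

theorem OutDegreeLeOne.card_le {n : ℕ} {E : Finset (Fin n × Fin n)} (h : OutDegreeLeOne E) :
    E.card ≤ n := by
  have hinj : Set.InjOn Prod.fst (E : Set (Fin n × Fin n)) := by
    intro a ha b hb hab
    exact Finset.card_le_one.1 (h a.1) a (by simpa using ha) b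
      (by simpa [hab] using hb)
  calc E.card = (E.image Prod.fst).card := (Finset.card_image_of_injOn hinj).symm
    _ ≤ Fintype.card (Fin n) := Finset.card_le_univ _
    _ = n := Fintype.card_fin n

/-- The sum of all bounds is of the order `(n m)² min(n, m)`. -/
theorem total_bound {n m e : ℕ} (hn : 1 ≤ n) (hm : 1 ≤ m) (he : e ≤ n) :
    130 * (n + 1) * (n + e + 1) + nodeBound n m e * n + e * (m * augmentBound n m) + 20 ≤
      20000 * ((n * m) ^ 2 * min n m) := by
  have hk : 1 ≤ min n m := le_min hn hm
  have h₁ : 130 * (n + 1) * (n + e + 1) ≤ 780 * (n * m) ^ 2 := by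
    have h : (n + 1) * (n + e + 1) ≤ (2 * n) * (3 * n) := Nat.mul_le_mul (by omega) (by omega)
    have h' : n * n ≤ (n * m) * (n * m) :=
      Nat.mul_le_mul (Nat.le_mul_of_pos_right _ hm) (Nat.le_mul_of_pos_right _ hm)
    nlinarith
  have h₂ : nodeBound n m e * n ≤ 8100 * (n * m) ^ 2 := by
    have h : (n + 1) * (m + 1) * (m + 1) ≤ (2 * n) * (2 * m) * (2 * m) :=
      Nat.mul_le_mul (Nat.mul_le_mul (by omega) (by omega)) (by omega)
    have h' : e + 1 ≤ 2 * (n * (m * m)) := by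
      have : n ≤ n * (m * m) := Nat.le_mul_of_pos_right _ (by positivity)
      omega
    have h'' : nodeBound n m e ≤ 8060 * (n * (m * m)) := by
      unfold nodeBound
      nlinarith
    calc nodeBound n m e * n ≤ 8060 * (n * (m * m)) * n := Nat.mul_le_mul_right _ h''
      _ = 8060 * (n * m) ^ 2 := by ring
      _ ≤ 8100 * (n * m) ^ 2 := Nat.mul_le_mul_right _ (by norm_num)
  have h₃ : e * (m * augmentBound n m) ≤ 2400 * ((n * m) ^ 2 * min n m) := by
    have h : augmentBound n m ≤ (300 * n) * (2 * m) * (4 * min n m) :=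
      Nat.mul_le_mul (Nat.mul_le_mul (by omega) (by omega)) (by omega)
    calc e * (m * augmentBound n m) ≤ n * (m * ((300 * n) * (2 * m) * (4 * min n m))) :=
          Nat.mul_le_mul he (Nat.mul_le_mul_left _ h)
      _ = 2400 * ((n * m) ^ 2 * min n m) := by ring
  have h₄ : (n * m) ^ 2 ≤ (n * m) ^ 2 * min n m := Nat.le_mul_of_pos_right _ hk
  have h₅ : 1 ≤ (n * m) ^ 2 := Nat.one_le_pow _ _ (Nat.mul_pos hn hm)
  omega

/-- The square of `min n m` is at most `n * m`, so the factor `min n m` costs half a power. -/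
theorem sq_mul_min_le_rpow {n m e : ℕ} :
    (((n * m) ^ 2 * min n m : ℕ) : ℝ) ≤ ((n * m + e : ℕ) : ℝ) ^ (5 / 2 : ℝ) := by
  have hmin : ((min n m : ℕ) : ℝ) ≤ Real.sqrt ((n * m : ℕ) : ℝ) := by
    apply Real.le_sqrt_of_sq_le
    rw [sq]
    exact_mod_cast Nat.mul_le_mul (min_le_left n m) (min_le_right n m)
  have hpow : ((n * m : ℕ) : ℝ) ^ (5 / 2 : ℝ) =
      ((n * m : ℕ) : ℝ) ^ 2 * Real.sqrt ((n * m : ℕ) : ℝ) := by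
    rw [Real.sqrt_eq_rpow, ← Real.rpow_natCast, ← Real.rpow_add_of_nonneg (by positivity)
      (by norm_num) (by norm_num)]
    norm_num
  calc (((n * m) ^ 2 * min n m : ℕ) : ℝ) = ((n * m : ℕ) : ℝ) ^ 2 * ((min n m : ℕ) : ℝ) := by
        push_cast
        ring
    _ ≤ ((n * m : ℕ) : ℝ) ^ 2 * Real.sqrt ((n * m : ℕ) : ℝ) := by gcongr
    _ = ((n * m : ℕ) : ℝ) ^ (5 / 2 : ℝ) := hpow.symm
    _ ≤ ((n * m + e : ℕ) : ℝ) ^ (5 / 2 : ℝ) := by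
        refine Real.rpow_le_rpow (by positivity) ?_ (by norm_num)
        exact_mod_cast Nat.le_add_right _ _

end CoordDag

theorem mainTheorem11 :
    (∀ topsort matching : CoordDag.Prog,
      CoordDag.IsTopologicalSort topsort → CoordDag.IsMatchingTest matching →
      ∀ (n m : ℕ) (G : CoordDag.Game n m) (q : CoordDag.Query G) (s : CoordDag.Store),
        CoordDag.IsAcyclic G.E → CoordDag.OutDegreeLeOne G.E → s.HasInput G q →
        ∃ (t : ℕ) (s₁ : CoordDag.Store),
          CoordDag.Exec (CoordDag.algorithm topsort matching) s t s₁ ∧ s₁.Correct G q) ∧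
    ∃ (topsort matching : CoordDag.Prog) (K : ℝ),
      CoordDag.IsTopologicalSort topsort ∧ CoordDag.IsMatchingTest matching ∧
      ∀ (n m : ℕ) (G : CoordDag.Game n m) (q : CoordDag.Query G) (s : CoordDag.Store),
        CoordDag.IsAcyclic G.E → CoordDag.OutDegreeLeOne G.E → s.HasInput G q →
        ∃ (t : ℕ) (s₁ : CoordDag.Store),
          CoordDag.Exec (CoordDag.algorithm topsort matching) s t s₁ ∧ s₁.Correct G q ∧
          (t : ℝ) ≤ K * (G.size : ℝ) ^ (5 / 2 : ℝ) := by
  open CoordDag in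
  refine ⟨fun topsort matching htop hmatch n m G q s hacyc hout hs => ?_, topologicalSort,
    matchingTest, 20000, isTopologicalSort_topologicalSort, isMatchingTest_matchingTest,
    fun n m G q s hacyc hout hs => ?_⟩
  -- With `b := False` the conditional time bounds are void, so nothing is asked of the speed of the
  -- subroutines.
  · have hM : MatchingSpec False matching := by
      intro s
      obtain ⟨t, s₁, he, h₁, h₂⟩ := hmatch s
      exact ⟨t, s₁, he, False.elim, h₁, h₂⟩
    have htop' : WP topsort s fun t s₁ => (False → t ≤ 0) ∧
        (∃ σ : Fin n ≃ Fin n, (∀ k : Fin n, s₁.arr .ord (k : ℕ) 0 = (σ k : ℕ)) ∧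
          ∀ p ∈ G.E, σ.symm p.1 < σ.symm p.2) ∧
        s.Preserved s₁ (fun _ => False) fun a => a = .ord := by
      obtain ⟨t, s₁, he, h₁, h₂⟩ := htop n G.E s hacyc hs.graph
      exact ⟨t, s₁, he, False.elim, h₁, h₂⟩
    obtain ⟨t, s₁, he, hc, _⟩ := algorithm_spec hM G q s hout hs htop'
    exact ⟨t, s₁, he, hc⟩
  · have hM : MatchingSpec True matchingTest := fun s =>
      (matchingTest_spec s).mono fun t s₁ hF ⟨ht, hf⟩ =>
        ⟨fun _ => ht, hf, matchingTest_preserved hF⟩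
    have htop' : WP topologicalSort s fun t s₁ =>
        (True → t ≤ 130 * (n + 1) * (n + G.E.card + 1)) ∧
        (∃ σ : Fin n ≃ Fin n, (∀ k : Fin n, s₁.arr .ord (k : ℕ) 0 = (σ k : ℕ)) ∧
          ∀ p ∈ G.E, σ.symm p.1 < σ.symm p.2) ∧
        s.Preserved s₁ (fun _ => False) fun a => a = .ord :=
      (topologicalSort_spec G.E hacyc s hs.graph).mono fun t s₁ hF ⟨ht, hσ⟩ =>
        ⟨fun _ => ht, hσ, topologicalSort_preserved hF⟩
    obtain ⟨t, s₁, he, hc, ht⟩ := algorithm_spec hM G q s hout hs htop'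
    refine ⟨t, s₁, he, hc, ?_⟩
    -- A queried node gives `1 ≤ n` and one of its colours gives `1 ≤ m`, so that additive constants
    -- are absorbed.
    obtain ⟨i, _⟩ := q.nonempty
    obtain ⟨c, _⟩ := G.nonempty i
    have h₁ := (ht trivial).trans (total_bound (by have := i.2; omega) (by have := c.2; omega)
      hout.card_le)
    calc (t : ℝ) ≤ ((20000 * ((n * m) ^ 2 * min n m) : ℕ) : ℝ) := by exact_mod_cast h₁
      _ = 20000 * (((n * m) ^ 2 * min n m : ℕ) : ℝ) := by push_cast; ring
      _ ≤ 20000 * (G.size : ℝ) ^ (5 / 2 : ℝ) := by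
          have := sq_mul_min_le_rpow (n := n) (m := m) (e := G.E.card)
          unfold Game.size
          linarith
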